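/- **Setting.** Let $T>0$, let $S\subset\mathbb R$ be finite, $\lambda_0:S\to[0,\infty)$, and let $\mu_0(u,\cdot)$ be a probability on $S$ for every $u\in S$. On a filtered probability space $(\Omega,(\mathcal F_t),P)$ let $W^1$ be an $(\mathcal F_t)$-Brownian motion and $N(\cdot;u,v)$, $(u,v)\in S\times S$, independent $(\mathcal F_t)$-Poisson processes with rates $\nu(\{(u,v)\})=\lambda_0(u)\mu_0(u,v)$, i.e. a Poisson random measure $N(dt,d\zeta)$ with marks $\zeta\in Z:=S\times S$. Let $K_0(x;(u,v))=\mathbf 1_{\{x=u\}}(v-u)$, and let $b_1(t,x,y)$, $\sigma_1(t,y)>0$, $K_1(t,x,y;\zeta)$ ($x\in S$) be real measurable functions. Assume that the system $$X_t=x_0+\int_0^t\!\int_Z K_0(X_{s^-};\zeta)N(ds,d\zeta),\qquad Y_t=y_0+\int_0^t b_1(s,X_s,Y_s)ds+\int_0^t\sigma_1(s,Y_s)dW^1_s+\int_0^t\!\int_Z K_1(s,X_{s^-},Y_{s^-};\zeta)N(ds,d\zeta)$$ ($x_0\in S$, $y_0\in\mathbb R$) has an adapted càdlàg solution $(X,Y)$,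 $X$ being $S$-valued, which is unique up to indistinguishability on $[0,T]$. Thus $X$ is a pure jump process on $S$. Assume $$E\int_0^T\Big(\int_Z|K_1(t,X_{t^-},Y_{t^-};\zeta)|\nu(d\zeta)+|b_1|+\sigma_1^2+\Big|\frac{b_1}{\sigma_1}\Big|\Big)dt<\infty ,$$ where $b_1,\sigma_1$ are evaluated at $(t,X_t,Y_t)$, and, for every $u\in S$, $\int_0^T\big(b_1(t,u,Y_t)/\sigma_1(t,Y_t)\big)^2dt<\infty$ $P$-a.s. **Filter and reference probability.** Let $\mathcal F^Y_t$ be generated by $Y_s$, $s\le t$, and the null events; let $\pi_t$ be the càdlàg version of the conditional law of $X_t$ given $\mathcal F^Y_t$; for $\rho$ a measure on $S$ and a function $F(t,x,y)$ put $\rho_t(F)=\int F(t,x,Y_t)\rho_t(dx)$ and $\rho_{t^-}(F)=\int F(t,x,Y_{t^-})\rho_{t^-}(dx)$. Assume $E\int_0^T\pi_t(|b_1/\sigma_1|)^2dt<\infty$. Let $m(dt,dz)=\sum_{s:\Delta Y_s\ne0}\delta_{(s,\Delta Y_s)}(dt,dz)$, $\lambda(t,x,y)=\nu(\zeta:K_1(t,x,y;\zeta)\neq0)$,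 and let $\lambda\phi(t,x,y,\cdot)$ be the measure $A\mapsto\nu(\zeta:K_1(t,x,y;\zeta)\in A\setminus\{0\})$ on $\mathbb R$. Let $\eta(t,y,dz)$ be a transition kernel such that $\eta_t:=\eta(t,Y_{t^-},\cdot)$ satisfies $E\int_0^T\eta_t(\mathbb R)dt<\infty$ and is equivalent to $\pi_{t^-}(\lambda\phi)$, namely $\pi_{t^-}(\lambda\phi(dz))=(1+\Psi(t,z))\eta_t(dz)$ with $\Psi>-1$ $\mathcal F^Y$-predictable. Put $$I_t=W^1_t+\int_0^t\Big\{\frac{b_1(s,X_s,Y_s)}{\sigma_1(s,Y_s)}-\pi_s\Big(\frac{b_1}{\sigma_1}\Big)\Big\}ds,\qquad \widetilde W^1_t=I_t+\int_0^t\pi_s\Big(\frac{b_1}{\sigma_1}\Big)ds,$$ let $Z=\mathcal E\big(-\int\pi_s(\tfrac{b_1}{\sigma_1})dI_s\big)\,\mathcal E\big(\int\!\!\int(\tfrac1{1+\Psi(s,z)}-1)(m(ds,dz)-\pi_{s^-}(\lambda\phi(dz))ds)\big)$ ($\mathcal E$ the Doléans-Dade exponential), assume that $Z$ is a $(P,\mathcal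 F^Y_t)$-martingale on $[0,T]$, and let $dP_0=Z_T\,dP$. **Zakai equation.** For $f\in C_b^{1,2}([0,T]\times\mathbb R)$ put $$L^X_0f(t,x,y)=\partial_tf(t,x)+\int_{\{K_1(t,x,y;\zeta)=0\}}[f(t,x+K_0(x;\zeta))-f(t,x)]\nu(d\zeta),$$ $$\overline Lf(t,x,y,A)=\int_{\{K_1(t,x,y;\zeta)\in A\setminus\{0\}\}}[f(t,x+K_0(x;\zeta))-f(t,x)]\nu(d\zeta).$$ A strong solution of the Zakai equation is an $\mathcal F^Y_t$-adapted càdlàg process $\xi$ of finite nonnegative measures on $S$ with $\xi_{t^-}(\lambda\phi)\ll\eta_t$ for a.e. $t\le T$, $P_0$-a.s., with $$\int_0^T\big\{\eta_s(\mathbb R)\,\xi_s(S)+\xi_s(\lambda^0)+\xi_{s}(\lambda(s,\cdot,Y_{s^-}))+\xi_s(|b_1/\sigma_1|)^2\big\}ds<\infty\quad P_0\text{-a.s.},$$ where $\lambda^0(x)=\nu(\zeta:K_0(x;\zeta)\ne0)$, and such that for every $f\in C_b^{1,2}([0,T]\times\mathbb R)$, $P_0$-a.s. for all $t\le T$, $$\xi_t(f)=f(0,x_0)+\int_0^t\{\xi_s(L_0^Xf)-\xi_s(\lambda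 f)+\eta_s(\mathbb R)\xi_s(f)\}ds+\int_0^t\frac{\xi_s(b_1f)}{\sigma_1(s,Y_s)}d\widetilde W^1_s$$ $$\qquad+\int_0^t\!\int_{\mathbb R}\Big\{\frac{d\xi_{s^-}(\lambda\phi f)}{d\eta_s}(z)-\xi_{s^-}(f)+\frac{d\xi_{s^-}(\overline Lf)}{d\eta_s}(z)\Big\}m(ds,dz).$$ **Proposition.** Pathwise uniqueness holds for the Zakai equation: if $\xi$ and $\xi'$ are strong solutions, then $P_0$-a.s. $\xi_t=\xi'_t$ for all $t\in[0,T]$. -/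

import Mathlib

open MeasureTheory ProbabilityTheory Filter Topology
open scoped NNReal ENNReal

noncomputable section

namespace PureJumpFilter

/-! ### General notions for processes indexed by `ℝ≥0` -/

/-- `∫₀ᵗ H s ds` for a function `H` of a time variable in `ℝ≥0`. -/
def timeIntegral (H : ℝ≥0 → ℝ) (t : ℝ≥0) : ℝ :=
  ∫ s in (0 : ℝ)..t, H s.toNNReal

/-- `∫₀ᵗ H s ds ∈ [0, ∞]` for a nonnegative function `H` of a time variable in `ℝ≥0`. -/
def timeLIntegral (H : ℝ≥0 → ℝ≥0∞) (t : ℝ≥0) : ℝ≥0∞ :=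
  ∫⁻ s in Set.Icc (0 : ℝ) t, H s.toNNReal

/-- Right-continuous paths with left limits. -/
def IsCadlag {E : Type*} [TopologicalSpace E] (x : ℝ≥0 → E) : Prop :=
  ∀ t, ContinuousWithinAt x (Set.Ici t) t ∧ ∃ l, Tendsto x (𝓝[<] t) (𝓝 l)

/-- The jump `Δ y s = y s - y (s-)` of a path. -/
def jump (y : ℝ≥0 → ℝ) (s : ℝ≥0) : ℝ := y s - Function.leftLim y s

variable {Ω : Type*} {mΩ : MeasurableSpace Ω}

/-- The σ-algebra generated by the null events. -/
@[reducible] def nullSigma (P : Measure Ω) : MeasurableSpace Ω :=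
  MeasurableSpace.generateFrom {A | MeasurableSet A ∧ P A = 0}

theorem nullSigma_le (P : Measure Ω) : nullSigma P ≤ mΩ :=
  MeasurableSpace.generateFrom_le fun _ h => h.1

/-- The observation filtration `σ(Y s : s ≤ t)`, augmented by the null events. -/
def obsFiltration (P : Measure Ω) (Y : ℝ≥0 → Ω → ℝ) (hY : ∀ t, StronglyMeasurable (Y t)) :
    Filtration ℝ≥0 mΩ :=
  Filtration.natural Y hY ⊔ Filtration.const ℝ≥0 (nullSigma P) (nullSigma_le P)

/-- `W` is a standard Brownian motion relative to the filtration `𝓕`. -/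
structure IsBrownianWrt (P : Measure Ω) (𝓕 : Filtration ℝ≥0 mΩ) (W : ℝ≥0 → Ω → ℝ) : Prop where
  brownian : IsBrownianReal W P
  adapted : ∀ t, Measurable[𝓕 t] (W t)
  indep : ∀ s t, s ≤ t →
    Indep (MeasurableSpace.comap (fun ω => W t ω - W s ω) inferInstance) (𝓕 s) P

/-- `N i`, `i : ι`, are independent Poisson processes with rates `r i` relative to the
filtration `𝓕`; for finite `ι` this is a Poisson random measure on `ℝ₊ × ι` with intensity
`dt ⊗ r`. -/
structure IsPoissonFamily {ι : Type*} (P : Measure Ω) (𝓕 : Filtration ℝ≥0 mΩ)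
    (N : ι → ℝ≥0 → Ω → ℕ) (r : ι → ℝ≥0) : Prop where
  adapted : ∀ i t, Measurable[𝓕 t] (N i t)
  paths : ∀ i, ∀ᵐ ω ∂P, N i 0 ω = 0 ∧ Monotone (fun t => N i t ω) ∧ IsCadlag (fun t => N i t ω)
  law : ∀ i s t, s ≤ t → HasLaw (fun ω => N i t ω - N i s ω) (poissonMeasure (r i * (t - s))) P
  indep : ∀ s t, s ≤ t → iIndepFun (fun i ω => N i t ω - N i s ω) P
  indep_past : ∀ s t, s ≤ t →
    Indep (MeasurableSpace.comap (fun ω i => N i t ω - N i s ω) MeasurableSpace.pi) (𝓕 s) P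

/-- Elementary integrands `∑_{i < n} c i · 1_{(τ i, τ (i+1)]}` with `c i` bounded and
`𝓕 (τ i)`-measurable. -/
structure SimpleIntegrand (𝓕 : Filtration ℝ≥0 mΩ) where
  n : ℕ
  τ : ℕ → ℝ≥0
  mono : Monotone τ
  c : ℕ → Ω → ℝ
  measurable_c : ∀ i, Measurable[𝓕 (τ i)] (c i)
  bounded_c : ∃ C, ∀ i ω, |c i ω| ≤ C

def SimpleIntegrand.value {𝓕 : Filtration ℝ≥0 mΩ} (H : SimpleIntegrand 𝓕) (s : ℝ≥0) (ω : Ω) : ℝ :=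
  ∑ i ∈ Finset.range H.n, (Set.Ioc (H.τ i) (H.τ (i + 1))).indicator (fun _ => H.c i ω) s

def SimpleIntegrand.integral {𝓕 : Filtration ℝ≥0 mΩ} (H : SimpleIntegrand 𝓕) (W : ℝ≥0 → Ω → ℝ)
    (t : ℝ≥0) (ω : Ω) : ℝ :=
  ∑ i ∈ Finset.range H.n, H.c i ω * (W (min (H.τ (i + 1)) t) ω - W (min (H.τ i) t) ω)

/-- `M` is the Itô integral process `∫₀ᵗ H dW`, `t ≤ T`, of the integrand `H` against the Brownian
motion `W` under `Q`: the limit, uniformly on `[0, T]` in probability, of the integrals of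
elementary processes `Hₙ` with `∫₀ᵀ |Hₙ - H|² ds → 0` in probability. -/
def IsItoIntegral (Q : Measure Ω) (𝓖 : Filtration ℝ≥0 mΩ) (T : ℝ≥0)
    (W H M : ℝ≥0 → Ω → ℝ) : Prop :=
  ∃ Hn : ℕ → SimpleIntegrand 𝓖, ∀ ε : ℝ≥0∞, 0 < ε →
    Tendsto (fun n => Q {ω | ε ≤ timeLIntegral
      (fun s => ‖(Hn n).value s ω - H s ω‖ₑ ^ 2) T}) atTop (𝓝 0) ∧
    Tendsto (fun n => Q {ω | ε ≤ ⨆ t ∈ Set.Iic T,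
      ‖(Hn n).integral W t ω - M t ω‖ₑ}) atTop (𝓝 0)

/-- Test functions of class `C_b^{1,2}`: bounded, with bounded continuous derivatives
`∂ₜ f`, `∂ₓ f`, `∂ₓₓ f`. Only the values for times in `[0, T]` are ever used. -/
structure IsTestFunction (f : ℝ → ℝ → ℝ) : Prop where
  differentiable_t : ∀ x, Differentiable ℝ (fun t => f t x)
  differentiable_x : ∀ t, Differentiable ℝ (f t)
  differentiable_xx : ∀ t, Differentiable ℝ (deriv (f t))
  continuous : Continuous (fun p : ℝ × ℝ => f p.1 p.2)
  continuous_t : Continuous (fun p : ℝ × ℝ => deriv (fun t => f t p.2) p.1)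
  continuous_x : Continuous (fun p : ℝ × ℝ => deriv (f p.1) p.2)
  continuous_xx : Continuous (fun p : ℝ × ℝ => deriv (deriv (f p.1)) p.2)
  bounded : ∃ C, ∀ t x, |f t x| ≤ C ∧ |deriv (fun t => f t x) t| ≤ C ∧ |deriv (f t) x| ≤ C ∧
    |deriv (deriv (f t)) x| ≤ C

/-! ### The model -/

/-- The data of the partially observed system: a finite state space `S ⊆ ℝ`, the jump rate `lam0`
and the jump distribution `mu0` of the signal, and the coefficients of the observation. The marks
of the driving Poisson random measure are the pairs `(u, v) ∈ S × S`. -/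
structure Model where
  S : Finset ℝ
  lam0 : S → ℝ≥0
  mu0 : S → S → ℝ≥0
  sum_mu0 : ∀ u, ∑ v, mu0 u v = 1
  b1 : ℝ≥0 → S → ℝ → ℝ
  sigma1 : ℝ≥0 → ℝ → ℝ
  K1 : ℝ≥0 → S → ℝ → S × S → ℝ
  measurable_b1 : ∀ x, Measurable (fun p : ℝ≥0 × ℝ => b1 p.1 x p.2)
  measurable_sigma1 : Measurable (fun p : ℝ≥0 × ℝ => sigma1 p.1 p.2)
  measurable_K1 : ∀ x ζ, Measurable (fun p : ℝ≥0 × ℝ => K1 p.1 x p.2 ζ)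
  sigma1_pos : ∀ t y, 0 < sigma1 t y
  x0 : S
  y0 : ℝ

namespace Model

variable (𝓜 : Model)

/-- The rate `ν({(u, v)}) = λ₀(u) μ₀(u, v)`. -/
def rate (ζ : 𝓜.S × 𝓜.S) : ℝ≥0 := 𝓜.lam0 ζ.1 * 𝓜.mu0 ζ.1 ζ.2

/-- The intensity measure `ν` on the mark space `S × S`. -/
def nu : Measure (𝓜.S × 𝓜.S) := ∑ ζ, 𝓜.rate ζ • Measure.dirac ζ

instance : IsFiniteMeasure 𝓜.nu := by
  unfold nu
  infer_instance

/-- `K₀(x; (u, v)) = 1_{x = u} (v - u)`. -/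
def K0 (x : 𝓜.S) (ζ : 𝓜.S × 𝓜.S) : ℝ := if x = ζ.1 then (ζ.2 : ℝ) - ζ.1 else 0

/-- The marks that make the observation jump. -/
def d1 (t : ℝ≥0) (x : 𝓜.S) (y : ℝ) : Set (𝓜.S × 𝓜.S) := {ζ | 𝓜.K1 t x y ζ ≠ 0}

/-- The jump intensity `λ(t, x, y) = ν(d¹(t, x, y))` of the observation. -/
def lam (t : ℝ≥0) (x : 𝓜.S) (y : ℝ) : ℝ≥0∞ := 𝓜.nu (𝓜.d1 t x y)

/-- The jump intensity `λ⁰(x) = ν(K₀(x; ·) ≠ 0)` of the signal. -/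
def lamX (x : 𝓜.S) : ℝ≥0∞ := 𝓜.nu {ζ | 𝓜.K0 x ζ ≠ 0}

/-- The measure `λ φ(t, x, y, dz)`, i.e. `A ↦ ν(ζ : K₁(t, x, y; ζ) ∈ A \ {0})`. -/
def lamPhi (t : ℝ≥0) (x : 𝓜.S) (y : ℝ) : Measure ℝ :=
  (𝓜.nu.restrict (𝓜.d1 t x y)).map (𝓜.K1 t x y)

instance (t : ℝ≥0) (x : 𝓜.S) (y : ℝ) : IsFiniteMeasure (𝓜.lamPhi t x y) := by
  unfold lamPhi
  infer_instance

/-- The measure `ρ(λ φ)(dz) = ∫ λ φ(t, x, y, dz) ρ(dx)`. -/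
def mixLamPhi (ρ : Measure 𝓜.S) (t : ℝ≥0) (y : ℝ) : Measure ℝ :=
  ∑ x, ρ {x} • 𝓜.lamPhi t x y

/-- The signed measure `ρ(λ φ f)(dz) = ∫ f(t, x) λ φ(t, x, y, dz) ρ(dx)`. -/
def mixLamPhiTest (ρ : Measure 𝓜.S) (f : ℝ → ℝ → ℝ) (t : ℝ≥0) (y : ℝ) : SignedMeasure ℝ :=
  ∑ x : 𝓜.S, (ρ.real {x} * f t x) • (𝓜.lamPhi t x y).toSignedMeasure

/-- The signed measure `L̄ f(t, x, y, A) = ∫_{ζ : K₁ ∈ A \ {0}} [f(t, x + K₀) - f(t, x)] ν(dζ)`,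
which records the common jumps of signal and observation. -/
def Lbar (f : ℝ → ℝ → ℝ) (t : ℝ≥0) (x : 𝓜.S) (y : ℝ) : SignedMeasure ℝ :=
  ((𝓜.nu.restrict (𝓜.d1 t x y)).withDensityᵥ
    (fun ζ => f t (x + 𝓜.K0 x ζ) - f t x)).map (𝓜.K1 t x y)

/-- The signed measure `ρ(L̄ f)(dz)`. -/
def mixLbar (ρ : Measure 𝓜.S) (f : ℝ → ℝ → ℝ) (t : ℝ≥0) (y : ℝ) : SignedMeasure ℝ :=
  ∑ x : 𝓜.S, ρ.real {x} • 𝓜.Lbar f t x y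

/-- `L₀ˣ f = ∂ₜ f + ∫_{K₁ = 0} [f(t, x + K₀) - f(t, x)] ν(dζ)`. -/
def L0 (f : ℝ → ℝ → ℝ) (t : ℝ≥0) (x : 𝓜.S) (y : ℝ) : ℝ :=
  deriv (fun s => f s x) t +
    ∫ ζ in {ζ | 𝓜.K1 t x y ζ = 0}, (f t (x + 𝓜.K0 x ζ) - f t x) ∂𝓜.nu

/-- `(b₁ / σ₁)(t, x, y)`. -/
def ratio (t : ℝ≥0) (x : 𝓜.S) (y : ℝ) : ℝ := 𝓜.b1 t x y / 𝓜.sigma1 t y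

/-- `(X, Y)` solves, on `[0, T]`, the system
`dX = ∫ K₀(X₋; ζ) N(dt, dζ)`,
`dY = b₁(t, X, Y) dt + σ₁(t, Y) dW + ∫ K₁(t, X₋, Y₋; ζ) N(dt, dζ)`, `X₀ = x₀`, `Y₀ = y₀`. -/
structure IsSolution (P : Measure Ω) (𝓕 : Filtration ℝ≥0 mΩ) (T : ℝ≥0) (W : ℝ≥0 → Ω → ℝ)
    (N : 𝓜.S × 𝓜.S → ℝ≥0 → Ω → ℕ) (X : ℝ≥0 → Ω → 𝓜.S) (Y : ℝ≥0 → Ω → ℝ) : Prop where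
  adapted_X : ∀ t, Measurable[𝓕 t] (X t)
  adapted_Y : ∀ t, Measurable[𝓕 t] (Y t)
  cadlag_X : ∀ᵐ ω ∂P, IsCadlag (fun t => X t ω)
  cadlag_Y : ∀ᵐ ω ∂P, IsCadlag (fun t => Y t ω)
  integrable_b1 : ∀ᵐ ω ∂P, timeLIntegral (fun s => ‖𝓜.b1 s (X s ω) (Y s ω)‖ₑ) T < ∞
  equation_X : ∀ᵐ ω ∂P, ∀ t ≤ T, (X t ω : ℝ) = 𝓜.x0 +
    ∑ ζ, ∑ᶠ s ∈ Set.Ioc 0 t,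
      𝓜.K0 (Function.leftLim (fun r => X r ω) s) ζ * jump (fun r => (N ζ r ω : ℝ)) s
  equation_Y : ∃ M : ℝ≥0 → Ω → ℝ,
    IsItoIntegral P 𝓕 T W (fun s ω => 𝓜.sigma1 s (Y s ω)) M ∧
    ∀ᵐ ω ∂P, ∀ t ≤ T, Y t ω = 𝓜.y0 +
      timeIntegral (fun s => 𝓜.b1 s (X s ω) (Y s ω)) t + M t ω +
      ∑ ζ, ∑ᶠ s ∈ Set.Ioc 0 t,
        𝓜.K1 s (Function.leftLim (fun r => X r ω) s) (Function.leftLim (fun r => Y r ω) s) ζ *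
          jump (fun r => (N ζ r ω : ℝ)) s

/-- Integrability of the coefficients along the system. The corresponding conditions on `K₀` and
on the total jump intensity hold automatically because `S` is finite. -/
structure IsIntegrableSystem (P : Measure Ω) (T : ℝ≥0) (X : ℝ≥0 → Ω → 𝓜.S) (Y : ℝ≥0 → Ω → ℝ) :
    Prop where
  K1 : ∫⁻ ω, timeLIntegral (fun s => ∫⁻ ζ, ‖𝓜.K1 s (Function.leftLim (fun r => X r ω) s)
    (Function.leftLim (fun r => Y r ω) s) ζ‖ₑ ∂𝓜.nu) T ∂P < ∞
  b1 : ∫⁻ ω, timeLIntegral (fun s => ‖𝓜.b1 s (X s ω) (Y s ω)‖ₑ) T ∂P < ∞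
  sigma1 : ∫⁻ ω, timeLIntegral (fun s => ‖𝓜.sigma1 s (Y s ω)‖ₑ ^ 2) T ∂P < ∞
  ratio : ∫⁻ ω, timeLIntegral (fun s => ‖𝓜.ratio s (X s ω) (Y s ω)‖ₑ) T ∂P < ∞

/-- `π` is the filter: the càdlàg version of the conditional law of `X t` given the observation
σ-algebra at time `t`. -/
structure IsFilter (P : Measure Ω) (𝓨 : Filtration ℝ≥0 mΩ) (T : ℝ≥0) (X : ℝ≥0 → Ω → 𝓜.S)
    (π : ℝ≥0 → Ω → ProbabilityMeasure 𝓜.S) : Prop where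
  adapted : ∀ t ≤ T, Measurable[𝓨 t] (π t)
  cadlag : ∀ᵐ ω ∂P, IsCadlag (fun t => π t ω)
  condExp : ∀ t ≤ T, ∀ g : 𝓜.S → ℝ,
    (fun ω => ∫ x, g x ∂(π t ω : Measure 𝓜.S)) =ᵐ[P] P[fun ω => g (X t ω) | 𝓨 t]

/-- `π_t(b₁ / σ₁)`. -/
def filteredRatio (Y : ℝ≥0 → Ω → ℝ) (π : ℝ≥0 → Ω → ProbabilityMeasure 𝓜.S)
    (t : ℝ≥0) (ω : Ω) : ℝ :=
  ∫ x, 𝓜.ratio t x (Y t ω) ∂(π t ω : Measure 𝓜.S)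

/-- The measure `π_{t-}(λ φ)(dz)`. -/
def filteredLamPhi (Y : ℝ≥0 → Ω → ℝ) (π : ℝ≥0 → Ω → ProbabilityMeasure 𝓜.S)
    (t : ℝ≥0) (ω : Ω) : Measure ℝ :=
  𝓜.mixLamPhi (Function.leftLim (fun s => π s ω) t : ProbabilityMeasure 𝓜.S) t
    (Function.leftLim (fun s => Y s ω) t)

/-- The innovation process `I_t = W_t + ∫₀ᵗ {b₁(s)/σ₁(s) - π_s(b₁/σ₁)} ds`. -/
def innovation (W : ℝ≥0 → Ω → ℝ) (X : ℝ≥0 → Ω → 𝓜.S) (Y : ℝ≥0 → Ω → ℝ)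
    (π : ℝ≥0 → Ω → ProbabilityMeasure 𝓜.S) (t : ℝ≥0) (ω : Ω) : ℝ :=
  W t ω + timeIntegral (fun s => 𝓜.ratio s (X s ω) (Y s ω) - 𝓜.filteredRatio Y π s ω) t

/-- `W̃_t = I_t + ∫₀ᵗ π_s(b₁/σ₁) ds`. -/
def Wtilde (W : ℝ≥0 → Ω → ℝ) (X : ℝ≥0 → Ω → 𝓜.S) (Y : ℝ≥0 → Ω → ℝ)
    (π : ℝ≥0 → Ω → ProbabilityMeasure 𝓜.S) (t : ℝ≥0) (ω : Ω) : ℝ :=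
  𝓜.innovation W X Y π t ω + timeIntegral (fun s => 𝓜.filteredRatio Y π s ω) t

/-- The transition function `η(t, y, dz)` gives a measure `η_t = η(t, Y_{t-}, ·)` that is
integrable in mean and equivalent to `π_{t-}(λ φ)`, with
`π_{t-}(λ φ)(dz) = (1 + Ψ(t, z)) η_t(dz)` for a predictable `Ψ > -1`. -/
structure IsReference (P : Measure Ω) (𝓨 : Filtration ℝ≥0 mΩ) (T : ℝ≥0) (Y : ℝ≥0 → Ω → ℝ)
    (π : ℝ≥0 → Ω → ProbabilityMeasure 𝓜.S) (η : Kernel (ℝ≥0 × ℝ) ℝ)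
    (Ψ : ℝ≥0 → Ω → ℝ → ℝ) : Prop where
  integrable : ∫⁻ ω, timeLIntegral
    (fun s => η (s, Function.leftLim (fun r => Y r ω) s) Set.univ) T ∂P < ∞
  predictable : Measurable[𝓨.predictable.prod inferInstance]
    (fun p : (ℝ≥0 × Ω) × ℝ => Ψ p.1.1 p.1.2 p.2)
  pos : ∀ᵐ ω ∂P, ∀ t ≤ T, ∀ z, 0 < 1 + Ψ t ω z
  density : ∀ᵐ ω ∂P, ∀ᵐ t ∂(volume.restrict (Set.Icc (0 : ℝ) T)),
    𝓜.filteredLamPhi Y π t.toNNReal ω =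
      (η (t.toNNReal, Function.leftLim (fun r => Y r ω) t.toNNReal)).withDensity
        (fun z => ENNReal.ofReal (1 + Ψ t.toNNReal ω z))

/-- The density process `Z = Z⁰ Z¹`, where `Z⁰` is the Doléans-Dade exponential of
`- ∫ π(b₁/σ₁) dI` and `Z¹` that of `∫∫ (1/(1+Ψ) - 1) (m(ds, dz) - π_{s-}(λ φ)(dz) ds)`, in closed
form. Here `J` stands for the Itô integral `∫ π(b₁/σ₁) dI` and `m` is the jump measure of `Y`. -/
def girsanovDensity (Y : ℝ≥0 → Ω → ℝ) (π : ℝ≥0 → Ω → ProbabilityMeasure 𝓜.S)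
    (Ψ : ℝ≥0 → Ω → ℝ → ℝ) (J : ℝ≥0 → Ω → ℝ) (t : ℝ≥0) (ω : Ω) : ℝ :=
  Real.exp (- J t ω - timeIntegral (fun s => 𝓜.filteredRatio Y π s ω ^ 2) t / 2) *
  (Real.exp (- timeIntegral
      (fun s => ∫ z, ((1 + Ψ s ω z)⁻¹ - 1) ∂(𝓜.filteredLamPhi Y π s ω)) t) *
    ∏ᶠ s ∈ {s | s ∈ Set.Ioc 0 t ∧ jump (fun r => Y r ω) s ≠ 0},
      (1 + ((1 + Ψ s ω (jump (fun r => Y r ω) s))⁻¹ - 1)))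

/-- The reference probability `dP₀ = Z_T dP`; only its restriction to the observation σ-algebra
at time `T` matters. -/
def referenceMeasure (P : Measure Ω) (T : ℝ≥0) (Y : ℝ≥0 → Ω → ℝ)
    (π : ℝ≥0 → Ω → ProbabilityMeasure 𝓜.S) (Ψ : ℝ≥0 → Ω → ℝ → ℝ) (J : ℝ≥0 → Ω → ℝ) :
    Measure Ω :=
  P.withDensity (fun ω => ENNReal.ofReal (𝓜.girsanovDensity Y π Ψ J T ω))

/-! ### The Zakai equation -/

/-- `ξ_t(f) = ∫ f(t, x) ξ_t(dx)`. -/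
def pairing (ρ : Measure 𝓜.S) (f : ℝ → ℝ → ℝ) (t : ℝ≥0) : ℝ := ∫ x : 𝓜.S, f t x ∂ρ

/-- The drift `ξ_t(L₀ˣ f) - ξ_t(λ f) + η_t(ℝ) ξ_t(f)`. -/
def zakaiDrift (Y : ℝ≥0 → Ω → ℝ) (η : Kernel (ℝ≥0 × ℝ) ℝ) (f : ℝ → ℝ → ℝ)
    (ξ : ℝ≥0 → Ω → FiniteMeasure 𝓜.S) (t : ℝ≥0) (ω : Ω) : ℝ :=
  (∫ x, 𝓜.L0 f t x (Y t ω) ∂(ξ t ω : Measure 𝓜.S))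
  - (∫ x, (𝓜.lam t x (Y t ω)).toReal * f t x ∂(ξ t ω : Measure 𝓜.S))
  + (η (t, Function.leftLim (fun r => Y r ω) t)).real Set.univ * 𝓜.pairing (ξ t ω) f t

/-- The diffusion coefficient `ξ_t(b₁ f) / σ₁(t)`. -/
def zakaiDiffusion (Y : ℝ≥0 → Ω → ℝ) (f : ℝ → ℝ → ℝ)
    (ξ : ℝ≥0 → Ω → FiniteMeasure 𝓜.S) (t : ℝ≥0) (ω : Ω) : ℝ :=
  (∫ x, 𝓜.b1 t x (Y t ω) * f t x ∂(ξ t ω : Measure 𝓜.S)) / 𝓜.sigma1 t (Y t ω)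

/-- The jump coefficient
`dξ_{t-}(λ φ f)/dη_t (z) - ξ_{t-}(f) + dξ_{t-}(L̄ f)/dη_t (z)`. -/
def zakaiJump (Y : ℝ≥0 → Ω → ℝ) (η : Kernel (ℝ≥0 × ℝ) ℝ) (f : ℝ → ℝ → ℝ)
    (ξ : ℝ≥0 → Ω → FiniteMeasure 𝓜.S) (t : ℝ≥0) (ω : Ω) (z : ℝ) : ℝ :=
  let ξl : Measure 𝓜.S := (Function.leftLim (fun s => ξ s ω) t : FiniteMeasure 𝓜.S)
  let yl : ℝ := Function.leftLim (fun s => Y s ω) t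
  (𝓜.mixLamPhiTest ξl f t yl).rnDeriv (η (t, yl)) z - 𝓜.pairing ξl f t
    + (𝓜.mixLbar ξl f t yl).rnDeriv (η (t, yl)) z

/-- Strong solutions of the Zakai equation on `[0, T]`. The integral against the jump measure
`m(ds, dz) = ∑_{ΔY_s ≠ 0} δ_{(s, ΔY_s)}` is the sum over the jumps of `Y`. -/
structure IsZakaiSolution (P₀ : Measure Ω) (𝓨 : Filtration ℝ≥0 mΩ) (T : ℝ≥0)
    (Wt : ℝ≥0 → Ω → ℝ) (Y : ℝ≥0 → Ω → ℝ) (η : Kernel (ℝ≥0 × ℝ) ℝ)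
    (ξ : ℝ≥0 → Ω → FiniteMeasure 𝓜.S) : Prop where
  adapted : ∀ t ≤ T, Measurable[𝓨 t] (ξ t)
  cadlag : ∀ᵐ ω ∂P₀, IsCadlag (fun t => ξ t ω)
  absolutelyContinuous : ∀ᵐ ω ∂P₀, ∀ᵐ t ∂(volume.restrict (Set.Icc (0 : ℝ) T)),
    𝓜.mixLamPhi (Function.leftLim (fun s => ξ s ω) t.toNNReal : FiniteMeasure 𝓜.S) t.toNNReal
      (Function.leftLim (fun s => Y s ω) t.toNNReal) ≪
      η (t.toNNReal, Function.leftLim (fun s => Y s ω) t.toNNReal)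
  integrable : ∀ᵐ ω ∂P₀, timeLIntegral (fun s =>
    (∫⁻ x, (η (s, Function.leftLim (fun r => Y r ω) s) Set.univ + 𝓜.lamX x +
        𝓜.lam s x (Function.leftLim (fun r => Y r ω) s)) ∂(ξ s ω : Measure 𝓜.S)) +
      (∫⁻ x, ‖𝓜.ratio s x (Y s ω)‖ₑ ∂(ξ s ω : Measure 𝓜.S)) ^ 2) T < ∞
  equation : ∀ f : ℝ → ℝ → ℝ, IsTestFunction f → ∃ M : ℝ≥0 → Ω → ℝ,
    IsItoIntegral P₀ 𝓨 T Wt (𝓜.zakaiDiffusion Y f ξ) M ∧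
    ∀ᵐ ω ∂P₀, ∀ t ≤ T, 𝓜.pairing (ξ t ω) f t = f 0 𝓜.x0 +
      timeIntegral (fun s => 𝓜.zakaiDrift Y η f ξ s ω) t + M t ω +
      ∑ᶠ s ∈ {s | s ∈ Set.Ioc 0 t ∧ jump (fun r => Y r ω) s ≠ 0},
        𝓜.zakaiJump Y η f ξ s ω (jump (fun r => Y r ω) s)

end Model

end PureJumpFilter

end

/-! Since `S` is finite, a measure on `S` is determined by its masses at the points of `S`. Testing
the Zakai equation with smooth functions equal to 1 at one state and 0 at the others turns it into a
finite linear system for these masses. The filter terms cancel in the driving process: W̃ = W¹ + ∫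
(b₁/σ₁)(s, X_s, Y_s) ds. The density Z_T is positive, so P and P₀ have the same null sets. One may
therefore work under P and drive the system by the original Brownian motion W¹, relative to the full
filtration augmented by null events (`IsZakaiSolution.exists_representation`).

Let d be the vector of differences of the masses of two solutions. The jump term at time s depends
on a solution only through its left limit at s, so as long as d vanishes before s the two jumps
agree. Hence d can leave 0 only continuously, at some θ with d_θ = 0. Jumps of Y occur only at jumps
of the Poisson processes, and these are constant for a short time after θ. On that stretch d solves
a linear Itô system whose coefficients are dominated by a clock, the density 1 + η(ℝ) + ∑ (b₁/σ₁)²,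
with finite integral. Stop when the integrated clock has advanced by a small ε since θ. Doob's
inequality and the Itô isometry then give E S² ≤ ½ E S² for the supremum S of |d|, so S = 0 and d
never leaves 0. No induction over the jump times is needed.

Stopping times are replaced by the decreasing adapted events `Tame`, which play the role of {t ≤ τ}.
The estimates are `lintegral_sup_ito_le` (maximal inequality on a decreasing family of events) and
`timeLIntegral_tame_le` (the clock is small on tame times). `eq_zero_of_tame_eq_zero` shows that a
path leaving 0 is tame right afterwards. `ae_eq_zero_of_linear_ito` combines them, and
`IsZakaiSolution.ae_eq` applies the result to the masses. -/

noncomputable section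
namespace PureJumpFilter

/-! ### Doob's inequality and the isometry in discrete time. -/

/-- The pathwise inequality behind Doob's `L²` inequality. -/
lemma sq_partialSups_le (q : ℕ → ℝ) (n : ℕ) :
    partialSups (fun k => |q k|) n ^ 2 ≤ 4 * q n ^ 2 -
      4 * ∑ k ∈ Finset.range n,
        partialSups (fun k => |q k|) k * SignType.sign (q k) * (q (k + 1) - q k) := by
  set s := partialSups (fun k => |q k|) with hs
  have hs_nonneg : ∀ k, 0 ≤ s k := fun k => (abs_nonneg _).trans (le_partialSups (fun k => |q k|) k)
  -- Discrete form of ∫ s d|q| = s|q| - s²/2: the running maximum s grows only when it equals |q|,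
  -- and sign(q)·Δq ≤ Δ|q|.
  have key : ∀ n, ∑ k ∈ Finset.range n, s k * SignType.sign (q k) * (q (k + 1) - q k) ≤
      s n * |q n| - s n ^ 2 / 2 := by
    intro n
    induction n with
    | zero => simp only [hs, Finset.range_zero, Finset.sum_empty, partialSups_zero]; nlinarith [sq_nonneg (|q 0|)]
    | succ n ih =>
      rw [Finset.sum_range_succ]
      have h1 : (SignType.sign (q n) : ℝ) * (q (n + 1) - q n) ≤ |q (n + 1)| - |q n| := by
        have h2 : (SignType.sign (q n) : ℝ) * q n = |q n| := sign_mul_self (q n)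
        have h3 : (SignType.sign (q n) : ℝ) * q (n + 1) ≤ |q (n + 1)| := by
          rcases lt_trichotomy (q n) 0 with h | h | h
          · simp [sign_neg h, neg_le_abs]
          · simp [h]
          · simp [sign_pos h, le_abs_self]
        linarith [mul_sub (SignType.sign (q n) : ℝ) (q (n + 1)) (q n)]
      have h4 := mul_le_mul_of_nonneg_left h1 (hs_nonneg n)
      have h5 : s (n + 1) = s n ⊔ |q (n + 1)| := partialSups_add_one _ n
      rcases le_total (s n) |q (n + 1)| with h | h
      · rw [h5, sup_eq_right.2 h]
        nlinarith [sq_nonneg (s n - |q (n + 1)|)]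
      · rw [h5, sup_eq_left.2 h]
        nlinarith
  have := key n
  -- Four times `this` leaves 4q² - 4s|q| + s² ≥ 0, which is (s - 2|q|)².
  nlinarith [sq_nonneg (s n - 2 * |q n|), sq_abs (q n)]

lemma integral_mul_eq_zero_of_indep {Ω : Type*} {m mΩ : MeasurableSpace Ω} {P : Measure Ω}
    (hm : m ≤ mΩ) {b Z : Ω → ℝ} (hb : Measurable[m] b) (hZ : Measurable Z)
    (hind : Indep (MeasurableSpace.comap Z inferInstance) m P) (hZ0 : ∫ ω, Z ω ∂P = 0) :
    ∫ ω, b ω * Z ω ∂P = 0 := by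
  have h : IndepFun b Z P := by
    rw [IndepFun_iff_Indep]
    exact indep_of_indep_of_le_left hind.symm hb.comap_le
  rw [show (fun ω => b ω * Z ω) = b * Z from rfl,
    h.integral_mul_eq_mul_integral (hb.mono hm le_rfl).aestronglyMeasurable
      hZ.aestronglyMeasurable, hZ0, mul_zero]

variable {Ω : Type*} {mΩ : MeasurableSpace Ω}

/-- Doob's `L²` inequality together with the Itô isometry, for the discrete stochastic integral of
bounded predictable `a` against centred increments `Z`. -/
lemma integral_sq_partialSups_le {P : Measure Ω} [IsProbabilityMeasure P]
    {F : ℕ → MeasurableSpace Ω} (hF : Monotone F) (hFle : ∀ k, F k ≤ mΩ)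
    {a Z : ℕ → Ω → ℝ} {v : ℕ → ℝ}
    (ha : ∀ k, Measurable[F k] (a k)) (hab : ∀ k, ∃ C, ∀ ω, |a k ω| ≤ C)
    (hZ : ∀ k, Measurable[F (k + 1)] (Z k)) (hZL : ∀ k, MemLp (Z k) 2 P)
    (hind : ∀ k, Indep (MeasurableSpace.comap (Z k) inferInstance) (F k) P)
    (hZ0 : ∀ k, ∫ ω, Z k ω ∂P = 0) (hZv : ∀ k, ∫ ω, Z k ω ^ 2 ∂P = v k) (n : ℕ) :
    let Q : ℕ → Ω → ℝ := fun k ω => ∑ j ∈ Finset.range k, a j ω * Z j ω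
    MemLp (fun ω => partialSups (fun k => |Q k ω|) n) 2 P ∧
    ∫ ω, partialSups (fun k => |Q k ω|) n ^ 2 ∂P ≤
      4 * ∑ j ∈ Finset.range n, (∫ ω, a j ω ^ 2 ∂P) * v j := by
  intro Q
  have hZm : ∀ k, Measurable (Z k) := fun k => (hZ k).mono (hFle _) le_rfl
  have ham : ∀ k, Measurable (a k) := fun k => (ha k).mono (hFle _) le_rfl
  have hinc : ∀ k, MemLp (fun ω => a k ω * Z k ω) 2 P := by
    intro k
    obtain ⟨C, hC⟩ := hab k
    refine (hZL k).of_le_mul (c := C) ((ham k).mul (hZm k)).aestronglyMeasurable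
      (ae_of_all _ fun ω => ?_)
    rw [norm_mul]
    gcongr
    exact hC ω
  have hQL : ∀ k, MemLp (Q k) 2 P := fun k => memLp_finsetSum _ fun j _ => hinc j
  have hQm : ∀ k, Measurable[F k] (Q k) := by
    intro k
    refine Finset.measurable_fun_sum _ fun j hj => ?_
    have hj' : j < k := Finset.mem_range.1 hj
    exact ((ha j).mono (hF hj'.le) le_rfl).mul ((hZ j).mono (hF hj') le_rfl)
  have hsm : ∀ k, Measurable[F k] (fun ω => partialSups (fun k => |Q k ω|) k) := by
    intro k
    induction k with
    | zero => simp only [partialSups_zero]; exact measurable_norm.comp (hQm 0)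
    | succ k ih =>
      simp only [partialSups_add_one]
      exact (ih.mono (hF k.le_succ) le_rfl).sup (measurable_norm.comp (hQm (k + 1)))
  have hsL : ∀ k, MemLp (fun ω => partialSups (fun k => |Q k ω|) k) 2 P := by
    intro k
    induction k with
    | zero => simpa using (hQL 0).norm
    | succ k ih =>
      simp only [partialSups_add_one]
      exact ih.sup (hQL (k + 1)).norm
  refine ⟨hsL n, ?_⟩
  have hsgn : ∀ k, Measurable[F k] (fun ω => (SignType.sign (Q k ω) : ℝ)) := by
    intro k
    have h1 : Measurable (fun x : ℝ => (SignType.sign x : ℝ)) := by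
      have e : (fun x : ℝ => (SignType.sign x : ℝ)) =
          fun x => if 0 < x then 1 else if x < 0 then -1 else 0 := by
        ext x
        rcases lt_trichotomy x 0 with h | h | h
        · simp [sign_neg h, h, h.le]
        · simp [h]
        · simp [sign_pos h, h]
      rw [e]
      exact Measurable.ite measurableSet_Ioi measurable_const
        (Measurable.ite measurableSet_Iio measurable_const measurable_const)
    exact h1.comp (hQm k)
  -- the isometry
  have hiso : ∀ k, ∫ ω, Q k ω ^ 2 ∂P = ∑ j ∈ Finset.range k, (∫ ω, a j ω ^ 2 ∂P) * v j := by
    intro k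
    induction k with
    | zero => simp [Q]
    | succ k ih =>
      rw [Finset.sum_range_succ, ← ih]
      -- The last summand is an `F k`-measurable factor times a centred independent increment, so it
      -- integrates to 0.
      have e : ∀ ω, Q (k + 1) ω ^ 2 =
          (Q k ω ^ 2 + a k ω ^ 2 * Z k ω ^ 2) + (2 * Q k ω * a k ω) * Z k ω := by
        intro ω; simp only [Q, Finset.sum_range_succ]; ring
      have i1 : Integrable (fun ω => Q k ω ^ 2) P := (hQL k).integrable_sq
      have i2 : Integrable (fun ω => a k ω ^ 2 * Z k ω ^ 2) P := by
        simpa only [mul_pow] using (hinc k).integrable_sq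
      have i3 : Integrable (fun ω => (2 * Q k ω * a k ω) * Z k ω) P := by
        have := ((hQL k).integrable_mul (hinc k)).const_mul 2
        refine this.congr (ae_of_all _ fun ω => ?_)
        simp only [Pi.mul_apply]; ring
      simp_rw [e]
      rw [integral_add (by exact i1.add i2) i3, integral_add i1 i2]
      have z : ∫ ω, (2 * Q k ω * a k ω) * Z k ω ∂P = 0 :=
        integral_mul_eq_zero_of_indep (hFle k) (((hQm k).const_mul 2).mul (ha k)) (hZm k)
          (hind k) (hZ0 k)
      have w : ∫ ω, a k ω ^ 2 * Z k ω ^ 2 ∂P = (∫ ω, a k ω ^ 2 ∂P) * v k := by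
        have h : IndepFun (fun ω => a k ω ^ 2) (fun ω => Z k ω ^ 2) P := by
          have h0 : IndepFun (a k) (Z k) P := by
            rw [IndepFun_iff_Indep]
            exact indep_of_indep_of_le_left (hind k).symm (ha k).comap_le
          exact h0.comp (measurable_id.pow_const 2) (measurable_id.pow_const 2)
        have := h.integral_mul_eq_mul_integral ((ham k).pow_const 2).aestronglyMeasurable
          ((hZm k).pow_const 2).aestronglyMeasurable
        rw [← hZv k, ← this]; rfl
      rw [z, w, add_zero]
  set s : ℕ → Ω → ℝ := fun k ω => partialSups (fun k => |Q k ω|) k with hs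
  -- The correction sum in `sq_partialSups_le` is itself a martingale transform of `Z`, so it
  -- disappears in the mean.
  have hterm : ∀ k, Integrable (fun ω => s k ω * SignType.sign (Q k ω) * (Q (k + 1) ω - Q k ω)) P ∧
      ∫ ω, s k ω * SignType.sign (Q k ω) * (Q (k + 1) ω - Q k ω) ∂P = 0 := by
    intro k
    have e : (fun ω => s k ω * SignType.sign (Q k ω) * (Q (k + 1) ω - Q k ω)) =
        fun ω => (s k ω * SignType.sign (Q k ω) * a k ω) * Z k ω := by
      ext ω; simp only [Q, Finset.sum_range_succ]; ring
    rw [e]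
    refine ⟨?_, integral_mul_eq_zero_of_indep (hFle k) (((hsm k).mul (hsgn k)).mul (ha k)) (hZm k)
          (hind k) (hZ0 k)⟩
    have i := ((hsL k).integrable_mul (hinc k))
    refine i.mono ?_ (ae_of_all _ fun ω => ?_)
    · exact (((((hsm k).mul (hsgn k)).mul (ha k)).mono (hFle k) le_rfl).mul
        (hZm k)).aestronglyMeasurable
    · simp only [Pi.mul_apply, norm_mul]
      have h1 : ‖(SignType.sign (Q k ω) : ℝ)‖ ≤ 1 := by
        rcases lt_trichotomy (Q k ω) 0 with h | h | h
        · simp [sign_neg h]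
        · simp [h]
        · simp [sign_pos h]
      have h2 : 0 ≤ ‖s k ω‖ := norm_nonneg _
      have h3 : 0 ≤ ‖a k ω‖ * ‖Z k ω‖ := by positivity
      calc _ = ‖s k ω‖ * ‖(SignType.sign (Q k ω) : ℝ)‖ * (‖a k ω‖ * ‖Z k ω‖) := by ring
        _ ≤ ‖s k ω‖ * 1 * (‖a k ω‖ * ‖Z k ω‖) := by gcongr
        _ = _ := by rw [mul_one]
  calc ∫ ω, s n ω ^ 2 ∂P
      ≤ ∫ ω, (4 * Q n ω ^ 2 - 4 * ∑ k ∈ Finset.range n,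
          s k ω * SignType.sign (Q k ω) * (Q (k + 1) ω - Q k ω)) ∂P := by
        refine integral_mono (hsL n).integrable_sq ?_ fun ω => sq_partialSups_le (fun k => Q k ω) n
        exact ((hQL n).integrable_sq.const_mul 4).sub
          ((integrable_finsetSum _ fun k _ => (hterm k).1).const_mul 4)
    _ = 4 * ∑ j ∈ Finset.range n, (∫ ω, a j ω ^ 2 ∂P) * v j := by
        rw [integral_sub ((hQL n).integrable_sq.const_mul 4)
          ((integrable_finsetSum _ fun k _ => (hterm k).1).const_mul 4), integral_const_mul,
          integral_const_mul, integral_finsetSum _ fun k _ => (hterm k).1,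
          Finset.sum_eq_zero fun k _ => (hterm k).2, hiso n]
        ring

/-! ### Grids and elementary integrands. -/

/-- A finite grid on `[0, T]` of mesh at most `δ` that contains the points of `F` in `[0, T]`. -/
lemma exists_grid (T : ℝ≥0) (F : Finset ℝ≥0) {δ : ℝ≥0} (hδ : 0 < δ) :
    ∃ (m : ℕ) (t : ℕ → ℝ≥0), Monotone t ∧ t 0 = 0 ∧ (∀ k, t k ≤ T) ∧
      (∀ x ∈ F, x ≤ T → ∃ k ≤ m, t k = x) ∧ (∀ x ∈ F, ∀ k, x ≤ t k ∨ t (k + 1) ≤ x) ∧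
      ∀ k, t (k + 1) ≤ t k + δ := by
  classical
  -- The multiples of δ force the mesh. The range extends far enough to contain the index following
  -- ⌊t k / δ⌋ for every t k ≤ T.
  set F' : Finset ℝ≥0 := insert 0 (insert T (F.filter (· ≤ T) ∪
    (Finset.range (⌈T / δ⌉₊ + 2)).image (fun i : ℕ => min (i * δ) T))) with hF'
  have hle : ∀ x ∈ F', x ≤ T := by
    intro x hx
    simp only [hF', Finset.mem_insert, Finset.mem_union, Finset.mem_filter, Finset.mem_image] at hx
    rcases hx with rfl | rfl | h | ⟨i, -, rfl⟩
    · exact zero_le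
    · exact le_rfl
    · exact h.2
    · exact min_le_right _ _
  have hc : 0 < F'.card := Finset.card_pos.2 ⟨0, by simp [hF']⟩
  set c := F'.card with hcdef
  set emb := F'.orderEmbOfFin hcdef.symm
  have hlt : ∀ k, min k (c - 1) < c := fun k => by omega
  -- Increasing enumeration of `F'`, constant from its last point on; the later cells are empty.
  set t : ℕ → ℝ≥0 := fun k => emb ⟨min k (c - 1), hlt k⟩ with ht
  have htmem : ∀ k, t k ∈ F' := fun k => Finset.orderEmbOfFin_mem _ _ _
  have hemb : ∀ x ∈ F', ∃ i : Fin c, emb i = x := by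
    intro x hx
    have : x ∈ Set.range emb := by
      rw [Finset.range_orderEmbOfFin]; exact hx
    exact this
  have hgap : ∀ x ∈ F', ∀ k, x ≤ t k ∨ t (k + 1) ≤ x := by
    intro x hx k
    obtain ⟨i, rfl⟩ := hemb x hx
    by_cases h : (i : ℕ) ≤ k
    · left
      refine emb.monotone ?_
      rw [Fin.le_def]
      have := i.2
      simp only
      omega
    · right
      refine emb.monotone ?_
      rw [Fin.le_def]
      simp only
      omega
  have hmono : Monotone t := by
    intro i j hij
    refine emb.monotone ?_
    rw [Fin.le_def]
    simp only
    omega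
  have h0 : t 0 = 0 := by
    have h0' : (0 : ℝ≥0) ∈ F' := by simp [hF']
    obtain ⟨i, hi⟩ := hemb 0 h0'
    refine le_antisymm ?_ zero_le
    rw [← hi]
    refine emb.monotone ?_
    rw [Fin.le_def]
    simp
  refine ⟨c, t, hmono, h0, fun k => hle _ (htmem k), ?_, ?_, ?_⟩
  · intro x hx hxT
    obtain ⟨i, rfl⟩ := hemb x (by simp [hF', hx, hxT])
    refine ⟨i, i.2.le, ?_⟩
    simp only [ht]
    congr 1
    ext
    have := i.2
    simp only
    omega
  · intro x hx k
    by_cases hxT : x ≤ T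
    · exact hgap x (by simp [hF', hx, hxT]) k
    · exact Or.inr ((hle _ (htmem _)).trans (not_le.1 hxT).le)
  · intro k
    -- The first multiple of δ strictly above `t k`, cut off at `T`, is a grid point. Hence either
    -- it bounds `t (k + 1)`, or `t k` is already `T`.
    set i := ⌊t k / δ⌋₊
    have hi1 : t k < (i + 1) * δ := by
      have := Nat.lt_floor_add_one (t k / δ)
      rwa [div_lt_iff₀ hδ] at this
    have hi2 : i * δ ≤ t k := by
      have := Nat.floor_le (a := t k / δ) zero_le
      rwa [le_div_iff₀ hδ] at this
    have hi3 : i ≤ ⌈T / δ⌉₊ :=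
      (Nat.floor_mono (by gcongr; exact hle _ (htmem _))).trans (Nat.floor_le_ceil _)
    have hmem : min ((i + 1 : ℕ) * δ) T ∈ F' := by
      simp only [hF', Finset.mem_insert, Finset.mem_union, Finset.mem_image]
      exact Or.inr (Or.inr (Or.inr ⟨i + 1, Finset.mem_range.2 (by omega), rfl⟩))
    rcases hgap _ hmem k with h | h
    · rcases min_le_iff.1 h with h | h
      · push_cast at h
        exact absurd h (not_le.2 hi1)
      · exact ((hle _ (htmem _)).trans h).trans le_self_add
    · refine h.trans ((min_le_left _ _).trans ?_)
      push_cast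
      rw [add_mul, one_mul]
      gcongr

/-- An order-connected set is an increasing union of compact intervals with endpoints in the set,
and `withDensity` is continuous from below. Neither measurability of `f` nor knowledge of which
endpoints belong to `A` is needed. -/
lemma setLIntegral_le_of_ordConnected {f : ℝ → ℝ≥0∞} {A : Set ℝ} (hA : A.OrdConnected) {κ : ℝ≥0∞}
    (h : ∀ a ∈ A, ∀ b ∈ A, ∫⁻ s in Set.Icc a b, f s ≤ κ) : ∫⁻ s in A, f s ≤ κ := by
  rcases A.eq_empty_or_nonempty with rfl | ⟨x, hx⟩
  · simp
  have := hA
  have : Nonempty A := ⟨⟨x, hx⟩⟩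
  obtain ⟨b, hb, hbt⟩ := exists_seq_monotone_tendsto_atTop_atTop A
  obtain ⟨a, ha, hat⟩ := exists_seq_antitone_tendsto_atTop_atBot A
  have hU : A = ⋃ n, Set.Icc (a n : ℝ) (b n) := by
    ext y
    simp only [Set.mem_iUnion]
    constructor
    · intro hy
      obtain ⟨n, h1, h2⟩ := ((hat.eventually (eventually_le_atBot ⟨y, hy⟩)).and
        (hbt.eventually (eventually_ge_atTop ⟨y, hy⟩))).exists
      exact ⟨n, h1, h2⟩
    · rintro ⟨n, hn⟩
      exact hA.out (a n).2 (b n).2 hn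
  have hm : Monotone fun n => Set.Icc (a n : ℝ) (b n) := fun i j hij =>
    Set.Icc_subset_Icc (ha hij) (hb hij)
  rw [← withDensity_apply f hA.measurableSet, hU, hm.measure_iUnion]
  refine iSup_le fun n => ?_
  rw [withDensity_apply f measurableSet_Icc]
  exact h _ (a n).2 _ (b n).2

namespace SimpleIntegrand

variable {𝓗 : Filtration ℝ≥0 mΩ} (H : SimpleIntegrand 𝓗)

lemma exists_bound_value : ∃ C : ℝ≥0, ∀ s ω, |H.value s ω| ≤ C := by
  obtain ⟨C, hC⟩ := H.bounded_c
  refine ⟨(H.n * |C|).toNNReal, fun s ω => ?_⟩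
  rw [Real.coe_toNNReal _ (by positivity)]
  refine (Finset.abs_sum_le_sum_abs _ _).trans ?_
  refine (Finset.sum_le_card_nsmul _ _ |C| fun i _ => ?_).trans (by simp)
  by_cases h : s ∈ Set.Ioc (H.τ i) (H.τ (i + 1))
  · rw [Set.indicator_of_mem h]; exact (hC i ω).trans (le_abs_self C)
  · rw [Set.indicator_of_notMem h]; simp

/-- The value of an elementary integrand, jointly in time and `ω`, is progressively measurable. -/
lemma measurable_value (t : ℝ≥0) :
    Measurable[(inferInstance : MeasurableSpace ℝ≥0).prod (𝓗 t)]
      (fun p : ℝ≥0 × Ω => H.value (min p.1 t) p.2) := by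
  unfold value
  refine Finset.measurable_fun_sum _ fun i _ => ?_
  by_cases h : H.τ i ≤ t
  · have h1 : Measurable[(inferInstance : MeasurableSpace ℝ≥0).prod (𝓗 t)]
        (fun p : ℝ≥0 × Ω => H.c i p.2) :=
      ((H.measurable_c i).mono (𝓗.mono h) le_rfl).comp (@measurable_snd _ _ _ (𝓗 t))
    have h2 : MeasurableSet[(inferInstance : MeasurableSpace ℝ≥0).prod (𝓗 t)]
        {p : ℝ≥0 × Ω | min p.1 t ∈ Set.Ioc (H.τ i) (H.τ (i + 1))} :=
      ((@measurable_fst _ _ _ (𝓗 t)).min measurable_const) measurableSet_Ioc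
    exact Measurable.indicator (s := {p : ℝ≥0 × Ω | min p.1 t ∈ Set.Ioc (H.τ i) (H.τ (i + 1))})
      h1 h2
  · have : (fun p : ℝ≥0 × Ω => (Set.Ioc (H.τ i) (H.τ (i + 1))).indicator
        (fun _ => H.c i p.2) (min p.1 t)) = fun _ => 0 := by
      ext p
      refine Set.indicator_of_notMem (fun h' => ?_) _
      exact h (h'.1.le.trans (min_le_right _ _))
    rw [this]
    exact measurable_const

section Grid

variable {t : ℕ → ℝ≥0}

/-- No partition point of `H` lies strictly inside a cell, so each cell is either contained in an
interval of `H` or disjoint from it. -/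
lemma mem_Ioc_iff_of_grid (hgrid : ∀ i ≤ H.n, ∀ k, H.τ i ≤ t k ∨ t (k + 1) ≤ H.τ i)
    {i k : ℕ} (hi : i < H.n) {s : ℝ≥0} (hs : s ∈ Set.Ioc (t k) (t (k + 1))) :
    s ∈ Set.Ioc (H.τ i) (H.τ (i + 1)) ↔ H.τ i ≤ t k ∧ t (k + 1) ≤ H.τ (i + 1) := by
  constructor
  · rintro ⟨h1, h2⟩
    exact ⟨(hgrid i hi.le k).resolve_right fun h => absurd (hs.2.trans h) (not_le.2 h1),
      (hgrid (i + 1) hi k).resolve_left fun h => absurd (h2.trans h) (not_le.2 hs.1)⟩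
  · rintro ⟨h1, h2⟩
    exact ⟨h1.trans_lt hs.1, hs.2.trans h2⟩

lemma value_eq_of_grid (hgrid : ∀ i ≤ H.n, ∀ k, H.τ i ≤ t k ∨ t (k + 1) ≤ H.τ i)
    {k : ℕ} {s : ℝ≥0} (hs : s ∈ Set.Ioc (t k) (t (k + 1))) (ω : Ω) :
    H.value s ω = H.value (t (k + 1)) ω := by
  have hk : t (k + 1) ∈ Set.Ioc (t k) (t (k + 1)) := ⟨hs.1.trans_le hs.2, le_rfl⟩
  unfold value
  refine Finset.sum_congr rfl fun i hi => ?_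
  have hi' := Finset.mem_range.1 hi
  simp only [Set.indicator_apply, H.mem_Ioc_iff_of_grid hgrid hi' hs,
    H.mem_Ioc_iff_of_grid hgrid hi' hk]

/-- Increments of `W` telescope under refinement of the partition. This puts two elementary
integrals with different partitions on one common grid. -/
lemma integral_eq_of_grid (hgrid : ∀ i ≤ H.n, ∀ k, H.τ i ≤ t k ∨ t (k + 1) ≤ H.τ i)
    (h0 : t 0 = 0) (ht : Monotone t) (W : ℝ≥0 → Ω → ℝ) (k : ℕ) (ω : Ω) :
    H.integral W (t k) ω =
      ∑ j ∈ Finset.range k, H.value (t (j + 1)) ω * (W (t (j + 1)) ω - W (t j) ω) := by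
  induction k with
  | zero => simp [integral, h0]
  | succ k ih =>
    rw [Finset.sum_range_succ, ← ih]
    unfold integral value
    rw [Finset.sum_mul, ← Finset.sum_add_distrib]
    refine Finset.sum_congr rfl fun i hi => ?_
    have hi' := Finset.mem_range.1 hi
    have hτ : H.τ i ≤ H.τ (i + 1) := H.mono i.le_succ
    rcases (ht k.le_succ).eq_or_lt with he | hlt
    · simp only [Nat.succ_eq_add_one] at he; rw [← he]; simp
    · have hk : t (k + 1) ∈ Set.Ioc (t k) (t (k + 1)) := ⟨hlt, le_rfl⟩
      simp only [Set.indicator_apply, H.mem_Ioc_iff_of_grid hgrid hi' hk]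
      -- The cases, in order: the cell lies after the i-th interval of `H`, inside it, in an
      -- impossible position, before it.
      rcases hgrid i hi'.le k with h1 | h1 <;> rcases hgrid (i + 1) hi' k with h2 | h2
      · have : ¬ (t (k + 1) ≤ H.τ (i + 1)) := not_le.2 (h2.trans_lt hlt)
        simp only [this, and_false, if_false, min_eq_left h1, min_eq_left h2,
          min_eq_left (h1.trans hlt.le), min_eq_left (h2.trans hlt.le)]
        ring
      · simp only [h1, h2, and_self, if_true, min_eq_left h1, min_eq_right h2,
          min_eq_left (h1.trans hlt.le), min_eq_right (hlt.le.trans h2)]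
        ring
      · exact absurd (h1.trans (hτ.trans h2)) (not_le.2 hlt)
      · have : ¬ (H.τ i ≤ t k) := not_le.2 (hlt.trans_le h1)
        simp only [this, false_and, if_false, min_eq_right h1, min_eq_right h2,
          min_eq_right (hlt.le.trans h1), min_eq_right (hlt.le.trans h2)]
        ring

/-- Predictability: if the cell lies in the i-th interval, that interval has begun by the left end
of the cell, so `c i` is already known there. -/
lemma measurable_value_of_grid (hgrid : ∀ i ≤ H.n, ∀ k, H.τ i ≤ t k ∨ t (k + 1) ≤ H.τ i)
    (k : ℕ) : Measurable[𝓗 (t k)] (H.value (t (k + 1))) := by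
  unfold value
  refine Finset.measurable_fun_sum _ fun i hi => ?_
  by_cases h : t (k + 1) ∈ Set.Ioc (H.τ i) (H.τ (i + 1))
  · simp only [Set.indicator_of_mem h]
    refine (H.measurable_c i).mono (𝓗.mono ?_) le_rfl
    exact (hgrid i (Finset.mem_range.1 hi).le k).resolve_right (not_le.2 h.1)
  · simp only [Set.indicator_of_notMem h]
    exact measurable_const

end Grid

end SimpleIntegrand

/-! ### Maximal inequalities for elementary and Itô integrals. -/

lemma IsBrownianWrt.increment {P : Measure Ω} {𝓗 : Filtration ℝ≥0 mΩ} {W : ℝ≥0 → Ω → ℝ}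
    (hW : IsBrownianWrt P 𝓗 W) {s t : ℝ≥0} (hst : s ≤ t) :
    MemLp (fun ω => W t ω - W s ω) 2 P ∧ ∫ ω, W t ω - W s ω ∂P = 0 ∧
      ∫ ω, (W t ω - W s ω) ^ 2 ∂P = t - s := by
  have hlaw := hW.brownian.toIsPreBrownianReal.hasLaw_sub t s
  have hv : (nndist t.1 s.1 : ℝ) = t - s := by
    rw [coe_nndist, Real.dist_eq]
    exact abs_of_nonneg (sub_nonneg.2 (NNReal.coe_le_coe.2 hst))
  have h1 : MemLp (W t - W s) 2 P := by
    have := memLp_id_gaussianReal' (μ := 0) (v := nndist t.1 s.1) 2 (by simp)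
    rw [← hlaw.map_eq] at this
    exact MemLp.comp_of_map (g := id) this hlaw.aemeasurable
  have h2 : ∫ ω, (W t - W s) ω ∂P = 0 := by
    rw [hlaw.integral_eq]; simp
  refine ⟨h1, h2, ?_⟩
  have h3 := hlaw.variance_eq
  rw [variance_id_gaussianReal, variance_of_integral_eq_zero h1.aemeasurable h2, hv] at h3
  exact h3

lemma lintegral_Ioc_add {f : ℝ → ℝ≥0∞} {a b c : ℝ} (hab : a ≤ b) (hbc : b ≤ c) :
    ∫⁻ s in Set.Ioc a c, f s = (∫⁻ s in Set.Ioc a b, f s) + ∫⁻ s in Set.Ioc b c, f s := by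
  rw [← Set.Ioc_union_Ioc_eq_Ioc hab hbc,
    lintegral_union measurableSet_Ioc (Set.Ioc_disjoint_Ioc_of_le le_rfl)]

/-- Stopping a piecewise constant function on a grid overshoots by at most one cell. -/
lemma sum_indicator_grid_le {t : ℕ → ℝ≥0} (ht : Monotone t) {δ : ℝ≥0}
    (hδ : ∀ k, t (k + 1) ≤ t k + δ) {A : Set ℝ≥0} (hA : IsLowerSet A)
    {v : ℝ≥0 → ℝ≥0∞} {C : ℝ≥0∞} (hvC : ∀ s, v s ≤ C)
    (hv : ∀ k, ∀ s ∈ Set.Ioc (t k) (t (k + 1)), v s = v (t (k + 1))) (m : ℕ) :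
    ∑ j ∈ Finset.range m, A.indicator (fun _ => v (t (j + 1))) (t j) *
        ENNReal.ofReal (t (j + 1) - t j) ≤
      (∫⁻ s in Set.Ioc (0 : ℝ) (t m), A.indicator v s.toNNReal) + C * δ := by
  have hcell : ∀ k, ENNReal.ofReal ((t (k + 1) : ℝ) - t k) ≤ δ := by
    intro k
    rw [← ENNReal.ofReal_coe_nnreal]
    refine ENNReal.ofReal_le_ofReal ?_
    have := NNReal.coe_le_coe.2 (hδ k)
    push_cast at this
    linarith
  have key : ∀ m, (∑ j ∈ Finset.range m, A.indicator (fun _ => v (t (j + 1))) (t j) *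
        ENNReal.ofReal (t (j + 1) - t j)) + A.indicator (fun _ => C * δ) (t m) ≤
      (∫⁻ s in Set.Ioc (0 : ℝ) (t m), A.indicator v s.toNNReal) + C * δ := by
    intro m
    induction m with
    | zero =>
      simp only [Finset.range_zero, Finset.sum_empty, zero_add]
      exact (Set.indicator_le_self' (by simp) _).trans le_add_self
    | succ m ih =>
      rw [Finset.sum_range_succ, lintegral_Ioc_add (b := t m) (t m).2
        (NNReal.coe_le_coe.2 (ht m.le_succ))]
      by_cases h1 : t (m + 1) ∈ A
      · have h2 : t m ∈ A := hA (ht m.le_succ) h1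
        have h3 : ∫⁻ s in Set.Ioc (t m : ℝ) (t (m + 1)), A.indicator v s.toNNReal =
            v (t (m + 1)) * ENNReal.ofReal (t (m + 1) - t m) := by
          rw [← Real.volume_Ioc, ← setLIntegral_const]
          refine setLIntegral_congr_fun measurableSet_Ioc fun s hs => ?_
          have hs' : s.toNNReal ∈ Set.Ioc (t m) (t (m + 1)) :=
            ⟨Real.lt_toNNReal_iff_coe_lt.2 hs.1, Real.toNNReal_le_iff_le_coe.2 hs.2⟩
          rw [Set.indicator_of_mem (hA hs'.2 h1), hv m _ hs']
        rw [Set.indicator_of_mem h2] at ih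
        rw [Set.indicator_of_mem h2, Set.indicator_of_mem h1, h3]
        calc _ = (∑ j ∈ Finset.range m, A.indicator (fun _ => v (t (j + 1))) (t j) *
                ENNReal.ofReal (t (j + 1) - t j)) + C * δ +
                v (t (m + 1)) * ENNReal.ofReal (t (m + 1) - t m) := by ring
          _ ≤ (∫⁻ s in Set.Ioc (0 : ℝ) (t m), A.indicator v s.toNNReal) + C * δ +
                v (t (m + 1)) * ENNReal.ofReal (t (m + 1) - t m) := by gcongr
          _ = _ := by ring
      · rw [Set.indicator_of_notMem h1, add_zero]
        have h4 : A.indicator (fun _ => v (t (m + 1))) (t m) *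
            ENNReal.ofReal (t (m + 1) - t m) ≤ A.indicator (fun _ => C * δ) (t m) := by
          by_cases h2 : t m ∈ A
          · simp only [Set.indicator_of_mem h2]
            exact mul_le_mul' (hvC _) (hcell m)
          · simp [Set.indicator_of_notMem h2]
        calc _ ≤ (∑ j ∈ Finset.range m, A.indicator (fun _ => v (t (j + 1))) (t j) *
                ENNReal.ofReal (t (j + 1) - t j)) + A.indicator (fun _ => C * δ) (t m) := by gcongr
          _ ≤ _ := ih
          _ ≤ _ := by gcongr; exact le_self_add
  exact le_self_add.trans (key m)

/-- Doob's inequality for the difference of two elementary integrals, stopped when leaving a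
decreasing adapted family of events. -/
lemma lintegral_sup_simple_le {P : Measure Ω} [IsProbabilityMeasure P] {𝓗 : Filtration ℝ≥0 mΩ}
    {W : ℝ≥0 → Ω → ℝ} (hW : IsBrownianWrt P 𝓗 W) (T : ℝ≥0) (H H' : SimpleIntegrand 𝓗)
    {G : ℝ≥0 → Set Ω} (hG : ∀ t ≤ T, MeasurableSet[𝓗 t] (G t)) (hGa : Antitone G)
    (F : Finset ℝ≥0) (hF : ∀ t ∈ F, t ≤ T) {e : ℝ≥0} (he : 0 < e) :
    ∫⁻ ω, F.sup (fun t => (G t).indicator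
        (fun ω => ‖H.integral W t ω - H'.integral W t ω‖ₑ ^ 2) ω) ∂P ≤
      4 * (∫⁻ ω, timeLIntegral (fun s => (G s).indicator
        (fun ω => ‖H.value s ω - H'.value s ω‖ₑ ^ 2) ω) T ∂P) + e := by
  classical
  obtain ⟨C₁, hC₁⟩ := H.exists_bound_value
  obtain ⟨C₂, hC₂⟩ := H'.exists_bound_value
  set C : ℝ≥0 := C₁ + C₂ + 1 with hC
  have hCpos : 0 < C := by positivity
  set hv : ℝ≥0 → Ω → ℝ := fun s ω => H.value s ω - H'.value s ω with hhv
  have hvC : ∀ s ω, |hv s ω| ≤ C := by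
    intro s ω
    refine (abs_sub _ _).trans ?_
    have := hC₁ s ω
    have := hC₂ s ω
    push_cast [hC]
    linarith
  -- Makes the overshoot C²δ of the last cell, multiplied by Doob's constant 4, equal to `e`.
  set δ : ℝ≥0 := e / (4 * C ^ 2) with hδ
  have hδpos : 0 < δ := by positivity
  obtain ⟨m, t, ht, h0, htT, hFt, hgap, hmesh⟩ := exists_grid T
    (F ∪ (Finset.range (H.n + 1)).image H.τ ∪ (Finset.range (H'.n + 1)).image H'.τ) hδpos
  have hgH : ∀ i ≤ H.n, ∀ k, H.τ i ≤ t k ∨ t (k + 1) ≤ H.τ i := fun i hi k => hgap _ (by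
    simp only [Finset.mem_union, Finset.mem_image, Finset.mem_range]
    exact Or.inl (Or.inr ⟨i, by omega, rfl⟩)) k
  have hgH' : ∀ i ≤ H'.n, ∀ k, H'.τ i ≤ t k ∨ t (k + 1) ≤ H'.τ i := fun i hi k => hgap _ (by
    simp only [Finset.mem_union, Finset.mem_image, Finset.mem_range]
    exact Or.inr ⟨i, by omega, rfl⟩) k
  -- The event is tested at the left end of the cell, which keeps the coefficient predictable.
  set a : ℕ → Ω → ℝ := fun j => (G (t j)).indicator (hv (t (j + 1))) with ha
  set Z : ℕ → Ω → ℝ := fun j ω => W (t (j + 1)) ω - W (t j) ω with hZ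
  have ham : ∀ j, Measurable[𝓗 (t j)] (a j) := fun j =>
    ((H.measurable_value_of_grid hgH j).sub (H'.measurable_value_of_grid hgH' j)).indicator
      (hG _ (htT j))
  have haC : ∀ j ω, |a j ω| ≤ C := by
    intro j ω
    simp only [ha, Set.indicator_apply]
    split_ifs
    · exact hvC _ _
    · simp
  have hinc := fun j => hW.increment (ht (Nat.le_succ j))
  obtain ⟨hL, hle⟩ := integral_sq_partialSups_le (P := P) (F := fun j => 𝓗 (t j))
    (fun i j hij => 𝓗.mono (ht hij)) (fun j => 𝓗.le _) (a := a) (Z := Z)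
    (v := fun j => (t (j + 1) : ℝ) - t j) ham (fun j => ⟨C, haC j⟩)
    (fun j => (hW.adapted _).sub ((hW.adapted _).mono (𝓗.mono (ht j.le_succ)) le_rfl))
    (fun j => (hinc j).1) (fun j => hW.indep _ _ (ht j.le_succ)) (fun j => (hinc j).2.1)
    (fun j => (hinc j).2.2) m
  set s : Ω → ℝ := fun ω => partialSups
    (fun k => |∑ j ∈ Finset.range k, a j ω * Z j ω|) m with hs
  -- `G` decreases, so on `G (t k)` none of the earlier cells has been switched off and the stopped
  -- sum is the true integral.
  have hQ : ∀ k ω, ω ∈ G (t k) → ∑ j ∈ Finset.range k, a j ω * Z j ω =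
      H.integral W (t k) ω - H'.integral W (t k) ω := by
    intro k ω hω
    rw [H.integral_eq_of_grid hgH h0 ht, H'.integral_eq_of_grid hgH' h0 ht,
      ← Finset.sum_sub_distrib]
    refine Finset.sum_congr rfl fun j hj => ?_
    have hjk : j ≤ k := (Finset.mem_range.1 hj).le
    simp only [ha, Set.indicator_of_mem (hGa (ht hjk) hω), hhv, hZ]
    ring
  have hsup : ∀ ω, F.sup (fun t => (G t).indicator
        (fun ω => ‖H.integral W t ω - H'.integral W t ω‖ₑ ^ 2) ω) ≤ ENNReal.ofReal (s ω ^ 2) := by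
    intro ω
    refine Finset.sup_le fun x hx => ?_
    obtain ⟨k, hkm, rfl⟩ := hFt x (by simp [hx]) (hF x hx)
    by_cases hω : ω ∈ G (t k)
    · rw [Set.indicator_of_mem hω, ← hQ k ω hω, ← enorm_pow, Real.enorm_eq_ofReal (sq_nonneg _)]
      refine ENNReal.ofReal_le_ofReal ?_
      rw [← sq_abs]
      have := le_partialSups_of_le (fun k => |∑ j ∈ Finset.range k, a j ω * Z j ω|) hkm
      gcongr
    · rw [Set.indicator_of_notMem hω]
      exact zero_le
  have haL : ∀ j, Integrable (fun ω => a j ω ^ 2) P := fun j =>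
    (MemLp.of_bound ((ham j).mono (𝓗.le _) le_rfl).aestronglyMeasurable (C : ℝ)
      (ae_of_all _ (haC j))).integrable_sq
  have hpath : ∀ ω, ∑ j ∈ Finset.range m, ‖a j ω‖ₑ ^ 2 * ENNReal.ofReal (t (j + 1) - t j) ≤
      timeLIntegral (fun s => (G s).indicator (fun ω => ‖hv s ω‖ₑ ^ 2) ω) T + C ^ 2 * δ := by
    intro ω
    have h1 := sum_indicator_grid_le ht hmesh (A := {s | ω ∈ G s})
      (fun x y hyx hx => hGa hyx hx) (v := fun s => ‖hv s ω‖ₑ ^ 2) (C := C ^ 2)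
      (fun s => by
        gcongr
        rw [Real.enorm_eq_ofReal_abs, ← ENNReal.ofReal_coe_nnreal]
        exact ENNReal.ofReal_le_ofReal (hvC s ω))
      (fun k s hs => by
        simp only [hhv]
        rw [H.value_eq_of_grid hgH hs, H'.value_eq_of_grid hgH' hs]) m
    refine le_trans (le_of_eq (Finset.sum_congr rfl fun j _ => ?_)) (h1.trans ?_)
    · congr 1
      by_cases hω : ω ∈ G (t j)
      · simp only [ha, Set.indicator_of_mem hω,
          Set.indicator_of_mem (show t j ∈ {s | ω ∈ G s} from hω)]
      · simp [ha, Set.indicator_of_notMem hω,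
          Set.indicator_of_notMem (show t j ∉ {s | ω ∈ G s} from hω)]
    · gcongr
      unfold timeLIntegral
      refine (lintegral_mono_set (Set.Ioc_subset_Icc_self.trans
        (Set.Icc_subset_Icc_right (NNReal.coe_le_coe.2 (htT m))))).trans (le_of_eq ?_)
      rfl
  have hC2 : (4 : ℝ≥0∞) * (C ^ 2 * δ) = e := by
    have : 4 * (C ^ 2 * δ) = e := by
      rw [hδ]; field_simp
    exact_mod_cast this
  calc ∫⁻ ω, F.sup (fun t => (G t).indicator
        (fun ω => ‖H.integral W t ω - H'.integral W t ω‖ₑ ^ 2) ω) ∂P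
      ≤ ∫⁻ ω, ENNReal.ofReal (s ω ^ 2) ∂P := lintegral_mono hsup
    _ = ENNReal.ofReal (∫ ω, s ω ^ 2 ∂P) :=
        (ofReal_integral_eq_lintegral_ofReal hL.integrable_sq
          (ae_of_all _ fun ω => sq_nonneg _)).symm
    _ ≤ ENNReal.ofReal (4 * ∑ j ∈ Finset.range m, (∫ ω, a j ω ^ 2 ∂P) * (t (j + 1) - t j)) :=
        ENNReal.ofReal_le_ofReal hle
    _ = 4 * ∑ j ∈ Finset.range m, (∫⁻ ω, ‖a j ω‖ₑ ^ 2 ∂P) * ENNReal.ofReal (t (j + 1) - t j) := by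
        rw [ENNReal.ofReal_mul (by norm_num), ENNReal.ofReal_ofNat, ENNReal.ofReal_sum_of_nonneg]
        · congr 1
          refine Finset.sum_congr rfl fun j _ => ?_
          rw [ENNReal.ofReal_mul (integral_nonneg fun ω => sq_nonneg _),
            ofReal_integral_eq_lintegral_ofReal (haL j) (ae_of_all _ fun ω => sq_nonneg _)]
          congr 2
          ext ω
          rw [← enorm_pow, Real.enorm_eq_ofReal (sq_nonneg _)]
        · intro j _
          exact mul_nonneg (integral_nonneg fun ω => sq_nonneg _)
            (sub_nonneg.2 (NNReal.coe_le_coe.2 (ht j.le_succ)))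
    _ = 4 * ∫⁻ ω, ∑ j ∈ Finset.range m,
          ‖a j ω‖ₑ ^ 2 * ENNReal.ofReal (t (j + 1) - t j) ∂P := by
        have hmm : ∀ j, Measurable (fun ω => ‖a j ω‖ₑ ^ 2) := fun j =>
          ((ham j).mono (𝓗.le _) le_rfl).enorm.pow_const 2
        rw [lintegral_finsetSum _ fun j _ => (hmm j).mul_const _]
        congr 1
        refine Finset.sum_congr rfl fun j _ => ?_
        rw [lintegral_mul_const _ (hmm j)]
    _ ≤ 4 * ∫⁻ ω, (timeLIntegral (fun s => (G s).indicator (fun ω => ‖hv s ω‖ₑ ^ 2) ω) T +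
          C ^ 2 * δ) ∂P := by
        gcongr with ω
        exact hpath ω
    _ = _ := by
        rw [lintegral_add_right _ measurable_const, lintegral_const, measure_univ, mul_one,
          mul_add, hC2]

/-- Joint measurability on `[0, t] × Ω` with respect to `m`; for `m = 𝓗 t` and all `t` this is
progressive measurability. -/
def MeasurableUpTo {E : Type*} [MeasurableSpace E] (m : MeasurableSpace Ω) (t : ℝ≥0)
    (h : ℝ≥0 → Ω → E) : Prop :=
  Measurable[(inferInstance : MeasurableSpace ℝ≥0).prod m] (fun p : ℝ≥0 × Ω => h (min p.1 t) p.2)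

lemma setLIntegral_congr_min (f : ℝ≥0 → ℝ≥0∞) {a : ℝ} {t : ℝ≥0} :
    ∫⁻ s in Set.Icc a t, f s.toNNReal = ∫⁻ s in Set.Icc a t, f (min s.toNNReal t) :=
  setLIntegral_congr_fun measurableSet_Icc fun s hs => by
    rw [min_eq_left (Real.toNNReal_le_iff_le_coe.2 hs.2)]

lemma MeasurableUpTo.lintegral {m : MeasurableSpace Ω} {t : ℝ≥0} {h : ℝ≥0 → Ω → ℝ≥0∞}
    (hh : MeasurableUpTo m t h) (a : ℝ) :
    Measurable[m] (fun ω => ∫⁻ s in Set.Icc a t, h s.toNNReal ω) := by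
  simp_rw [fun ω => setLIntegral_congr_min (fun s => h s ω) (a := a) (t := t)]
  have h1 : Measurable[(inferInstance : MeasurableSpace ℝ).prod m]
      (fun p : ℝ × Ω => h (min p.1.toNNReal t) p.2) :=
    hh.comp ((measurable_real_toNNReal.comp (@measurable_fst _ _ _ m)).prodMk
      (@measurable_snd _ _ _ m))
  exact @Measurable.lintegral_prod_left' _ _ _ m _ _ _ h1

lemma MeasurableUpTo.path {E : Type*} [MeasurableSpace E] {m : MeasurableSpace Ω} {t : ℝ≥0}
    {h : ℝ≥0 → Ω → E} (hh : MeasurableUpTo m t h) (ω : Ω) :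
    Measurable (fun s : ℝ => h (min s.toNNReal t) ω) :=
  hh.comp (measurable_real_toNNReal.prodMk (@measurable_const _ _ m _ ω))

lemma ennreal_add_sq_le (a b : ℝ≥0∞) : (a + b) ^ 2 ≤ 2 * (a ^ 2 + b ^ 2) := by
  rcases eq_or_ne a ∞ with rfl | ha
  · simp
  rcases eq_or_ne b ∞ with rfl | hb
  · simp
  lift a to ℝ≥0 using ha
  lift b to ℝ≥0 using hb
  have := add_sq_le (a := (a : ℝ)) (b := (b : ℝ))
  exact_mod_cast this

/-- **Maximal inequality for Itô integrals** stopped on leaving a decreasing adapted family of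
events: the integrand is approximated by differences of elementary integrands whose integrals
converge pointwise. -/
theorem lintegral_sup_ito_le {P : Measure Ω} [IsProbabilityMeasure P] {𝓗 : Filtration ℝ≥0 mΩ}
    {W : ℝ≥0 → Ω → ℝ} (hW : IsBrownianWrt P 𝓗 W) (T : ℝ≥0) (H H' : ℕ → SimpleIntegrand 𝓗)
    {h : ℝ≥0 → Ω → ℝ} (hh : ∀ t ≤ T, MeasurableUpTo (𝓗 t) t h)
    (hconv : ∀ᵐ ω ∂P, Tendsto (fun n => timeLIntegral
      (fun s => ‖(H n).value s ω - (H' n).value s ω - h s ω‖ₑ ^ 2) T) atTop (𝓝 0))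
    {Q : Set ℝ≥0} (hQ : Q.Countable) (hQT : ∀ t ∈ Q, t ≤ T) {M : ℝ≥0 → Ω → ℝ}
    (hM : ∀ᵐ ω ∂P, ∀ t ∈ Q, Tendsto (fun n => (H n).integral W t ω - (H' n).integral W t ω) atTop
      (𝓝 (M t ω)))
    {G : ℝ≥0 → Set Ω} (hG : ∀ t ≤ T, MeasurableSet[𝓗 t] (G t)) (hGa : Antitone G) :
    ∫⁻ ω, ⨆ t ∈ Q, (G t).indicator (fun ω => ‖M t ω‖ₑ ^ 2) ω ∂P ≤
      8 * ∫⁻ ω, timeLIntegral (fun s => (G s).indicator (fun ω => ‖h s ω‖ₑ ^ 2) ω) T ∂P := by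
  classical
  rcases Q.eq_empty_or_nonempty with rfl | hne
  · simp
  obtain ⟨q, rfl⟩ := hQ.exists_eq_range hne
  have hqT : ∀ i, q i ≤ T := fun i => hQT _ ⟨i, rfl⟩
  set R := ∫⁻ ω, timeLIntegral (fun s => (G s).indicator (fun ω => ‖h s ω‖ₑ ^ 2) ω) T ∂P with hR
  set err : ℕ → ℝ≥0 → Ω → ℝ≥0∞ := fun n s ω =>
    ‖(H n).value s ω - (H' n).value s ω - h s ω‖ₑ ^ 2 with herr
  set I : ℕ → ℝ≥0 → Ω → ℝ := fun n t ω => (H n).integral W t ω - (H' n).integral W t ω with hI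
  have herrm : ∀ n, ∀ t ≤ T, MeasurableUpTo (𝓗 t) t (err n) := fun n t ht =>
    (measurable_enorm.comp ((((H n).measurable_value t).sub ((H' n).measurable_value t)).sub
      (hh t ht))).pow_const 2
  have hIm : ∀ n t, Measurable (I n t) := by
    intro n t
    have : ∀ K : SimpleIntegrand 𝓗, Measurable (K.integral W t) := fun K => by
      unfold SimpleIntegrand.integral
      refine Finset.measurable_fun_sum _ fun i _ => ?_
      exact ((K.measurable_c i).mono (𝓗.le _) le_rfl).mul
        (((hW.adapted _).mono (𝓗.le _) le_rfl).sub ((hW.adapted _).mono (𝓗.le _) le_rfl))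
    exact (this _).sub (this _)
  have hκ : ∀ κ : ℝ≥0, 0 < κ → ∫⁻ ω, ⨆ t ∈ Set.range q, (G t).indicator
      (fun ω => ‖M t ω‖ₑ ^ 2) ω ∂P ≤ 8 * R + 9 * κ := by
    intro κ hκ
    -- Stopping also when the accumulated approximation error exceeds κ makes pathwise convergence
    -- of the integrands sufficient; no convergence in L²(P) is required.
    set G' : ℕ → ℝ≥0 → Set Ω := fun n t => G t ∩ {ω | ∫⁻ s in Set.Icc (0 : ℝ) t,
      err n s.toNNReal ω ≤ κ} with hG'
    have hG'm : ∀ n, ∀ t ≤ T, MeasurableSet[𝓗 t] (G' n t) := fun n t ht =>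
      (hG t ht).inter (measurableSet_le ((herrm n t ht).lintegral 0) measurable_const)
    have hG'a : ∀ n, Antitone (G' n) := fun n s t hst ω hω =>
      ⟨hGa hst hω.1, (lintegral_mono_set
        (Set.Icc_subset_Icc_right (NNReal.coe_le_coe.2 hst))).trans hω.2⟩
    -- Only the first n + 1 times are used, so that the inequality for finite sets of times applies;
    -- Fatou's lemma then recovers all of `Q`.
    set Sn : ℕ → Ω → ℝ≥0∞ := fun n ω => ((Finset.range (n + 1)).image q).sup
      (fun t => (G' n t).indicator (fun ω => ‖I n t ω‖ₑ ^ 2) ω) with hSn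
    have hSnm : ∀ n, Measurable (Sn n) := by
      intro n
      have : Sn n = ((Finset.range (n + 1)).image q).sup
          (fun t => (G' n t).indicator (fun ω => ‖I n t ω‖ₑ ^ 2)) := by
        ext ω
        simp only [hSn, Finset.sup_apply]
      rw [this]
      refine Finset.sup_induction measurable_const (fun f hf g hg => hf.sup hg) fun t ht => ?_
      obtain ⟨i, -, rfl⟩ := Finset.mem_image.1 ht
      exact ((hIm n _).enorm.pow_const 2).indicator (𝓗.le _ _ (hG'm n _ (hqT i)))
    have hbound : ∀ n, ∫⁻ ω, Sn n ω ∂P ≤ 8 * R + 9 * κ := by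
      intro n
      refine (lintegral_sup_simple_le hW T (H n) (H' n) (hG'm n) (hG'a n) _ ?_ hκ).trans ?_
      · intro t ht
        obtain ⟨i, -, rfl⟩ := Finset.mem_image.1 ht
        exact hqT i
      have hpath : ∀ ω, timeLIntegral (fun s => (G' n s).indicator
          (fun ω => ‖(H n).value s ω - (H' n).value s ω‖ₑ ^ 2) ω) T ≤
          2 * timeLIntegral (fun s => (G s).indicator (fun ω => ‖h s ω‖ₑ ^ 2) ω) T + 2 * κ := by
        intro ω
        -- `G' n` decreases in time, so these times form an interval. On every compact piece of it
        -- the error integral is at most κ.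
        have hA : ({s : ℝ | 0 ≤ s ∧ s ≤ T ∧ ω ∈ G' n s.toNNReal}).OrdConnected := by
          refine ⟨fun x hx y hy z hz => ⟨hx.1.trans hz.1, hz.2.trans hy.2.1, ?_⟩⟩
          exact hG'a n (Real.toNNReal_le_toNNReal hz.2) hy.2.2
        have hAle : ∫⁻ s in {s : ℝ | 0 ≤ s ∧ s ≤ T ∧ ω ∈ G' n s.toNNReal},
            err n s.toNNReal ω ≤ κ := by
          refine setLIntegral_le_of_ordConnected hA fun a ha b hb => ?_
          refine (lintegral_mono_set (Set.Icc_subset_Icc_left ha.1)).trans ?_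
          have := hb.2.2.2
          simp only [Set.mem_ofPred_eq, Real.coe_toNNReal _ hb.1] at this
          exact this
        have hpt : ∀ s : ℝ, s ∈ Set.Icc (0 : ℝ) T → (G' n s.toNNReal).indicator
            (fun ω => ‖(H n).value s.toNNReal ω - (H' n).value s.toNNReal ω‖ₑ ^ 2) ω ≤
            2 * (G s.toNNReal).indicator (fun ω => ‖h s.toNNReal ω‖ₑ ^ 2) ω +
            2 * ({s : ℝ | 0 ≤ s ∧ s ≤ T ∧ ω ∈ G' n s.toNNReal}).indicator
              (fun s => err n (min s.toNNReal T) ω) s := by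
          intro s hs
          by_cases hω : ω ∈ G' n s.toNNReal
          · rw [Set.indicator_of_mem hω, Set.indicator_of_mem hω.1,
              Set.indicator_of_mem (show s ∈ {s : ℝ | 0 ≤ s ∧ s ≤ T ∧ ω ∈ G' n s.toNNReal} from
                ⟨hs.1, hs.2, hω⟩), ← mul_add]
            simp only [herr]
            have h1 : ‖(H n).value s.toNNReal ω - (H' n).value s.toNNReal ω‖ₑ ≤
                ‖h s.toNNReal ω‖ₑ +
                ‖(H n).value s.toNNReal ω - (H' n).value s.toNNReal ω - h s.toNNReal ω‖ₑ := by
              refine le_trans (le_of_eq ?_) (enorm_add_le _ _)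
              congr 1; ring
            refine (pow_le_pow_left' h1 2).trans ?_
            rw [min_eq_left (Real.toNNReal_le_iff_le_coe.2 hs.2)]
            exact ennreal_add_sq_le _ _
          · rw [Set.indicator_of_notMem hω]
            exact zero_le
        unfold timeLIntegral
        refine (setLIntegral_mono' measurableSet_Icc hpt).trans ?_
        rw [lintegral_add_right', lintegral_const_mul', lintegral_const_mul']
        · gcongr
          refine (lintegral_mono_set (Set.subset_univ _)).trans ?_
          rw [setLIntegral_univ, lintegral_indicator hA.measurableSet]
          refine le_trans (le_of_eq ?_) hAle
          refine setLIntegral_congr_fun hA.measurableSet fun s hs => ?_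
          rw [min_eq_left (Real.toNNReal_le_iff_le_coe.2 hs.2.1)]
        · simp
        · simp
        · refine Measurable.aemeasurable (Measurable.const_mul (Measurable.indicator ?_
            hA.measurableSet) _)
          exact (herrm n T le_rfl).path ω
      calc _ ≤ 4 * (∫⁻ ω, (2 * timeLIntegral (fun s => (G s).indicator
              (fun ω => ‖h s ω‖ₑ ^ 2) ω) T + 2 * κ) ∂P) + κ := by
            gcongr with ω
            exact hpath ω
        _ = 8 * R + 9 * κ := by
            rw [lintegral_add_right _ measurable_const, lintegral_const, measure_univ, mul_one,
              lintegral_const_mul' _ _ (by simp), hR]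
            ring
    -- For a fixed time the total error is eventually below κ and the time is eventually among the
    -- first n + 1, so `G'` imposes nothing beyond `G`.
    have hlim : ∀ᵐ ω ∂P, ⨆ t ∈ Set.range q, (G t).indicator (fun ω => ‖M t ω‖ₑ ^ 2) ω ≤
        liminf (fun n => Sn n ω) atTop := by
      filter_upwards [hconv, hM] with ω h1 h2
      refine iSup₂_le fun t ht => ?_
      obtain ⟨i, rfl⟩ := ht
      by_cases hω : ω ∈ G (q i)
      · rw [Set.indicator_of_mem hω]
        have h3 : Tendsto (fun n => ‖I n (q i) ω‖ₑ ^ 2) atTop (𝓝 (‖M (q i) ω‖ₑ ^ 2)) := by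
          have := ((h2 _ ⟨i, rfl⟩).enorm)
          exact (ENNReal.continuous_pow 2).continuousAt.tendsto.comp this
        rw [← h3.liminf_eq]
        refine liminf_le_liminf ?_
        have h4 : ∀ᶠ n in atTop, timeLIntegral (fun s => err n s ω) T ≤ κ :=
          (h1.eventually (gt_mem_nhds (ENNReal.coe_pos.2 hκ))).mono fun n hn => hn.le
        filter_upwards [h4, eventually_ge_atTop i] with n hn hin
        have h5 : ω ∈ G' n (q i) := ⟨hω, (lintegral_mono_set
          (Set.Icc_subset_Icc_right (NNReal.coe_le_coe.2 (hqT i)))).trans hn⟩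
        have h6 : (G' n (q i)).indicator (fun ω => ‖I n (q i) ω‖ₑ ^ 2) ω ≤ Sn n ω :=
          Finset.le_sup (f := fun t => (G' n t).indicator (fun ω => ‖I n t ω‖ₑ ^ 2) ω)
            (Finset.mem_image.2 ⟨i, Finset.mem_range.2 (by omega), rfl⟩)
        rwa [Set.indicator_of_mem h5] at h6
      · rw [Set.indicator_of_notMem hω]
        exact zero_le
    calc _ ≤ ∫⁻ ω, liminf (fun n => Sn n ω) atTop ∂P := lintegral_mono_ae hlim
      _ ≤ liminf (fun n => ∫⁻ ω, Sn n ω ∂P) atTop := lintegral_liminf_le hSnm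
      _ ≤ 8 * R + 9 * κ := by
        refine liminf_le_of_frequently_le' (Frequently.of_forall hbound)
  refine ENNReal.le_of_forall_pos_le_add fun ε hε _ => ?_
  have := hκ (ε / 9) (by positivity)
  refine this.trans (le_of_eq ?_)
  congr 1
  have : (9 : ℝ≥0) * (ε / 9) = ε := by field_simp
  exact_mod_cast this

/-! ### Tame paths: deterministic estimates along one path. -/

/-- The path `d` has stayed bounded by `1` up to time `t`, and since it left `0` the counting paths
`N` have not jumped and the clock `∫ k` has not advanced by more than `ε`. Times are tested along
the set `Q`. -/
def Tame {ι κ : Type*} (Q : Set ℝ≥0) (ε : ℝ≥0∞) (d : ι → ℝ≥0 → ℝ) (N : κ → ℝ≥0 → ℕ)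
    (k : ℝ≥0 → ℝ≥0∞) (t : ℝ≥0) : Prop :=
  ∀ q ∈ Q, q ≤ t → (∀ u, |d u q| ≤ 1) ∧ ((∀ u, d u q = 0) ∨
    ((∀ ζ, N ζ q = N ζ t) ∧ ∫⁻ s in Set.Icc (q : ℝ) t, k s.toNNReal ≤ ε))

/-- The supremum of `|d u|` over the times in `Q` at which the path is tame. -/
def tameSup {ι κ : Type*} (Q : Set ℝ≥0) (ε : ℝ≥0∞) (d : ι → ℝ≥0 → ℝ) (N : κ → ℝ≥0 → ℕ)
    (k : ℝ≥0 → ℝ≥0∞) (u : ι) : ℝ≥0∞ :=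
  ⨆ t ∈ Q, {t | Tame Q ε d N k t}.indicator (fun t => ‖d u t‖ₑ) t

section Path

variable {ι κ : Type*} {Q : Set ℝ≥0} {ε : ℝ≥0∞} {d : ι → ℝ≥0 → ℝ} {N : κ → ℝ≥0 → ℕ}
  {k : ℝ≥0 → ℝ≥0∞} {T : ℝ≥0}

lemma Tame.anti (hN : ∀ ζ, Monotone (N ζ)) {s t : ℝ≥0} (hst : s ≤ t) (h : Tame Q ε d N k t) :
    Tame Q ε d N k s := by
  intro q hq hqs
  obtain ⟨h1, h2⟩ := h q hq (hqs.trans hst)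
  refine ⟨h1, h2.imp_right fun h3 => ⟨fun ζ => ?_, ?_⟩⟩
  · exact le_antisymm (hN ζ hqs) ((hN ζ hst).trans (h3.1 ζ).ge)
  · exact (lintegral_mono_set (Set.Icc_subset_Icc_right (NNReal.coe_le_coe.2 hst))).trans h3.2

/-- Right-continuity keeps `d u` nonzero for a while after `z`, long enough to meet the dense set
`Q`. Conditions imposed only at times in `Q` thereby detect every departure from 0. -/
lemma exists_mem_Ioo_ne_zero (hQ : ∀ s t : ℝ≥0, s < t → t ≤ T → ∃ q ∈ Q, s < q ∧ q < t)
    (hd : ∀ u t, ContinuousWithinAt (d u) (Set.Ici t) t) {z s : ℝ≥0} (hzs : z < s) (hsT : s ≤ T)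
    {u : ι} (hz : d u z ≠ 0) : ∃ q ∈ Q, z < q ∧ q < s ∧ d u q ≠ 0 := by
  have h1 : ∀ᶠ y in 𝓝[≥] z, d u y ≠ 0 := (hd u z).eventually_ne hz
  obtain ⟨c, hc, hcs⟩ := (mem_nhdsGE_iff_exists_Ico_subset' hzs).1 h1
  obtain ⟨q, hq, h2, h3⟩ := hQ z (min c s) (lt_min hc hzs) ((min_le_right _ _).trans hsT)
  exact ⟨q, hq, h2, h3.trans_le (min_le_right _ _), hcs ⟨h2.le, h3.trans_le (min_le_left _ _)⟩⟩

/-- Values at a time outside `Q` are limits from the right of values at times in `Q`. These times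
are tame only if they precede `t`, hence the strict inequality `s < t`. -/
lemma enorm_le_tameSup (hQ : ∀ s t : ℝ≥0, s < t → t ≤ T → ∃ q ∈ Q, s < q ∧ q < t)
    (hN : ∀ ζ, Monotone (N ζ)) (hd : ∀ u t, ContinuousWithinAt (d u) (Set.Ici t) t) {s t : ℝ≥0}
    (hst : s < t) (htT : t ≤ T) (ht : Tame Q ε d N k t) (u : ι) :
    ‖d u s‖ₑ ≤ tameSup Q ε d N k u := by
  by_contra! hcon
  have h1 : ∀ᶠ y in 𝓝[≥] s, tameSup Q ε d N k u < ‖d u y‖ₑ :=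
    (hd u s).enorm.eventually (lt_mem_nhds hcon)
  obtain ⟨c, hc, hcs⟩ := (mem_nhdsGE_iff_exists_Ico_subset' hst).1 h1
  obtain ⟨q, hq, h2, h3⟩ := hQ s (min c t) (lt_min hc hst) ((min_le_right _ _).trans htT)
  have h4 : tameSup Q ε d N k u < ‖d u q‖ₑ := hcs ⟨h2.le, h3.trans_le (min_le_left _ _)⟩
  refine absurd h4 (not_lt.2 ?_)
  have h5 : Tame Q ε d N k q := ht.anti hN (h3.le.trans (min_le_right _ _))
  refine le_trans (le_of_eq ?_) (le_iSup₂ (f := fun t (_ : t ∈ Q) =>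
    {t | Tame Q ε d N k t}.indicator (fun t => ‖d u t‖ₑ) t) q hq)
  exact (Set.indicator_of_mem (s := {t | Tame Q ε d N k t}) h5 (fun t => ‖d u t‖ₑ)).symm

lemma tameSup_le_one (u : ι) : tameSup Q ε d N k u ≤ 1 := by
  refine iSup₂_le fun t ht => ?_
  by_cases h : Tame Q ε d N k t
  · rw [Set.indicator_of_mem (show t ∈ {t | Tame Q ε d N k t} from h),
      Real.enorm_eq_ofReal_abs, ← ENNReal.ofReal_one]
    exact ENNReal.ofReal_le_ofReal ((h t ht le_rfl).1 u)
  · rw [Set.indicator_of_notMem (show t ∉ {t | Tame Q ε d N k t} from h)]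
    exact zero_le

lemma sum_tameSup_ne_top [Fintype ι] : ∑ u, tameSup Q ε d N k u ≠ ∞ :=
  ENNReal.sum_ne_top.2 fun u _ => ((tameSup_le_one u).trans_lt ENNReal.one_lt_top).ne

lemma eq_zero_of_lt_sInf {s : ℝ≥0} (hs : s < sInf {s | ∃ u, d u s ≠ 0}) (u : ι) : d u s = 0 := by
  by_contra h
  exact absurd (csInf_le (OrderBot.bddBelow _) (show s ∈ {s | ∃ u, d u s ≠ 0} from ⟨u, h⟩))
    (not_le.2 hs)

lemma exists_mem_ne_zero_of_sInf_lt
    (hQ : ∀ s t : ℝ≥0, s < t → t ≤ T → ∃ q ∈ Q, s < q ∧ q < t)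
    (hd : ∀ u t, ContinuousWithinAt (d u) (Set.Ici t) t)
    (hne : {s | ∃ u, d u s ≠ 0}.Nonempty) {s : ℝ≥0} (hs : sInf {s | ∃ u, d u s ≠ 0} < s)
    (hsT : s ≤ T) : ∃ q ∈ Q, q < s ∧ ∃ u, d u q ≠ 0 := by
  obtain ⟨z, ⟨u, hz⟩, hzs⟩ := exists_lt_of_csInf_lt hne hs
  obtain ⟨q, hq, -, h2, h3⟩ := exists_mem_Ioo_ne_zero hQ hd hzs hsT hz
  exact ⟨q, hq, h2, u, h3⟩

/-- While the path is tame, its clock since leaving `0` is bounded by `ε`. -/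
lemma timeLIntegral_tame_le [Fintype ι]
    (hQ : ∀ s t : ℝ≥0, s < t → t ≤ T → ∃ q ∈ Q, s < q ∧ q < t)
    (hN : ∀ ζ, Monotone (N ζ)) (hd : ∀ u t, ContinuousWithinAt (d u) (Set.Ici t) t)
    (hleft : ∀ t ≤ T, (∀ s < t, ∀ u, d u s = 0) → ∀ u, d u t = 0) {p : ℕ} (hp : p ≠ 0) :
    timeLIntegral (fun s => {t | Tame Q ε d N k t}.indicator
      (fun s => k s * (∑ u, ‖d u s‖ₑ) ^ p) s) T ≤ ε * (∑ u, tameSup Q ε d N k u) ^ p := by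
  set S := ∑ u, tameSup Q ε d N k u
  set θ := sInf {s | ∃ u, d u s ≠ 0} with hθ
  rcases Set.eq_empty_or_nonempty {s | ∃ u, d u s ≠ 0} with hem | hne
  · have h0 : ∀ s u, d u s = 0 := by
      intro s u
      by_contra h
      exact absurd (show s ∈ {s | ∃ u, d u s ≠ 0} from ⟨u, h⟩) (by rw [hem]; simp)
    simp [timeLIntegral, h0, hp]
  -- The tame times after the departure from 0. Before any point of `A` there is a time of `Q` with
  -- a nonzero value, so tameness bounds the clock over every compact piece of `A` by ε.
  set A : Set ℝ := {s : ℝ | θ < s ∧ s ≤ T ∧ Tame Q ε d N k s.toNNReal} with hA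
  have hAo : A.OrdConnected := by
    refine ⟨fun x hx y hy z hz => ⟨hx.1.trans_le hz.1, hz.2.trans hy.2.1, ?_⟩⟩
    exact hy.2.2.anti hN (Real.toNNReal_le_toNNReal hz.2)
  have hpos : ∀ s ∈ A, 0 ≤ s := fun s hs => θ.2.trans hs.1.le
  have hAε : ∫⁻ s in A, k s.toNNReal ≤ ε := by
    refine setLIntegral_le_of_ordConnected hAo fun a ha b hb => ?_
    rcases le_or_gt a b with hab | hab
    swap
    · simp [Set.Icc_eq_empty (not_le.2 hab)]
    obtain ⟨q, hq, hqa, u, hu⟩ := exists_mem_ne_zero_of_sInf_lt hQ hd hne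
      (s := a.toNNReal) (Real.lt_toNNReal_iff_coe_lt.2 ha.1)
      (Real.toNNReal_le_iff_le_coe.2 ha.2.1)
    have hqa' : (q : ℝ) ≤ a := (Real.lt_toNNReal_iff_coe_lt.1 hqa).le
    have h1 := (hb.2.2 q hq (hqa.le.trans (Real.toNNReal_le_toNNReal hab))).2
    have h2 := (h1.resolve_left fun h => hu (h u)).2
    rw [Real.coe_toNNReal _ (hpos b hb)] at h2
    exact (lintegral_mono_set (Set.Icc_subset_Icc_left hqa')).trans h2
  -- A possible last point of `A` has no later tame time, so `enorm_le_tameSup` does not apply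
  -- there; it is a null set.
  have hmax : volume {s | s ∈ A ∧ ∀ t ∈ A, t ≤ s} = 0 :=
    Set.Subsingleton.measure_zero (fun x hx y hy => le_antisymm (hy.2 x hx.1) (hx.2 y hy.1)) _
  have hae : ∀ᵐ s ∂(volume : Measure ℝ), s ∉ {s | s ∈ A ∧ ∀ t ∈ A, t ≤ s} := by
    rw [ae_iff]; simpa using hmax
  have hpt : ∀ᵐ s ∂(volume.restrict (Set.Icc (0 : ℝ) T)),
      {t | Tame Q ε d N k t}.indicator (fun s => k s * (∑ u, ‖d u s‖ₑ) ^ p) s.toNNReal ≤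
      A.indicator (fun s => k s.toNNReal * S ^ p) s := by
    filter_upwards [ae_restrict_of_ae hae, ae_restrict_mem measurableSet_Icc] with s hs hsI
    by_cases ht : Tame Q ε d N k s.toNNReal
    swap
    · rw [Set.indicator_of_notMem (show s.toNNReal ∉ {t | Tame Q ε d N k t} from ht)]
      exact zero_le
    rw [Set.indicator_of_mem (show s.toNNReal ∈ {t | Tame Q ε d N k t} from ht)]
    rcases le_or_gt s θ with hsθ | hsθ
    · have h0 : ∀ u, d u s.toNNReal = 0 := by
        have hsθ' : s.toNNReal ≤ θ := Real.toNNReal_le_iff_le_coe.2 hsθ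
        refine hleft _ (Real.toNNReal_le_iff_le_coe.2 hsI.2) fun r hr u =>
          eq_zero_of_lt_sInf (hr.trans_le hsθ') u
      simp [h0, hp]
    · have hsA : s ∈ A := ⟨hsθ, hsI.2, ht⟩
      rw [Set.indicator_of_mem hsA]
      gcongr k s.toNNReal * ?_ ^ p
      refine Finset.sum_le_sum fun u _ => ?_
      have : ∃ t ∈ A, s < t := by
        by_contra! hcon
        exact hs ⟨hsA, hcon⟩
      obtain ⟨t, htA, hst⟩ := this
      exact enorm_le_tameSup hQ hN hd
        ((Real.toNNReal_lt_toNNReal_iff_of_nonneg hsI.1).2 hst)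
        (Real.toNNReal_le_iff_le_coe.2 htA.2.1) htA.2.2 u
  calc _ ≤ ∫⁻ s in Set.Icc (0 : ℝ) T, A.indicator (fun s => k s.toNNReal * S ^ p) s :=
        lintegral_mono_ae hpt
    _ ≤ ∫⁻ s, A.indicator (fun s => k s.toNNReal * S ^ p) s := setLIntegral_le_lintegral _ _
    _ = ∫⁻ s in A, k s.toNNReal * S ^ p := lintegral_indicator hAo.measurableSet _
    _ ≤ ε * S ^ p := by
        rw [lintegral_mul_const' _ _ (ENNReal.pow_ne_top sum_tameSup_ne_top)]
        gcongr

/-- A nonzero value before `s` produces a nonzero value at a time q < s in `Q`, and tameness forbids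
jumps from q on. So up to a tame time, jumps can occur only at times before which the path has been
0 throughout. -/
lemma Tame.zero_or_const
    (hQ : ∀ s t : ℝ≥0, s < t → t ≤ T → ∃ q ∈ Q, s < q ∧ q < t)
    (hN : ∀ ζ, Monotone (N ζ)) (hd : ∀ u t, ContinuousWithinAt (d u) (Set.Ici t) t)
    {t : ℝ≥0} (htT : t ≤ T) (ht : Tame Q ε d N k t) {s : ℝ≥0} (hst : s ≤ t) :
    (∀ r < s, ∀ u, d u r = 0) ∨ ∃ q < s, ∀ ζ, N ζ q = N ζ s := by
  by_cases h : ∀ r < s, ∀ u, d u r = 0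
  · exact Or.inl h
  push Not at h
  obtain ⟨r, hr, u, hu⟩ := h
  obtain ⟨q, hq, -, hqs, hqu⟩ := exists_mem_Ioo_ne_zero hQ hd hr (hst.trans htT) hu
  have h1 := ((ht q hq (hqs.le.trans hst)).2.resolve_left fun h => hqu (h u)).1
  exact Or.inr ⟨q, hqs, fun ζ => le_antisymm (hN ζ hqs.le) ((hN ζ hst).trans (h1 ζ).ge)⟩

/-- At the time θ of leaving 0 the path is still 0 by `hleft`. For a short time after θ it is
bounded by 1, the counting paths are constant and the clock advances by less than ε. So these times
are tame, and the path vanishes there after all. -/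
lemma eq_zero_of_tame_eq_zero [Finite ι] [Finite κ]
    (hQ : ∀ s t : ℝ≥0, s < t → t ≤ T → ∃ q ∈ Q, s < q ∧ q < t) (hε : 0 < ε)
    (hNc : ∀ ζ t, ContinuousWithinAt (N ζ) (Set.Ici t) t)
    (hd : ∀ u t, ContinuousWithinAt (d u) (Set.Ici t) t)
    (hleft : ∀ t ≤ T, (∀ s < t, ∀ u, d u s = 0) → ∀ u, d u t = 0)
    (hk : timeLIntegral k T < ∞)
    (htame : ∀ t ∈ Q, t ≤ T → Tame Q ε d N k t → ∀ u, d u t = 0) :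
    ∀ t ≤ T, ∀ u, d u t = 0 := by
  intro t₁ ht₁ u₁
  by_contra hu₁
  set θ := sInf {s | ∃ u, d u s ≠ 0} with hθ
  have hne : {s | ∃ u, d u s ≠ 0}.Nonempty := ⟨t₁, u₁, hu₁⟩
  have hθt : θ ≤ t₁ := csInf_le (OrderBot.bddBelow _) ⟨u₁, hu₁⟩
  have hbefore : ∀ s ≤ θ, ∀ u, d u s = 0 := fun s hs =>
    hleft s (hs.trans (hθt.trans ht₁)) fun r hr u => eq_zero_of_lt_sInf (hr.trans_le hs) u
  have hθlt : θ < t₁ := hθt.lt_of_ne fun h => hu₁ (h ▸ hbefore θ le_rfl u₁)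
  have hθT : θ < T := hθlt.trans_le ht₁
  have e1 : ∀ᶠ s in 𝓝[≥] θ, ∀ u, |d u s| ≤ 1 := by
    refine eventually_all.2 fun u => ?_
    have h1 : Tendsto (fun s => |d u s|) (𝓝[≥] θ) (𝓝 |d u θ|) := (hd u θ).abs
    rw [hbefore θ le_rfl u, abs_zero] at h1
    exact (h1.eventually (gt_mem_nhds one_pos)).mono fun s hs => hs.le
  have e2 : ∀ᶠ s in 𝓝[≥] θ, ∀ ζ, N ζ s = N ζ θ := by
    refine eventually_all.2 fun ζ => ?_
    have h1 : Tendsto (N ζ) (𝓝[≥] θ) (𝓝 (N ζ θ)) := hNc ζ θ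
    rw [nhds_discrete, tendsto_pure] at h1
    exact h1
  -- Absolute continuity of the integral of `k` over [0, T].
  have e3 : ∀ᶠ s : ℝ≥0 in 𝓝[≥] θ, ∫⁻ r in Set.Icc (θ : ℝ) s, k r.toNNReal ≤ ε := by
    have h1 : Tendsto (fun s : ℝ≥0 => volume.restrict (Set.Icc (0 : ℝ) T) (Set.Icc (θ : ℝ) s))
        (𝓝[≥] θ) (𝓝 0) := by
      have h2 : Tendsto (fun s : ℝ≥0 => ENNReal.ofReal ((s : ℝ) - θ)) (𝓝[≥] θ) (𝓝 0) := by
        have h3 : Continuous (fun s : ℝ≥0 => ENNReal.ofReal ((s : ℝ) - θ)) :=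
          ENNReal.continuous_ofReal.comp (by fun_prop)
        have := h3.tendsto θ
        simp only [sub_self, ENNReal.ofReal_zero] at this
        exact this.mono_left nhdsWithin_le_nhds
      refine tendsto_of_tendsto_of_tendsto_of_le_of_le tendsto_const_nhds h2
        (fun s => zero_le) fun s => ?_
      exact (Measure.restrict_apply_le _ _).trans (by rw [Real.volume_Icc])
    have h4 := tendsto_setLIntegral_zero (f := fun r : ℝ => k r.toNNReal) hk.ne h1
    filter_upwards [h4.eventually (gt_mem_nhds hε),
      mem_nhdsWithin_of_mem_nhds (Iic_mem_nhds hθT)] with s hs hsT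
    rw [Measure.restrict_restrict measurableSet_Icc, Set.inter_eq_left.2] at hs
    · exact hs.le
    · exact Set.Icc_subset_Icc θ.2 (NNReal.coe_le_coe.2 hsT)
  obtain ⟨c, hc, hcs⟩ := (mem_nhdsGE_iff_exists_Ico_subset' hθT).1 (e1.and (e2.and e3))
  have hzero : ∀ q ∈ Q, θ < q → q < min c T → ∀ u, d u q = 0 := by
    intro q hq h1 h2
    refine htame q hq (h2.le.trans (min_le_right _ _)) fun q' hq' hqq' => ?_
    rcases le_or_gt q' θ with h3 | h3
    · exact ⟨fun u => by simp [hbefore q' h3 u], Or.inl (hbefore q' h3)⟩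
    · have g1 := hcs (show q' ∈ Set.Ico θ c from
        ⟨h3.le, hqq'.trans_lt (h2.trans_le (min_le_left _ _))⟩)
      have g2 := hcs (show q ∈ Set.Ico θ c from ⟨h1.le, h2.trans_le (min_le_left _ _)⟩)
      refine ⟨g1.1, Or.inr ⟨fun ζ => (g1.2.1 ζ).trans (g2.2.1 ζ).symm, ?_⟩⟩
      exact (lintegral_mono_set (Set.Icc_subset_Icc_left (NNReal.coe_le_coe.2 h3.le))).trans g2.2.2
  obtain ⟨z, ⟨u, hz⟩, hzs⟩ := exists_lt_of_csInf_lt hne (show θ < min c T from lt_min hc hθT)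
  have hθz : θ ≤ z := csInf_le (OrderBot.bddBelow _) ⟨u, hz⟩
  obtain ⟨q, hq, h2, h3, h4⟩ := exists_mem_Ioo_ne_zero hQ hd hzs (min_le_right _ _) hz
  exact h4 (hzero q hq (hθz.trans_lt h2) h3 u)

end Path

/-! ### Uniqueness for linear Itô systems. -/

/-- Right-continuous adapted processes are progressively measurable. -/
lemma measurableUpTo_of_rightContinuous {E : Type*} [TopologicalSpace E]
    [TopologicalSpace.PseudoMetrizableSpace E] [MeasurableSpace E] [BorelSpace E]
    {m : MeasurableSpace Ω} {t : ℝ≥0} {x : ℝ≥0 → Ω → E}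
    (hx : ∀ s ≤ t, Measurable[m] (x s))
    (hc : ∀ ω s, ContinuousWithinAt (fun s => x s ω) (Set.Ici s) s) : MeasurableUpTo m t x := by
  -- Times are rounded up to multiples of 1/(n + 1): the approximation takes countably many values
  -- and converges from the right.
  set g : ℕ → ℝ≥0 → ℝ≥0 := fun n s => (⌈s * (n + 1)⌉₊ : ℝ≥0) / (n + 1) with hg
  have hle : ∀ n s, s ≤ g n s := fun n s => by
    rw [hg, le_div_iff₀ (by positivity)]
    exact Nat.le_ceil _
  have hge : ∀ n s, g n s ≤ s + 1 / (n + 1) := fun n s => by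
    rw [hg, div_le_iff₀ (by positivity), add_mul, one_div, inv_mul_cancel₀ (by positivity)]
    exact (Nat.ceil_lt_add_one zero_le).le
  have hlim : ∀ s, Tendsto (fun n => g n s) atTop (𝓝 s) := by
    intro s
    refine tendsto_of_tendsto_of_tendsto_of_le_of_le tendsto_const_nhds ?_ (fun n => hle n s)
      fun n => hge n s
    have : Tendsto (fun n : ℕ => s + 1 / ((n : ℝ≥0) + 1)) atTop (𝓝 (s + 0)) :=
      tendsto_const_nhds.add tendsto_one_div_add_atTop_nhds_zero_nat
    simpa using this
  refine measurable_of_tendsto_metrizable (f := fun n (p : ℝ≥0 × Ω) => x (min (g n p.1) t) p.2)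
    (fun n => ?_) ?_
  · have h1 : Measurable[(⊤ : MeasurableSpace ℕ).prod m]
        (fun p : ℕ × Ω => x (min ((p.1 : ℝ≥0) / (n + 1)) t) p.2) :=
      measurable_from_prod_countable_right fun j =>
        hx (min ((j : ℝ≥0) / (n + 1)) t) (min_le_right _ _)
    have h2 : Measurable (fun s : ℝ≥0 => ⌈s * (n + 1)⌉₊) :=
      Nat.measurable_ceil.comp (measurable_id.mul_const _)
    have h3 : Measurable[(inferInstance : MeasurableSpace ℝ≥0).prod m,
        (⊤ : MeasurableSpace ℕ).prod m] (fun p : ℝ≥0 × Ω => (⌈p.1 * (n + 1)⌉₊, p.2)) :=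
      (h2.comp (@measurable_fst _ _ _ m)).prodMk (@measurable_snd _ _ _ m)
    have h4 := h1.comp h3
    simp only [Function.comp_def] at h4
    simp only [hg]
    exact h4
  · rw [tendsto_pi_nhds]
    intro p
    refine (hc p.2 (min p.1 t)).tendsto.comp (tendsto_nhdsWithin_iff.2 ⟨?_, ?_⟩)
    · exact (hlim p.1).min tendsto_const_nhds
    · exact Eventually.of_forall fun n => min_le_min_right _ (hle n p.1)

/-- Uniqueness for a linear Itô system with zero initial value that can restart from `0` only
continuously: a family `d` of right-continuous processes whose increments are controlled, between
jumps of the counting processes `N`, by `∫ r u * d u dW` and a linear drift, vanishes. -/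
theorem ae_eq_zero_of_linear_ito {P : Measure Ω} [IsProbabilityMeasure P] {𝓗 : Filtration ℝ≥0 mΩ}
    {W : ℝ≥0 → Ω → ℝ} (hW : IsBrownianWrt P 𝓗 W) (T : ℝ≥0) {ι κ : Type*} [Fintype ι] [Finite κ]
    {d : ι → ℝ≥0 → Ω → ℝ} (hdm : ∀ u, ∀ t ≤ T, Measurable[𝓗 t] (d u t))
    (hd : ∀ ω u t, ContinuousWithinAt (fun t => d u t ω) (Set.Ici t) t)
    {N : κ → ℝ≥0 → Ω → ℕ} (hNm : ∀ ζ t, Measurable[𝓗 t] (N ζ t))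
    (hN : ∀ ω ζ, Monotone (fun t => N ζ t ω))
    (hNc : ∀ ω ζ t, ContinuousWithinAt (fun t => N ζ t ω) (Set.Ici t) t)
    {k : ℝ≥0 → Ω → ℝ≥0∞} (hkm : ∀ t ≤ T, MeasurableUpTo (𝓗 t) t k)
    (hk : ∀ᵐ ω ∂P, timeLIntegral (fun s => k s ω) T < ∞)
    {r : ι → ℝ≥0 → Ω → ℝ} (hrm : ∀ u, ∀ t ≤ T, MeasurableUpTo (𝓗 t) t (r u))
    (hrk : ∀ u s ω, ‖r u s ω‖ₑ ^ 2 ≤ k s ω)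
    {H H' : ι → ℕ → SimpleIntegrand 𝓗}
    (hconv : ∀ u, ∀ᵐ ω ∂P, Tendsto (fun n => timeLIntegral (fun s =>
      ‖(H u n).value s ω - (H' u n).value s ω - r u s ω * d u s ω‖ₑ ^ 2) T) atTop (𝓝 0))
    {M : ι → ℝ≥0 → Ω → ℝ}
    (hM : ∀ u, ∀ᵐ ω ∂P, ∀ t ≤ T, Tendsto
      (fun n => (H u n).integral W t ω - (H' u n).integral W t ω) atTop (𝓝 (M u t ω)))
    {C : ℝ≥0}
    (hdrift : ∀ᵐ ω ∂P, ∀ t ≤ T, (∀ s, 0 < s → s ≤ t →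
        (∀ r < s, ∀ u, d u r ω = 0) ∨ ∃ q < s, ∀ ζ, N ζ q ω = N ζ s ω) →
      ∀ u, ‖d u t ω - M u t ω‖ₑ ≤
        C * timeLIntegral (fun s => k s ω * ∑ v, ‖d v s ω‖ₑ) t)
    (hleft : ∀ᵐ ω ∂P, ∀ t ≤ T, (∀ s < t, ∀ u, d u s ω = 0) → ∀ u, d u t ω = 0) :
    ∀ᵐ ω ∂P, ∀ t ≤ T, ∀ u, d u t ω = 0 := by
  classical
  -- Countable, so that tame events and suprema are measurable; dense in [0, T], so that
  -- right-continuous paths are controlled.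
  set Q : Set ℝ≥0 := Set.range (TopologicalSpace.denseSeq ℝ≥0) ∩ Set.Iic T with hQdef
  have hQc : Q.Countable := (Set.countable_range _).mono Set.inter_subset_left
  have hQT : ∀ t ∈ Q, t ≤ T := fun t ht => ht.2
  have hQ : ∀ s t : ℝ≥0, s < t → t ≤ T → ∃ q ∈ Q, s < q ∧ q < t := by
    intro s t hst htT
    obtain ⟨i, hi⟩ := (TopologicalSpace.denseRange_denseSeq ℝ≥0).exists_mem_open
      (isOpen_Ioo (a := s) (b := t)) (Set.nonempty_Ioo.2 hst)
    exact ⟨_, ⟨⟨i, rfl⟩, hi.2.le.trans htT⟩, hi.1, hi.2⟩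
  set n : ℝ≥0 := (Fintype.card ι : ℝ≥0) with hn
  -- Chosen for `hε1`, the contraction constant of `hmain`: 2(Cε)² comes from the drift, 16ε = 2·8ε
  -- from the maximal inequality, and n² from passing between single components and their sum. The
  -- summands 1 and 16 keep the denominator positive.
  set ε : ℝ≥0 := 1 / (4 * ((n ^ 2 + 1) * (2 * C ^ 2 + 16))) with hε
  have hεpos : 0 < ε := by positivity
  have hε1 : n * (n * (2 * (C * ε) ^ 2 + 16 * ε)) ≤ 1 / 2 := by
    have e1 : (n ^ 2 + 1) * (2 * C ^ 2 + 16) * ε = 1 / 4 := by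
      rw [hε]
      have : (2 * C ^ 2 + 16 : ℝ≥0) ≠ 0 := by positivity
      field_simp
    have e2 : ε ≤ 1 := by
      rw [hε, div_le_one (by positivity)]
      have h1 : (1 : ℝ≥0) ≤ n ^ 2 + 1 := le_add_self
      have h2 : (1 : ℝ≥0) ≤ 2 * C ^ 2 + 16 := le_add_left (by norm_num)
      calc (1 : ℝ≥0) = 1 * (1 * 1) := by norm_num
        _ ≤ 4 * ((n ^ 2 + 1) * (2 * C ^ 2 + 16)) := by gcongr; norm_num
    calc n * (n * (2 * (C * ε) ^ 2 + 16 * ε)) = n ^ 2 * ((2 * C ^ 2 * ε + 16) * ε) := by ring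
      _ ≤ n ^ 2 * ((2 * C ^ 2 * 1 + 16) * ε) := by gcongr
      _ ≤ (n ^ 2 + 1) * ((2 * C ^ 2 * 1 + 16) * ε) := by gcongr; exact le_self_add
      _ = 1 / 4 := by rw [← e1]; ring
      _ ≤ 1 / 2 := by
        rw [← NNReal.coe_le_coe]
        norm_num
  set G : ℝ≥0 → Set Ω := fun t =>
    {ω | Tame Q ε (fun u t => d u t ω) (fun ζ t => N ζ t ω) (fun t => k t ω) t} with hG
  have hGa : Antitone G := fun s t hst ω hω => by
    have h : Tame Q ε (fun u t => d u t ω) (fun ζ t => N ζ t ω) (fun t => k t ω) t := hω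
    exact h.anti (hN ω) hst
  have hGm : ∀ t ≤ T, MeasurableSet[𝓗 t] (G t) := by
    intro t ht
    have e : G t = ⋂ q ∈ Q, ⋂ (_ : q ≤ t), ((⋂ u, {ω | |d u q ω| ≤ 1}) ∩
        ((⋂ u, {ω | d u q ω = 0}) ∪ ((⋂ ζ, {ω | N ζ q ω = N ζ t ω}) ∩
          {ω | ∫⁻ s in Set.Icc (q : ℝ) t, k s.toNNReal ω ≤ ε}))) := by
      ext ω
      simp only [hG, Tame, Set.mem_ofPred_eq, Set.mem_iInter, Set.mem_inter_iff, Set.mem_union]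
    rw [e]
    refine MeasurableSet.biInter hQc fun q hq => MeasurableSet.iInter fun hqt => ?_
    have hdq : ∀ u, Measurable[𝓗 t] (d u q) := fun u =>
      (hdm u q (hQT q hq)).mono (𝓗.mono hqt) le_rfl
    refine (MeasurableSet.iInter fun u => ?_).inter
      ((MeasurableSet.iInter fun u => ?_).union ((MeasurableSet.iInter fun ζ => ?_).inter ?_))
    · exact (measurable_norm.comp (hdq u)) measurableSet_Iic
    · exact (hdq u) (measurableSet_singleton 0)
    · exact measurableSet_eq_fun ((hNm ζ q).mono (𝓗.mono hqt) le_rfl) (hNm ζ t)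
    · exact ((hkm t ht).lintegral q) measurableSet_Iic
  set S : ι → Ω → ℝ≥0∞ := fun u ω =>
    tameSup Q ε (fun u t => d u t ω) (fun ζ t => N ζ t ω) (fun t => k t ω) u with hS
  have hSm : ∀ u, Measurable (S u) := by
    intro u
    refine Measurable.biSup Q hQc fun t ht => ?_
    exact (((hdm u t (hQT t ht)).mono (𝓗.le _) le_rfl).enorm).indicator
      (𝓗.le _ _ (hGm t (hQT t ht)))
  set Sa : Ω → ℝ≥0∞ := fun ω => ∑ u, S u ω with hSa
  have hdp : ∀ u, ∀ t ≤ T, MeasurableUpTo (𝓗 t) t (d u) := fun u t ht =>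
    measurableUpTo_of_rightContinuous
      (fun s hs => (hdm u s (hs.trans ht)).mono (𝓗.mono hs) le_rfl) fun ω s => hd ω u s
  have hito : ∀ u, ∫⁻ ω, ⨆ t ∈ Q, (G t).indicator (fun ω => ‖M u t ω‖ₑ ^ 2) ω ∂P ≤
      8 * (ε * ∫⁻ ω, Sa ω ^ 2 ∂P) := by
    intro u
    refine (lintegral_sup_ito_le hW T (H u) (H' u) (h := fun s ω => r u s ω * d u s ω)
      (fun t ht => (hrm u t ht).mul (hdp u t ht)) (hconv u) hQc hQT ?_ hGm hGa).trans ?_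
    · filter_upwards [hM u] with ω h t ht using h t (hQT t ht)
    · gcongr
      rw [← lintegral_const_mul' _ _ ENNReal.coe_ne_top]
      refine lintegral_mono_ae ?_
      filter_upwards [hleft] with ω hω
      refine le_trans ?_ (timeLIntegral_tame_le (ε := (ε : ℝ≥0∞)) hQ (hN ω) (hd ω) hω
        (k := fun t => k t ω) two_ne_zero)
      refine lintegral_mono fun s => ?_
      beta_reduce
      by_cases hs : ω ∈ G s.toNNReal
      · rw [Set.indicator_of_mem hs, Set.indicator_of_mem (show s.toNNReal ∈ {t | Tame Q ε
          (fun u t => d u t ω) (fun ζ t => N ζ t ω) (fun t => k t ω) t} from hs),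
          enorm_mul, mul_pow]
        gcongr
        · exact hrk u _ ω
        · exact Finset.single_le_sum (f := fun v => ‖d v s.toNNReal ω‖ₑ) (fun _ _ => zero_le)
            (Finset.mem_univ u)
      · rw [Set.indicator_of_notMem hs]
        exact zero_le
  -- Split d = (d - M) + M and use (a + b)² ≤ 2(a² + b²). Up to a tame time the drift part is at
  -- most Cε times the total supremum.
  have hSu : ∀ u, ∀ᵐ ω ∂P, S u ω ^ 2 ≤ 2 * ((C * ε) ^ 2 * Sa ω ^ 2 +
      ⨆ t ∈ Q, (G t).indicator (fun ω => ‖M u t ω‖ₑ ^ 2) ω) := by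
    intro u
    filter_upwards [hdrift, hleft] with ω h1 h2
    set B := ⨆ t ∈ Q, (G t).indicator (fun ω => ‖M u t ω‖ₑ ^ 2) ω with hB
    have hkey : ∀ t ∈ Q, ω ∈ G t → ‖d u t ω‖ₑ ^ 2 ≤ 2 * ((C * ε) ^ 2 * Sa ω ^ 2 + B) := by
      intro t ht hω
      have htame : Tame Q ε (fun u t => d u t ω) (fun ζ t => N ζ t ω) (fun t => k t ω) t := hω
      have h3 := h1 t (hQT t ht) (fun s _ hst => htame.zero_or_const hQ (hN ω) (hd ω)
        (hQT t ht) hst) u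
      have h4 : timeLIntegral (fun s => k s ω * ∑ v, ‖d v s ω‖ₑ) t ≤ ε * Sa ω := by
        have h5 := timeLIntegral_tame_le (ε := (ε : ℝ≥0∞)) hQ (hN ω) (hd ω) h2
          (k := fun t => k t ω) one_ne_zero
        simp only [pow_one] at h5
        refine le_trans ?_ h5
        unfold timeLIntegral
        refine le_trans (setLIntegral_mono' measurableSet_Icc fun s hs => ?_)
          (lintegral_mono_set (Set.Icc_subset_Icc_right (NNReal.coe_le_coe.2 (hQT t ht))))
        beta_reduce
        rw [Set.indicator_of_mem]
        exact htame.anti (hN ω) (Real.toNNReal_le_iff_le_coe.2 hs.2)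
      have h6 : ‖d u t ω‖ₑ ≤ C * ε * Sa ω + ‖M u t ω‖ₑ := by
        calc ‖d u t ω‖ₑ = ‖(d u t ω - M u t ω) + M u t ω‖ₑ := by rw [sub_add_cancel]
          _ ≤ ‖d u t ω - M u t ω‖ₑ + ‖M u t ω‖ₑ := enorm_add_le _ _
          _ ≤ C * (ε * Sa ω) + ‖M u t ω‖ₑ := by gcongr; exact h3.trans (by gcongr)
          _ = _ := by rw [mul_assoc]
      have h7 : ‖M u t ω‖ₑ ^ 2 ≤ B := by
        refine le_trans (le_of_eq ?_) (le_iSup₂ (f := fun t (_ : t ∈ Q) =>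
          (G t).indicator (fun ω => ‖M u t ω‖ₑ ^ 2) ω) t ht)
        rw [Set.indicator_of_mem hω]
      calc ‖d u t ω‖ₑ ^ 2 ≤ (C * ε * Sa ω + ‖M u t ω‖ₑ) ^ 2 := by gcongr
        _ ≤ 2 * ((C * ε * Sa ω) ^ 2 + ‖M u t ω‖ₑ ^ 2) := ennreal_add_sq_le _ _
        _ ≤ _ := by rw [mul_pow (C * ε : ℝ≥0∞)]; gcongr
    -- The bound on the square is taken to its root so that it passes through the supremum.
    have hle : S u ω ≤ (2 * ((C * ε) ^ 2 * Sa ω ^ 2 + B)) ^ ((2 : ℝ)⁻¹) := by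
      refine iSup₂_le fun t ht => ?_
      by_cases hω : ω ∈ G t
      · rw [Set.indicator_of_mem (show t ∈ {t | Tame Q ε (fun u t => d u t ω)
          (fun ζ t => N ζ t ω) (fun t => k t ω) t} from hω), ENNReal.le_rpow_inv_iff two_pos,
          ENNReal.rpow_two]
        exact hkey t ht hω
      · rw [Set.indicator_of_notMem (show t ∉ {t | Tame Q ε (fun u t => d u t ω)
          (fun ζ t => N ζ t ω) (fun t => k t ω) t} from hω)]
        exact zero_le
    rwa [ENNReal.le_rpow_inv_iff two_pos, ENNReal.rpow_two] at hle
  -- Finiteness is what allows absorbing the factor 1/2 below; it is the reason for the bound by 1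
  -- in `Tame`.
  have hfin : ∫⁻ ω, Sa ω ^ 2 ∂P ≠ ∞ := by
    have : ∫⁻ ω, Sa ω ^ 2 ∂P ≤ ∫⁻ ω, (Fintype.card ι : ℝ≥0∞) ^ 2 ∂P := by
      refine lintegral_mono fun ω => ?_
      gcongr
      refine (Finset.sum_le_card_nsmul _ _ 1 fun u _ => tameSup_le_one u).trans ?_
      simp
    refine (this.trans_lt ?_).ne
    simp
  have hcs : ∀ ω, Sa ω ^ 2 ≤ n * ∑ u, S u ω ^ 2 := by
    intro ω
    have h1 : ∀ u, S u ω ≠ ∞ := fun u => ((tameSup_le_one u).trans_lt ENNReal.one_lt_top).ne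
    have h2 : ∀ u, S u ω = ((S u ω).toNNReal : ℝ≥0∞) := fun u => (ENNReal.coe_toNNReal (h1 u)).symm
    have h3 := sq_sum_le_card_mul_sum_sq (s := Finset.univ) (f := fun u => (S u ω).toNNReal)
    have e1 : Sa ω = ((∑ u, (S u ω).toNNReal : ℝ≥0) : ℝ≥0∞) := by
      push_cast
      exact Finset.sum_congr rfl fun u _ => h2 u
    have e2 : ∑ u, S u ω ^ 2 = ((∑ u, (S u ω).toNNReal ^ 2 : ℝ≥0) : ℝ≥0∞) := by
      push_cast
      exact Finset.sum_congr rfl fun u _ => congrArg (· ^ 2) (h2 u)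
    rw [e1, e2]
    rw [Finset.card_univ] at h3
    exact_mod_cast h3
  have hmain : ∫⁻ ω, Sa ω ^ 2 ∂P ≤ 2⁻¹ * ∫⁻ ω, Sa ω ^ 2 ∂P := by
    set V := ∫⁻ ω, Sa ω ^ 2 ∂P with hV
    have h1 : ∀ u, ∫⁻ ω, S u ω ^ 2 ∂P ≤ ((2 * (C * ε) ^ 2 + 16 * ε : ℝ≥0) : ℝ≥0∞) * V := by
      intro u
      have hSam : Measurable fun ω => ((C : ℝ≥0∞) * ε) ^ 2 * Sa ω ^ 2 :=
        ((Finset.measurable_fun_sum _ fun u _ => hSm u).pow_const 2).const_mul _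
      calc ∫⁻ ω, S u ω ^ 2 ∂P ≤ _ := lintegral_mono_ae (hSu u)
        _ = 2 * (((C : ℝ≥0∞) * ε) ^ 2 * V +
            ∫⁻ ω, ⨆ t ∈ Q, (G t).indicator (fun ω => ‖M u t ω‖ₑ ^ 2) ω ∂P) := by
          rw [lintegral_const_mul' _ _ (by simp), lintegral_add_left hSam,
            lintegral_const_mul' _ _ (ENNReal.pow_ne_top (ENNReal.mul_ne_top
              ENNReal.coe_ne_top ENNReal.coe_ne_top))]
        _ ≤ 2 * (((C : ℝ≥0∞) * ε) ^ 2 * V + 8 * (ε * V)) := by gcongr; exact hito u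
        _ = _ := by push_cast; ring
    calc V ≤ ∫⁻ ω, n * ∑ u, S u ω ^ 2 ∂P := lintegral_mono hcs
      _ = n * ∑ u, ∫⁻ ω, S u ω ^ 2 ∂P := by
        rw [lintegral_const_mul' _ _ ENNReal.coe_ne_top,
          lintegral_finsetSum _ fun u _ => (hSm u).pow_const 2]
      _ ≤ n * ∑ u : ι, ((2 * (C * ε) ^ 2 + 16 * ε : ℝ≥0) : ℝ≥0∞) * V := by
        gcongr with u
        exact h1 u
      _ = ((n * (n * (2 * (C * ε) ^ 2 + 16 * ε)) : ℝ≥0) : ℝ≥0∞) * V := by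
        rw [Finset.sum_const, Finset.card_univ, nsmul_eq_mul, hn]
        push_cast
        ring
      _ ≤ ((1 / 2 : ℝ≥0) : ℝ≥0∞) * V := by gcongr
      _ = 2⁻¹ * V := by simp
  have hzero : ∫⁻ ω, Sa ω ^ 2 ∂P = 0 := by
    by_contra hne
    have := ENNReal.half_lt_self hne hfin
    rw [ENNReal.div_eq_inv_mul] at this
    exact absurd hmain (not_le.2 this)
  rw [lintegral_eq_zero_iff ((Finset.measurable_fun_sum _ fun u _ => hSm u).pow_const 2)] at hzero
  filter_upwards [hzero, hk, hleft] with ω h1 h2 h3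
  refine eq_zero_of_tame_eq_zero (d := fun u t => d u t ω) (N := fun ζ t => N ζ t ω)
    (k := fun t => k t ω) (ε := ε) hQ (ENNReal.coe_pos.2 hεpos) (hNc ω) (hd ω) h3 h2 ?_
  intro t ht _ htame u
  have h4 : Sa ω = 0 := pow_eq_zero_iff two_ne_zero |>.1 h1
  have h5 : S u ω = 0 := by
    rw [hSa] at h4
    exact (Finset.sum_eq_zero_iff.1 h4) u (Finset.mem_univ u)
  have h6 : ‖d u t ω‖ₑ ≤ S u ω := by
    refine le_trans (le_of_eq ?_) (le_iSup₂ (f := fun t (_ : t ∈ Q) =>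
      {t | Tame Q ε (fun u t => d u t ω) (fun ζ t => N ζ t ω) (fun t => k t ω) t}.indicator
        (fun t => ‖d u t ω‖ₑ) t) t ht)
    rw [Set.indicator_of_mem (show t ∈ {t | Tame Q ε (fun u t => d u t ω) (fun ζ t => N ζ t ω)
      (fun t => k t ω) t} from htame)]
  rw [h5] at h6
  exact enorm_eq_zero.1 (le_antisymm h6 zero_le)

/-! ### Augmentation, and Itô integrals along paths. -/

/-- A filtration augmented by the null events. -/
def augmentation (P : Measure Ω) (𝓕 : Filtration ℝ≥0 mΩ) : Filtration ℝ≥0 mΩ :=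
  𝓕 ⊔ Filtration.const ℝ≥0 (nullSigma P) (nullSigma_le P)

lemma le_augmentation (P : Measure Ω) (𝓕 : Filtration ℝ≥0 mΩ) (t : ℝ≥0) :
    𝓕 t ≤ augmentation P 𝓕 t := le_sup_left

/-- Permits setting processes to 0 off an event of full probability without losing adaptedness. -/
lemma measurableSet_augmentation {P : Measure Ω} (𝓕 : Filtration ℝ≥0 mΩ) {A : Set Ω}
    (hA : MeasurableSet A) (h0 : P Aᶜ = 0) (t : ℝ≥0) : MeasurableSet[augmentation P 𝓕 t] A := by
  have h1 : nullSigma P ≤ augmentation P 𝓕 t := le_sup_right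
  have h2 : MeasurableSet[nullSigma P] Aᶜ := MeasurableSpace.measurableSet_generateFrom ⟨hA.compl, h0⟩
  exact (h1 _ h2).of_compl

/-- Elementary integrands of the observer thereby become integrands for the filtration in which the
driving process is a Brownian motion. -/
lemma obsFiltration_le_augmentation {P : Measure Ω} {𝓕 : Filtration ℝ≥0 mΩ} {Y : ℝ≥0 → Ω → ℝ}
    (hY : ∀ t, StronglyMeasurable (Y t)) (hYa : ∀ t, Measurable[𝓕 t] (Y t)) :
    obsFiltration P Y hY ≤ augmentation P 𝓕 := by
  refine sup_le_sup_right (fun t => ?_) _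
  refine iSup₂_le fun s hs => ?_
  exact ((hYa s).mono (𝓕.mono hs) le_rfl).comap_le

/-- Every event of the augmented σ-algebra agrees almost surely with an event of the original one,
and independence does not see null events. -/
lemma IsBrownianWrt.augmentation {P : Measure Ω} {𝓕 : Filtration ℝ≥0 mΩ} {W : ℝ≥0 → Ω → ℝ}
    (hW : IsBrownianWrt P 𝓕 W) : IsBrownianWrt P (augmentation P 𝓕) W where
  brownian := hW.brownian
  adapted t := (hW.adapted t).mono (le_augmentation P 𝓕 t) le_rfl
  indep s t hst := by
    have hle : PureJumpFilter.augmentation P 𝓕 s ≤ eventuallyMeasurableSpace (𝓕 s) (ae P) := by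
      refine sup_le (fun A hA => MeasurableSet.eventuallyMeasurableSet hA) ?_
      refine MeasurableSpace.generateFrom_le fun A hA => ?_
      exact ⟨∅, @MeasurableSet.empty _ (𝓕 s), ae_eq_empty.2 hA.2⟩
    have hind := hW.indep s t hst
    rw [Indep_iff] at hind ⊢
    intro A B hA hB
    obtain ⟨B', hB', hBB'⟩ := hle B hB
    rw [measure_congr (EventuallyEq.rfl.inter hBB'), measure_congr hBB']
    exact hind A B' hA hB'

/-- Elementary integrands for a filtration are elementary for a larger one. -/
def SimpleIntegrand.ofLE {𝓖 𝓗 : Filtration ℝ≥0 mΩ} (h : 𝓖 ≤ 𝓗) (H : SimpleIntegrand 𝓖) :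
    SimpleIntegrand 𝓗 where
  n := H.n
  τ := H.τ
  mono := H.mono
  c := H.c
  measurable_c i := (H.measurable_c i).mono (h _) le_rfl
  bounded_c := H.bounded_c

/-- Borel–Cantelli with the thresholds 2⁻ⁿ, along one choice of indices for both sequences. -/
lemma exists_subseq_ae_tendsto_zero {Q : Measure Ω} {x y : ℕ → Ω → ℝ≥0∞}
    (h : ∀ ε : ℝ≥0∞, 0 < ε → Tendsto (fun n => Q {ω | ε ≤ x n ω}) atTop (𝓝 0) ∧
      Tendsto (fun n => Q {ω | ε ≤ y n ω}) atTop (𝓝 0)) :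
    ∃ φ : ℕ → ℕ, ∀ᵐ ω ∂Q, Tendsto (fun n => x (φ n) ω) atTop (𝓝 0) ∧
      Tendsto (fun n => y (φ n) ω) atTop (𝓝 0) := by
  have hpos : ∀ n : ℕ, (0 : ℝ≥0∞) < 2⁻¹ ^ n := fun n => ENNReal.pow_pos (by simp) n
  have hex : ∀ n : ℕ, ∃ m, Q {ω | 2⁻¹ ^ n ≤ x m ω} ≤ 2⁻¹ ^ n ∧ Q {ω | 2⁻¹ ^ n ≤ y m ω} ≤ 2⁻¹ ^ n := by
    intro n
    have h1 := (h _ (hpos n)).1.eventually (gt_mem_nhds (hpos n))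
    have h2 := (h _ (hpos n)).2.eventually (gt_mem_nhds (hpos n))
    obtain ⟨m, hm⟩ := (h1.and h2).exists
    exact ⟨m, hm.1.le, hm.2.le⟩
  choose φ hφ using hex
  refine ⟨φ, ?_⟩
  have key : ∀ z : ℕ → Ω → ℝ≥0∞, (∀ n, Q {ω | 2⁻¹ ^ n ≤ z n ω} ≤ 2⁻¹ ^ n) →
      ∀ᵐ ω ∂Q, Tendsto (fun n => z n ω) atTop (𝓝 0) := by
    intro z hz
    have hs : ∑' n, Q {ω | 2⁻¹ ^ n ≤ z n ω} ≠ ∞ := by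
      refine ne_top_of_le_ne_top ?_ (ENNReal.tsum_le_tsum hz)
      rw [ENNReal.tsum_geometric]
      simp
    filter_upwards [ae_eventually_notMem hs] with ω hω
    have hlim : Tendsto (fun n : ℕ => (2⁻¹ : ℝ≥0∞) ^ n) atTop (𝓝 0) :=
      ENNReal.tendsto_pow_atTop_nhds_zero_of_lt_one (by simp)
    refine tendsto_of_tendsto_of_tendsto_of_le_of_le' tendsto_const_nhds hlim
      (Eventually.of_forall fun n => zero_le) ?_
    filter_upwards [hω] with n hn
    exact (not_le.1 hn).le
  filter_upwards [key _ fun n => (hφ n).1, key _ fun n => (hφ n).2] with ω h1 h2 using ⟨h1, h2⟩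

/-- An Itô integral is an almost sure uniform limit of elementary integrals. -/
lemma IsItoIntegral.exists_ae_tendsto {Q : Measure Ω} {𝓖 : Filtration ℝ≥0 mΩ} {T : ℝ≥0}
    {W H M : ℝ≥0 → Ω → ℝ} (h : IsItoIntegral Q 𝓖 T W H M) :
    ∃ Hn : ℕ → SimpleIntegrand 𝓖, ∀ᵐ ω ∂Q,
      Tendsto (fun n => timeLIntegral (fun s => ‖(Hn n).value s ω - H s ω‖ₑ ^ 2) T) atTop (𝓝 0) ∧
      TendstoUniformlyOn (fun n t => (Hn n).integral W t ω) (fun t => M t ω) atTop (Set.Iic T) := by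
  obtain ⟨Hn, hHn⟩ := h
  obtain ⟨φ, hφ⟩ := exists_subseq_ae_tendsto_zero hHn
  refine ⟨fun n => Hn (φ n), ?_⟩
  filter_upwards [hφ] with ω hω
  refine ⟨hω.1, ?_⟩
  rw [EMetric.tendstoUniformlyOn_iff]
  intro ε hε
  filter_upwards [hω.2.eventually (gt_mem_nhds hε)] with n hn t ht
  rw [edist_comm, edist_eq_enorm_sub]
  exact (le_iSup₂ (f := fun t (_ : t ∈ Set.Iic T) =>
    ‖(Hn (φ n)).integral W t ω - M t ω‖ₑ) t ht).trans_lt hn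

lemma SimpleIntegrand.continuous_integral {𝓖 : Filtration ℝ≥0 mΩ} (H : SimpleIntegrand 𝓖)
    {W : ℝ≥0 → Ω → ℝ} {ω : Ω} {T : ℝ≥0} (hW : ContinuousOn (fun t => W t ω) (Set.Iic T)) :
    ContinuousOn (fun t => H.integral W t ω) (Set.Iic T) := by
  unfold SimpleIntegrand.integral
  refine continuousOn_finsetSum _ fun i _ => continuousOn_const.mul ?_
  have : ∀ a : ℝ≥0, ContinuousOn (fun t => W (min a t) ω) (Set.Iic T) := fun a =>
    hW.comp (continuous_const.min continuous_id).continuousOn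
      fun t ht => (min_le_right a t).trans (Set.mem_Iic.1 ht)
  exact (this _).sub (this _)

lemma continuous_timeIntegral {R : ℝ≥0 → ℝ} {T : ℝ≥0}
    (hR : IntervalIntegrable (fun s : ℝ => R s.toNNReal) volume 0 T) :
    ContinuousOn (timeIntegral R) (Set.Iic T) := by
  have h1 := intervalIntegral.continuousOn_primitive_interval' hR Set.left_mem_uIcc
  rw [Set.uIcc_of_le T.coe_nonneg] at h1
  exact h1.comp (NNReal.continuous_coe.continuousOn) fun t ht => ⟨t.2, NNReal.coe_le_coe.2 ht⟩

/-- Associativity H·(∫ R ds) = ∫ H R ds. It isolates the contribution of the drift when W̃ is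
replaced by the original Brownian motion. -/
lemma SimpleIntegrand.integral_timeIntegral {𝓖 : Filtration ℝ≥0 mΩ} (H : SimpleIntegrand 𝓖)
    {R : ℝ≥0 → ℝ} {T : ℝ≥0} (hR : IntervalIntegrable (fun s : ℝ => R s.toNNReal) volume 0 T)
    {t : ℝ≥0} (ht : t ≤ T) (ω : Ω) :
    IntervalIntegrable (fun s : ℝ => H.value s.toNNReal ω * R s.toNNReal) volume 0 t ∧
    H.integral (fun t _ => timeIntegral R t) t ω = timeIntegral (fun s => H.value s ω * R s) t := by
  have hRt : IntervalIntegrable (fun s : ℝ => R s.toNNReal) volume 0 t := by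
    refine hR.mono_set ?_
    rw [Set.uIcc_of_le t.coe_nonneg, Set.uIcc_of_le T.coe_nonneg]
    exact Set.Icc_subset_Icc_right (NNReal.coe_le_coe.2 ht)
  have hterm : ∀ i, IntervalIntegrable (fun s : ℝ =>
        (Set.Ioc (H.τ i) (H.τ (i + 1))).indicator (fun _ => H.c i ω) s.toNNReal * R s.toNNReal)
        volume 0 t ∧
      H.c i ω * (timeIntegral R (min (H.τ (i + 1)) t) - timeIntegral R (min (H.τ i) t)) =
      ∫ s in (0 : ℝ)..t, (Set.Ioc (H.τ i) (H.τ (i + 1))).indicator (fun _ => H.c i ω) s.toNNReal *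
        R s.toNNReal := by
    intro i
    set a := min (H.τ i) t with ha
    set b := min (H.τ (i + 1)) t with hb
    have hab : (a : ℝ) ≤ b := NNReal.coe_le_coe.2 (min_le_min_right _ (H.mono i.le_succ))
    have hmem : ∀ s ∈ Set.Ioc (0 : ℝ) t,
        s.toNNReal ∈ Set.Ioc (H.τ i) (H.τ (i + 1)) ↔ s ∈ Set.Ioc (a : ℝ) b := by
      intro s hs
      rw [Set.mem_Ioc, Set.mem_Ioc, Real.lt_toNNReal_iff_coe_lt, Real.toNNReal_le_iff_le_coe, ha, hb,
        NNReal.coe_min, NNReal.coe_min, min_lt_iff, le_min_iff]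
      exact ⟨fun h => ⟨Or.inl h.1, h.2, hs.2⟩,
        fun h => ⟨h.1.resolve_right (not_lt.2 hs.2), h.2.1⟩⟩
    have hfun : Set.EqOn (fun s : ℝ =>
        (Set.Ioc (H.τ i) (H.τ (i + 1))).indicator (fun _ => H.c i ω) s.toNNReal * R s.toNNReal)
        ((Set.Ioc (a : ℝ) b).indicator fun s => H.c i ω * R s.toNNReal) (Set.Ioc 0 t) := by
      intro s hs
      by_cases h : s ∈ Set.Ioc (a : ℝ) b
      · simp only [Set.indicator_of_mem h, Set.indicator_of_mem ((hmem s hs).2 h)]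
      · simp only [Set.indicator_of_notMem h, Set.indicator_of_notMem (mt (hmem s hs).1 h),
          zero_mul]
    have hint : IntegrableOn (fun s : ℝ => H.c i ω * R s.toNNReal) (Set.Ioc 0 t) volume :=
      ((intervalIntegrable_iff_integrableOn_Ioc_of_le t.coe_nonneg).1 hRt).const_mul _
    constructor
    · rw [intervalIntegrable_iff_integrableOn_Ioc_of_le t.coe_nonneg]
      exact (hint.indicator measurableSet_Ioc).congr_fun hfun.symm measurableSet_Ioc
    · have hsub : ∀ x : ℝ≥0, x ≤ t → IntervalIntegrable (fun s : ℝ => R s.toNNReal) volume 0 x :=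
        fun x hx => hRt.mono_set (by
          rw [Set.uIcc_of_le t.coe_nonneg, Set.uIcc_of_le x.coe_nonneg]
          exact Set.Icc_subset_Icc_right (NNReal.coe_le_coe.2 hx))
      rw [intervalIntegral.integral_of_le t.coe_nonneg, setIntegral_congr_fun measurableSet_Ioc hfun,
        setIntegral_indicator measurableSet_Ioc, Set.inter_eq_right.2 (Set.Ioc_subset_Ioc
          a.coe_nonneg (NNReal.coe_le_coe.2 (min_le_right _ _))), integral_const_mul]
      unfold timeIntegral
      rw [intervalIntegral.integral_interval_sub_left (hsub b (min_le_right _ _))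
        (hsub a (min_le_right _ _)), intervalIntegral.integral_of_le hab]
  constructor
  · unfold SimpleIntegrand.value
    simp_rw [Finset.sum_mul]
    refine (IntervalIntegrable.sum (Finset.range H.n) fun i _ => (hterm i).1).congr ?_
    exact fun s _ => by simp only [Finset.sum_apply]
  · unfold SimpleIntegrand.integral timeIntegral SimpleIntegrand.value
    simp_rw [Finset.sum_mul]
    rw [intervalIntegral.integral_finsetSum fun i _ => (hterm i).1]
    exact Finset.sum_congr rfl fun i _ => (hterm i).2

lemma intervalIntegrable_of_le {f : ℝ → ℝ} {t T : ℝ≥0} (h : IntervalIntegrable f volume 0 T)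
    (ht : t ≤ T) : IntervalIntegrable f volume 0 t := by
  refine h.mono_set ?_
  rw [Set.uIcc_of_le t.coe_nonneg, Set.uIcc_of_le T.coe_nonneg]
  exact Set.Icc_subset_Icc_right (NNReal.coe_le_coe.2 ht)

lemma enorm_timeIntegral_le (f : ℝ≥0 → ℝ) (t : ℝ≥0) :
    ‖timeIntegral f t‖ₑ ≤ timeLIntegral (fun s => ‖f s‖ₑ) t := by
  unfold timeIntegral timeLIntegral
  rw [intervalIntegral.integral_of_le t.coe_nonneg]
  exact (enorm_integral_le_lintegral_enorm _).trans (lintegral_mono_set Set.Ioc_subset_Icc_self)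

lemma intervalIntegrable_of_timeLIntegral {f : ℝ≥0 → ℝ} {T : ℝ≥0}
    (hm : AEStronglyMeasurable (fun s : ℝ => f s.toNNReal) (volume.restrict (Set.Icc 0 T)))
    (hf : timeLIntegral (fun s => ‖f s‖ₑ) T < ∞) :
    IntervalIntegrable (fun s : ℝ => f s.toNNReal) volume 0 T := by
  rw [intervalIntegrable_iff_integrableOn_Icc_of_le T.coe_nonneg]
  exact ⟨hm, hf⟩

lemma SimpleIntegrand.measurable_value_path {𝓖 : Filtration ℝ≥0 mΩ} (H : SimpleIntegrand 𝓖)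
    (ω : Ω) : Measurable (fun s : ℝ => H.value s.toNNReal ω) := by
  unfold SimpleIntegrand.value
  refine Finset.measurable_fun_sum _ fun i _ => ?_
  exact (measurable_const.indicator measurableSet_Ioc).comp measurable_real_toNNReal

/-- Passing from an Itô integral against `W + ∫ R` to one against `W`, along one path. -/
lemma tendsto_integral_sub_drift {𝓖 : Filtration ℝ≥0 mΩ} {Hn : ℕ → SimpleIntegrand 𝓖}
    {W Wt : ℝ≥0 → Ω → ℝ} {R h : ℝ≥0 → ℝ} {ω : Ω} {T : ℝ≥0}
    (hWt : ∀ t ≤ T, Wt t ω = W t ω + timeIntegral R t)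
    (hR : IntervalIntegrable (fun s : ℝ => R s.toNNReal) volume 0 T)
    (hR2 : timeLIntegral (fun s => ‖R s‖ₑ ^ 2) T < ∞)
    (hhm : AEStronglyMeasurable (fun s : ℝ => h s.toNNReal) (volume.restrict (Set.Icc 0 T)))
    (hhR : IntervalIntegrable (fun s : ℝ => h s.toNNReal * R s.toNNReal) volume 0 T)
    (hconv : Tendsto (fun n => timeLIntegral (fun s => ‖(Hn n).value s ω - h s‖ₑ ^ 2) T) atTop
      (𝓝 0))
    {m : ℝ} {t : ℝ≥0} (ht : t ≤ T)
    (hm : Tendsto (fun n => (Hn n).integral Wt t ω) atTop (𝓝 m)) :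
    Tendsto (fun n => (Hn n).integral W t ω) atTop
      (𝓝 (m - timeIntegral (fun s => h s * R s) t)) := by
  have hRm : AEStronglyMeasurable (fun s : ℝ => R s.toNNReal) (volume.restrict (Set.Icc 0 T)) :=
    ((intervalIntegrable_iff_integrableOn_Icc_of_le T.coe_nonneg).1 hR).1
  have e : ∀ n, (Hn n).integral W t ω = (Hn n).integral Wt t ω -
      timeIntegral (fun s => (Hn n).value s ω * R s) t := by
    intro n
    rw [← ((Hn n).integral_timeIntegral hR ht ω).2]
    unfold SimpleIntegrand.integral
    rw [← Finset.sum_sub_distrib]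
    refine Finset.sum_congr rfl fun i _ => ?_
    rw [hWt _ ((min_le_right _ _).trans ht), hWt _ ((min_le_right _ _).trans ht)]
    ring
  simp_rw [e]
  refine hm.sub ?_
  rw [tendsto_iff_edist_tendsto_0]
  have hvm : ∀ n, AEMeasurable (fun s : ℝ => ‖(Hn n).value s.toNNReal ω - h s.toNNReal‖ₑ)
      (volume.restrict (Set.Icc 0 T)) := by
    intro n
    exact (((Hn n).measurable_value_path ω).aemeasurable.sub hhm.aemeasurable).enorm
  -- Cauchy–Schwarz: convergence of the integrands in L² suffices because `R` is square integrable
  -- along the path.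
  have hbound : ∀ n, edist (timeIntegral (fun s => (Hn n).value s ω * R s) t)
      (timeIntegral (fun s => h s * R s) t) ≤
      (timeLIntegral (fun s => ‖(Hn n).value s ω - h s‖ₑ ^ 2) T) ^ (1 / (2 : ℝ)) *
      (timeLIntegral (fun s => ‖R s‖ₑ ^ 2) T) ^ (1 / (2 : ℝ)) := by
    intro n
    have h1 : timeIntegral (fun s => (Hn n).value s ω * R s) t -
        timeIntegral (fun s => h s * R s) t =
        timeIntegral (fun s => ((Hn n).value s ω - h s) * R s) t := by
      unfold timeIntegral
      rw [← intervalIntegral.integral_sub ((Hn n).integral_timeIntegral hR ht ω).1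
        (intervalIntegrable_of_le hhR ht)]
      simp_rw [sub_mul]
    rw [edist_eq_enorm_sub, h1]
    refine (enorm_timeIntegral_le _ _).trans ?_
    refine (lintegral_mono_set (Set.Icc_subset_Icc_right (NNReal.coe_le_coe.2 ht))).trans ?_
    have h2 := ENNReal.lintegral_mul_le_Lp_mul_Lq (volume.restrict (Set.Icc (0 : ℝ) T))
      Real.HolderConjugate.two_two (hvm n) hRm.enorm
    simp only [Pi.mul_apply, ENNReal.rpow_two] at h2
    simp_rw [enorm_mul]
    exact h2
  refine tendsto_of_tendsto_of_tendsto_of_le_of_le tendsto_const_nhds ?_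
    (fun n => zero_le) hbound
  have h3 := (ENNReal.continuous_rpow_const (y := 1 / (2 : ℝ))).tendsto 0 |>.comp hconv
  rw [ENNReal.zero_rpow_of_pos (by norm_num)] at h3
  have h4 := ENNReal.Tendsto.mul_const (b := (timeLIntegral (fun s => ‖R s‖ₑ ^ 2) T) ^ (1 / (2 : ℝ)))
    h3 (Or.inr (ENNReal.rpow_ne_top_of_nonneg (by norm_num) hR2.ne))
  rwa [zero_mul] at h4

/-! ### The Zakai coefficients in terms of the masses at the states. -/

namespace Model

variable (𝓜 : Model)

/-- The part of the Zakai drift of a time-independent test function that does not involve the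
reference kernel, as a function of the state. -/
def driftCoeff (φ : ℝ → ℝ) (t : ℝ≥0) (x : 𝓜.S) (y : ℝ) : ℝ :=
  (∑ ζ, 𝓜.nu.real {ζ} * if 𝓜.K1 t x y ζ = 0 then φ (x + 𝓜.K0 x ζ) - φ x else 0) -
    (∑ ζ, 𝓜.nu.real {ζ} * if 𝓜.K1 t x y ζ = 0 then 0 else 1) * φ x

lemma measurable_driftCoeff (φ : ℝ → ℝ) (x : 𝓜.S) :
    Measurable (fun p : ℝ≥0 × ℝ => 𝓜.driftCoeff φ p.1 x p.2) := by
  have h : ∀ ζ, MeasurableSet {p : ℝ≥0 × ℝ | 𝓜.K1 p.1 x p.2 ζ = 0} := fun ζ =>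
    𝓜.measurable_K1 x ζ (measurableSet_singleton 0)
  unfold driftCoeff
  refine (Finset.measurable_fun_sum _ fun ζ _ => ?_).sub
    ((Finset.measurable_fun_sum _ fun ζ _ => ?_).mul_const _)
  · exact (Measurable.ite (h ζ) measurable_const measurable_const).const_mul _
  · exact (Measurable.ite (h ζ) measurable_const measurable_const).const_mul _

lemma abs_driftCoeff_le {φ : ℝ → ℝ} {C : ℝ} (hφ : ∀ x, |φ x| ≤ C) (t : ℝ≥0) (x : 𝓜.S) (y : ℝ) :
    |𝓜.driftCoeff φ t x y| ≤ 3 * C * ∑ ζ, 𝓜.nu.real {ζ} := by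
  have hC : 0 ≤ C := (abs_nonneg _).trans (hφ 0)
  have h1 : |∑ ζ, 𝓜.nu.real {ζ} * if 𝓜.K1 t x y ζ = 0 then φ (x + 𝓜.K0 x ζ) - φ x else 0| ≤
      ∑ ζ, 𝓜.nu.real {ζ} * (2 * C) := by
    refine (Finset.abs_sum_le_sum_abs _ _).trans (Finset.sum_le_sum fun ζ _ => ?_)
    rw [abs_mul, abs_of_nonneg measureReal_nonneg]
    gcongr
    split_ifs
    · refine (abs_sub _ _).trans ?_
      linarith [hφ (x + 𝓜.K0 x ζ), hφ x]
    · simpa using hC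
  have h2 : |(∑ ζ, 𝓜.nu.real {ζ} * if 𝓜.K1 t x y ζ = 0 then (0 : ℝ) else 1) * φ x| ≤
      (∑ ζ, 𝓜.nu.real {ζ} * 1) * C := by
    rw [abs_mul]
    gcongr
    · refine (Finset.abs_sum_le_sum_abs _ _).trans (Finset.sum_le_sum fun ζ _ => ?_)
      rw [abs_mul, abs_of_nonneg measureReal_nonneg]
      gcongr
      split_ifs <;> simp
    · exact hφ x
  refine (abs_sub _ _).trans ((add_le_add h1 h2).trans (le_of_eq ?_))
  rw [← Finset.sum_mul, ← Finset.sum_mul]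
  ring

/-- The time derivative vanishes for a time-independent test function, and the integrals over `S`
and over the marks are finite sums. This displays the drift as linear in the masses. -/
lemma zakaiDrift_eq (Y : ℝ≥0 → Ω → ℝ) (η : Kernel (ℝ≥0 × ℝ) ℝ) (φ : ℝ → ℝ)
    (ξ : ℝ≥0 → Ω → FiniteMeasure 𝓜.S) (t : ℝ≥0) (ω : Ω) :
    𝓜.zakaiDrift Y η (fun _ => φ) ξ t ω = ∑ x : 𝓜.S, (ξ t ω : Measure 𝓜.S).real {x} *
      (𝓜.driftCoeff φ t x (Y t ω) +
        (η (t, Function.leftLim (fun r => Y r ω) t)).real Set.univ * φ x) := by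
  have hL0 : ∀ x : 𝓜.S, 𝓜.L0 (fun _ => φ) t x (Y t ω) =
      ∑ ζ, 𝓜.nu.real {ζ} * if 𝓜.K1 t x (Y t ω) ζ = 0 then φ (x + 𝓜.K0 x ζ) - φ x else 0 := by
    intro x
    unfold L0
    rw [deriv_const, zero_add, ← integral_indicator (Set.toFinite _).measurableSet,
      integral_fintype Integrable.of_finite]
    refine Finset.sum_congr rfl fun ζ _ => ?_
    simp [Set.indicator_apply]
  have hlam : ∀ x : 𝓜.S, (𝓜.lam t x (Y t ω)).toReal =
      ∑ ζ, 𝓜.nu.real {ζ} * if 𝓜.K1 t x (Y t ω) ζ = 0 then 0 else 1 := by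
    intro x
    have h1 : (𝓜.lam t x (Y t ω)).toReal =
        ∫ ζ, (𝓜.d1 t x (Y t ω)).indicator (fun _ => (1 : ℝ)) ζ ∂𝓜.nu := by
      rw [integral_indicator (Set.toFinite _).measurableSet]
      simp [lam, measureReal_def]
    rw [h1, integral_fintype Integrable.of_finite]
    refine Finset.sum_congr rfl fun ζ _ => ?_
    simp only [Set.indicator_apply, d1, Set.mem_ofPred_eq, smul_eq_mul, ite_not]
  unfold zakaiDrift pairing
  rw [integral_fintype Integrable.of_finite, integral_fintype Integrable.of_finite,
    integral_fintype Integrable.of_finite, Finset.mul_sum, ← Finset.sum_sub_distrib,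
    ← Finset.sum_add_distrib]
  refine Finset.sum_congr rfl fun x _ => ?_
  rw [hL0, hlam, driftCoeff]
  simp only [smul_eq_mul]
  ring

lemma pairing_eq {φ : ℝ → ℝ} {u : 𝓜.S} (hφ : ∀ x : 𝓜.S, φ x = if x = u then 1 else 0)
    (ρ : FiniteMeasure 𝓜.S) (t : ℝ≥0) :
    𝓜.pairing ρ (fun _ => φ) t = (ρ : Measure 𝓜.S).real {u} := by
  unfold pairing
  rw [integral_fintype Integrable.of_finite]
  simp [hφ]

lemma zakaiDiffusion_eq {φ : ℝ → ℝ} {u : 𝓜.S} (hφ : ∀ x : 𝓜.S, φ x = if x = u then 1 else 0)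
    (Y : ℝ≥0 → Ω → ℝ) (ξ : ℝ≥0 → Ω → FiniteMeasure 𝓜.S) (t : ℝ≥0) (ω : Ω) :
    𝓜.zakaiDiffusion Y (fun _ => φ) ξ t ω =
      𝓜.ratio t u (Y t ω) * (ξ t ω : Measure 𝓜.S).real {u} := by
  unfold zakaiDiffusion ratio
  rw [integral_fintype Integrable.of_finite]
  simp only [hφ, smul_eq_mul, mul_ite, mul_one, mul_zero, Finset.sum_ite_eq', Finset.mem_univ,
    if_true]
  ring

/-- A bounded smooth function on `ℝ` that is `1` at `u` and `0` at the other points of `S`. -/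
lemma exists_testFunction (u : 𝓜.S) : ∃ φ : ℝ → ℝ, IsTestFunction (fun _ => φ) ∧
    ∀ x : 𝓜.S, φ x = if x = u then 1 else 0 := by
  classical
  have hnhds : ∀ᶠ y : ℝ in 𝓝 (u : ℝ), ∀ x : 𝓜.S, x ≠ u → y ≠ (x : ℝ) := by
    refine eventually_all.2 fun x => ?_
    by_cases hx : x = u
    · simp [hx]
    · have hne : (u : ℝ) ≠ x := fun h => hx (Subtype.ext h.symm)
      filter_upwards [isOpen_ne.mem_nhds hne] with y hy _ using hy
  obtain ⟨ε, hε, hball⟩ := Metric.eventually_nhds_iff_ball.1 hnhds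
  let φ : ContDiffBump (u : ℝ) := ⟨ε / 2, ε, by positivity, by linarith⟩
  have h0 : ContDiff ℝ (⊤ : ℕ∞) φ := φ.contDiff
  have h1 : ContDiff ℝ (⊤ : ℕ∞) (deriv φ) := (contDiff_infty_iff_deriv.1 h0).2
  have h2 : ContDiff ℝ (⊤ : ℕ∞) (deriv (deriv φ)) := (contDiff_infty_iff_deriv.1 h1).2
  obtain ⟨C₀, hC₀⟩ := φ.hasCompactSupport.exists_bound_of_continuous h0.continuous
  obtain ⟨C₁, hC₁⟩ := φ.hasCompactSupport.deriv.exists_bound_of_continuous h1.continuous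
  obtain ⟨C₂, hC₂⟩ := φ.hasCompactSupport.deriv.deriv.exists_bound_of_continuous h2.continuous
  have p0 : 0 ≤ C₀ := (norm_nonneg _).trans (hC₀ 0)
  have p1 : 0 ≤ C₁ := (norm_nonneg _).trans (hC₁ 0)
  have p2 : 0 ≤ C₂ := (norm_nonneg _).trans (hC₂ 0)
  refine ⟨φ, ⟨fun x => differentiable_const _, fun t => h0.differentiable (by simp),
    fun t => h1.differentiable (by simp), h0.continuous.comp continuous_snd, ?_,
    h1.continuous.comp continuous_snd, h2.continuous.comp continuous_snd,
    C₀ + C₁ + C₂, fun t x => ⟨?_, ?_, ?_, ?_⟩⟩, fun x => ?_⟩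
  · simpa using continuous_const
  · exact (hC₀ x).trans (by linarith)
  · simp only [deriv_const, abs_zero]; positivity
  · exact (hC₁ x).trans (by linarith)
  · exact (hC₂ x).trans (by linarith)
  · split_ifs with hx
    · rw [hx]
      exact φ.one_of_mem_closedBall (Metric.mem_closedBall_self (by positivity))
    · refine φ.zero_of_le_dist ?_
      by_contra! h
      exact hball x (Metric.mem_ball.2 h) x hx rfl

end Model

/-! ### Jumps of the observation, and positivity of the density. -/

lemma jump_eq_zero_of_eqOn_Icc {n : ℝ≥0 → ℝ} {q s : ℝ≥0} (hqs : q < s)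
    (h : ∀ r ∈ Set.Icc q s, n r = n s) : jump n s = 0 := by
  have : (𝓝[<] s).NeBot := nhdsLT_neBot_of_exists_lt ⟨q, hqs⟩
  have h1 : Tendsto n (𝓝[<] s) (𝓝 (n s)) := by
    refine tendsto_const_nhds.congr' ?_
    filter_upwards [Ico_mem_nhdsLT hqs] with r hr
    exact (h r ⟨hr.1, hr.2.le⟩).symm
  rw [jump, leftLim_eq_of_tendsto h1, sub_self]

/-- `Function.leftLim` defaults to the value at `s` if there is no left neighbourhood or no left
limit. Positivity of `s` and existence of the limit exclude these cases, so that only the past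
matters. -/
lemma leftLim_congr_of_eqOn_Iio {E : Type*} [TopologicalSpace E] [T2Space E] {f g : ℝ≥0 → E}
    {s : ℝ≥0} (hs : 0 < s) (hfg : ∀ r < s, f r = g r) (hf : ∃ l, Tendsto f (𝓝[<] s) (𝓝 l)) :
    Function.leftLim f s = Function.leftLim g s := by
  have : (𝓝[<] s).NeBot := nhdsLT_neBot_of_exists_lt ⟨0, hs⟩
  obtain ⟨l, hl⟩ := hf
  have hl' : Tendsto g (𝓝[<] s) (𝓝 l) := hl.congr' (by
    filter_upwards [self_mem_nhdsWithin] with r hr using hfg r hr)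
  rw [leftLim_eq_of_tendsto hl, leftLim_eq_of_tendsto hl']

namespace Model

variable (𝓜 : Model)

/-- The observation jumps only at the jump times of the driving Poisson processes. -/
lemma ae_jump_eq_zero {P : Measure Ω} {𝓕 : Filtration ℝ≥0 mΩ} {T : ℝ≥0} {W : ℝ≥0 → Ω → ℝ}
    (hW : IsBrownianWrt P 𝓕 W) {N : 𝓜.S × 𝓜.S → ℝ≥0 → Ω → ℕ}
    (hN : IsPoissonFamily P 𝓕 N 𝓜.rate) {X : ℝ≥0 → Ω → 𝓜.S} {Y : ℝ≥0 → Ω → ℝ}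
    (hXY : 𝓜.IsSolution P 𝓕 T W N X Y)
    (hb : ∀ᵐ ω ∂P, IntervalIntegrable
      (fun s : ℝ => 𝓜.b1 s.toNNReal (X s.toNNReal ω) (Y s.toNNReal ω)) volume 0 T) :
    ∀ᵐ ω ∂P, ∀ s ≤ T, (∃ q < s, ∀ ζ, N ζ q ω = N ζ s ω) → jump (fun r => Y r ω) s = 0 := by
  obtain ⟨M, hM, hY⟩ := hXY.equation_Y
  obtain ⟨Hn, hHn⟩ := hM.exists_ae_tendsto
  have hNp : ∀ᵐ ω ∂P, ∀ ζ, Monotone (fun t => N ζ t ω) :=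
    ae_all_iff.2 fun ζ => (hN.paths ζ).mono fun ω h => h.2.1
  filter_upwards [hY, hHn, hNp, hb, hW.brownian.cont] with ω hY hHn hNp hb hWc s hsT ⟨q, hqs, hq⟩
  -- Uniform limits of elementary integrals against continuous paths are continuous, so the Itô part
  -- of `Y` does not jump.
  have hMc : ContinuousOn (fun t => M t ω) (Set.Iic T) :=
    hHn.2.continuousOn (Frequently.of_forall fun n => (Hn n).continuous_integral hWc.continuousOn)
  have hconst : ∀ ζ, ∀ r ∈ Set.Icc q s, N ζ r ω = N ζ s ω := fun ζ r hr =>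
    le_antisymm (hNp ζ hr.2) ((hq ζ).ge.trans (hNp ζ hr.1))
  have hjump : ∀ ζ, ∀ r ∈ Set.Ioc q s, jump (fun r => (N ζ r ω : ℝ)) r = 0 := by
    intro ζ r hr
    refine jump_eq_zero_of_eqOn_Icc hr.1 fun r' hr' => ?_
    rw [hconst ζ r' ⟨hr'.1, hr'.2.trans hr.2⟩, hconst ζ r ⟨hr.1.le, hr.2⟩]
  -- Both index sets meet the support of the summand in the same points, so the finite sums agree
  -- without a separate finiteness argument.
  have hsum : ∀ t ∈ Set.Icc q s, ∀ (g : 𝓜.S × 𝓜.S → ℝ≥0 → ℝ),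
      ∑ ζ, ∑ᶠ r ∈ Set.Ioc 0 t, g ζ r * jump (fun r => (N ζ r ω : ℝ)) r =
      ∑ ζ, ∑ᶠ r ∈ Set.Ioc 0 s, g ζ r * jump (fun r => (N ζ r ω : ℝ)) r := by
    intro t ht g
    refine Finset.sum_congr rfl fun ζ _ => ?_
    refine finsum_mem_inter_support_eq _ _ _ ?_
    ext r
    simp only [Set.mem_inter_iff, Set.mem_Ioc, Function.mem_support]
    refine ⟨fun h => ⟨⟨h.1.1, h.1.2.trans ht.2⟩, h.2⟩, fun h => ⟨⟨h.1.1, ?_⟩, h.2⟩⟩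
    by_contra! hlt
    exact h.2 (by rw [hjump ζ r ⟨ht.1.trans_lt hlt, h.1.2⟩, mul_zero])
  have hc : ContinuousOn (fun t => timeIntegral (fun s => 𝓜.b1 s (X s ω) (Y s ω)) t + M t ω)
      (Set.Iic T) := (continuous_timeIntegral hb).add hMc
  have hne : (𝓝[<] s).NeBot := nhdsLT_neBot_of_exists_lt ⟨q, hqs⟩
  have hlim : Tendsto (fun r => Y r ω) (𝓝[<] s) (𝓝 (Y s ω)) := by
    have h1 : Tendsto (fun t => timeIntegral (fun s => 𝓜.b1 s (X s ω) (Y s ω)) t + M t ω) (𝓝[<] s)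
        (𝓝 (timeIntegral (fun s => 𝓜.b1 s (X s ω) (Y s ω)) s + M s ω)) :=
      ((hc s hsT).mono (fun r (hr : r < s) => hr.le.trans hsT)).tendsto
    have h2 := (h1.const_add 𝓜.y0).add_const (∑ ζ, ∑ᶠ r ∈ Set.Ioc 0 s,
        𝓜.K1 r (Function.leftLim (fun r => X r ω) r) (Function.leftLim (fun r => Y r ω) r) ζ *
          jump (fun r => (N ζ r ω : ℝ)) r)
    rw [hY s hsT, add_assoc 𝓜.y0 (timeIntegral _ _) (M s ω)]
    refine h2.congr' ?_
    filter_upwards [Ico_mem_nhdsLT hqs] with r hr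
    rw [hY r (hr.2.le.trans hsT), add_assoc 𝓜.y0 (timeIntegral _ _) (M r ω),
      ← hsum r ⟨hr.1, hr.2.le⟩]
  rw [jump, leftLim_eq_of_tendsto hlim, sub_self]

/-- The jump coefficient depends on the solution only through its past. -/
lemma zakaiJump_congr {ξ ξ' : ℝ≥0 → Ω → FiniteMeasure 𝓜.S} (Y : ℝ≥0 → Ω → ℝ)
    (η : Kernel (ℝ≥0 × ℝ) ℝ) (f : ℝ → ℝ → ℝ) {s : ℝ≥0} (hs : 0 < s) {ω : Ω}
    (h : ∀ r < s, ξ r ω = ξ' r ω) (hc : IsCadlag (fun t => ξ t ω)) (z : ℝ) :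
    𝓜.zakaiJump Y η f ξ s ω z = 𝓜.zakaiJump Y η f ξ' s ω z := by
  unfold zakaiJump
  rw [leftLim_congr_of_eqOn_Iio hs h (hc s).2]

/-- Monotone counting paths have countably many discontinuities. Elsewhere they are constant just
before `s`, because their values are integers, and `Y` does not jump there. Hence Y_{s-} and Y_s are
interchangeable in ds-integrals. -/
lemma ae_countable_jump {P : Measure Ω} {𝓕 : Filtration ℝ≥0 mΩ}
    {N : 𝓜.S × 𝓜.S → ℝ≥0 → Ω → ℕ}
    (hN : IsPoissonFamily P 𝓕 N 𝓜.rate) {T : ℝ≥0} {Y : ℝ≥0 → Ω → ℝ}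
    (hjump : ∀ᵐ ω ∂P, ∀ s ≤ T, (∃ q < s, ∀ ζ, N ζ q ω = N ζ s ω) → jump (fun r => Y r ω) s = 0) :
    ∀ᵐ ω ∂P, ∀ᵐ s ∂(volume.restrict (Set.Icc (0 : ℝ) T)),
      Function.leftLim (fun r => Y r ω) s.toNNReal = Y s.toNNReal ω := by
  have hNp : ∀ᵐ ω ∂P, ∀ ζ, Monotone (fun t => N ζ t ω) :=
    ae_all_iff.2 fun ζ => (hN.paths ζ).mono fun ω h => h.2.1
  filter_upwards [hjump, hNp] with ω h1 h2
  set D : Set ℝ≥0 := ⋃ ζ, {t | ¬ ContinuousAt (fun t => N ζ t ω) t} with hD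
  have hDc : D.Countable := Set.countable_iUnion fun ζ => (h2 ζ).countable_not_continuousAt
  have hDc' : (((↑) : ℝ≥0 → ℝ) '' D ∪ {0}).Countable := (hDc.image _).union (Set.countable_singleton 0)
  filter_upwards [ae_restrict_of_ae (hDc'.ae_notMem volume), ae_restrict_mem measurableSet_Icc]
    with s hs hsI
  have hs0 : 0 < s := lt_of_le_of_ne hsI.1 fun h => hs (Or.inr h.symm)
  have hsD : s.toNNReal ∉ D := fun h => hs (Or.inl ⟨_, h, Real.coe_toNNReal s hsI.1⟩)
  have hpos : 0 < s.toNNReal := Real.toNNReal_pos.2 hs0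
  have hne : (𝓝[<] s.toNNReal).NeBot := nhdsLT_neBot_of_exists_lt ⟨0, hpos⟩
  have h3 : ∀ᶠ q in 𝓝[<] s.toNNReal, ∀ ζ, N ζ q ω = N ζ s.toNNReal ω := by
    refine eventually_all.2 fun ζ => ?_
    have hc : ContinuousAt (fun t => N ζ t ω) s.toNNReal := by
      by_contra h
      exact hsD (Set.mem_iUnion.2 ⟨ζ, h⟩)
    have h4 : Tendsto (fun t => N ζ t ω) (𝓝 s.toNNReal) (𝓝 (N ζ s.toNNReal ω)) := hc
    rw [nhds_discrete ℕ, tendsto_pure] at h4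
    exact h4.filter_mono nhdsWithin_le_nhds
  obtain ⟨q, hq, hqs⟩ := (h3.and self_mem_nhdsWithin).exists
  have h5 := h1 s.toNNReal (Real.toNNReal_le_iff_le_coe.2 hsI.2) ⟨q, hqs, hq⟩
  rw [jump, sub_eq_zero] at h5
  exact h5.symm

/-- The density of the reference probability is positive. -/
lemma absolutelyContinuous_referenceMeasure {P : Measure Ω} {𝓨 : Filtration ℝ≥0 mΩ} {T : ℝ≥0}
    {Y : ℝ≥0 → Ω → ℝ} {π : ℝ≥0 → Ω → ProbabilityMeasure 𝓜.S} {η : Kernel (ℝ≥0 × ℝ) ℝ}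
    {Ψ : ℝ≥0 → Ω → ℝ → ℝ} (hη : 𝓜.IsReference P 𝓨 T Y π η Ψ) {J : ℝ≥0 → Ω → ℝ}
    (hZ : AEMeasurable (𝓜.girsanovDensity Y π Ψ J T) P) :
    P ≪ 𝓜.referenceMeasure P T Y π Ψ J := by
  refine withDensity_absolutelyContinuous' hZ.ennreal_ofReal ?_
  filter_upwards [hη.pos] with ω hω
  have : 0 < 𝓜.girsanovDensity Y π Ψ J T ω := by
    unfold girsanovDensity
    refine mul_pos (Real.exp_pos _) (mul_pos (Real.exp_pos _) ?_)
    -- The product over a set is a nested `finprod`: the outer one runs over all times, the inner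
    -- one over proofs of membership. Each factor is 1/(1 + Ψ) > 0.
    refine finprod_induction (0 < ·) one_pos (fun _ _ => mul_pos) fun s => ?_
    refine finprod_induction (0 < ·) one_pos (fun _ _ => mul_pos) fun hs => ?_
    have := hω s hs.1.2 (jump (fun r => Y r ω) s)
    rw [add_sub_cancel]
    positivity
  simpa using this

end Model

/-! ### Càdlàg paths and the clock. -/

lemma measurable_of_rightContinuous {E : Type*} [TopologicalSpace E]
    [TopologicalSpace.PseudoMetrizableSpace E] [MeasurableSpace E] [BorelSpace E] {x : ℝ≥0 → E}
    (hx : ∀ s, ContinuousWithinAt x (Set.Ici s) s) : Measurable x := by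
  refine measurable_of_tendsto_metrizable (f := fun (n : ℕ) s => x (min s n)) (fun n => ?_) ?_
  · have h := measurableUpTo_of_rightContinuous (m := (⊤ : MeasurableSpace Unit)) (t := n)
      (x := fun s _ => x s) (fun s _ => measurable_const) (fun _ s => hx s)
    exact h.comp (measurable_id.prodMk (measurable_const (a := ())))
  · rw [tendsto_pi_nhds]
    intro s
    obtain ⟨n, hn⟩ := exists_nat_ge s
    refine tendsto_const_nhds.congr' ?_
    filter_upwards [eventually_ge_atTop n] with m hm
    rw [min_eq_left (hn.trans (by exact_mod_cast hm))]

/-- The one-sided limits bound the path near each time, and compactness of [0, T] makes the bound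
global. -/
lemma IsCadlag.exists_bound {x : ℝ≥0 → ℝ} (hx : IsCadlag x) (T : ℝ≥0) :
    ∃ C : ℝ≥0, ∀ s ≤ T, |x s| ≤ C := by
  have h : ∃ C : ℝ≥0, ∀ s ∈ Set.Icc 0 T, |x s| ≤ C := by
    refine isCompact_Icc.induction_on (p := fun A => ∃ C : ℝ≥0, ∀ s ∈ A, |x s| ≤ C)
      ⟨0, by simp⟩ (fun A B hAB ⟨C, hC⟩ => ⟨C, fun s hs => hC s (hAB hs)⟩)
      (fun A B ⟨C, hC⟩ ⟨D, hD⟩ => ⟨max C D, ?_⟩) fun t _ => ?_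
    · rintro s (hs | hs)
      · exact (hC s hs).trans (by exact_mod_cast le_max_left C D)
      · exact (hD s hs).trans (by exact_mod_cast le_max_right C D)
    · obtain ⟨hr, l, hl⟩ := hx t
      have h1 : ∀ᶠ s in 𝓝[≥] t, |x s| < |x t| + 1 :=
        (hr.abs : Tendsto _ _ _).eventually (gt_mem_nhds (lt_add_one _))
      have h2 : ∀ᶠ s in 𝓝[<] t, |x s| < |l| + 1 :=
        hl.abs.eventually (gt_mem_nhds (lt_add_one _))
      set C : ℝ≥0 := ⟨|x t| + 1 + (|l| + 1), by positivity⟩ with hC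
      have hCv : (C : ℝ) = |x t| + 1 + (|l| + 1) := rfl
      refine ⟨{s | |x s| ≤ C}, mem_nhdsWithin_of_mem_nhds ?_, C, fun s hs => hs⟩
      rw [← nhdsLT_sup_nhdsGE]
      refine mem_sup.2 ⟨?_, ?_⟩
      · filter_upwards [h2] with s hs
        rw [hCv]
        linarith [abs_nonneg (x t)]
      · filter_upwards [h1] with s hs
        rw [hCv]
        linarith [abs_nonneg l]
  obtain ⟨C, hC⟩ := h
  exact ⟨C, fun s hs => hC s ⟨zero_le, hs⟩⟩

/-- On a finite discrete space the indicator of a point is a bounded continuous function, hence a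
test function for weak convergence. -/
lemma continuous_finiteMeasure_singleton {α : Type*} [Finite α] [TopologicalSpace α]
    [DiscreteTopology α] [MeasurableSpace α] [OpensMeasurableSpace α] (x : α) :
    Continuous (fun μ : FiniteMeasure α => (μ : Measure α).real {x}) := by
  classical
  rw [continuous_iff_continuousAt]
  intro μ
  have h := FiniteMeasure.tendsto_iff_forall_integral_tendsto.1 (tendsto_id (x := 𝓝 μ))
    (BoundedContinuousFunction.mkOfCompact
      ⟨Set.indicator {x} (fun _ => (1 : ℝ)), continuous_of_discreteTopology⟩)
  have e : ∀ μ : FiniteMeasure α, ∫ y, (BoundedContinuousFunction.mkOfCompact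
      ⟨Set.indicator {x} (fun _ => (1 : ℝ)), continuous_of_discreteTopology⟩ : α → ℝ) y ∂(μ : Measure α) =
      (μ : Measure α).real {x} := by
    intro μ
    simp only [BoundedContinuousFunction.mkOfCompact_apply, ContinuousMap.coe_mk]
    rw [integral_indicator (isOpen_discrete _).measurableSet, setIntegral_const, smul_eq_mul, mul_one]
  simp only [id] at h
  simp_rw [e] at h
  exact h

lemma IsCadlag.comp {E F : Type*} [TopologicalSpace E] [TopologicalSpace F] {x : ℝ≥0 → E}
    (hx : IsCadlag x) {g : E → F} (hg : Continuous g) : IsCadlag (fun t => g (x t)) := fun t =>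
  ⟨hg.continuousAt.comp_continuousWithinAt (hx t).1,
    (hx t).2.imp' g fun l hl => (hg.tendsto l).comp hl⟩

namespace Model

variable (𝓜 : Model)

/-- A clock that dominates all coefficients of the Zakai equation. -/
def clock (η : Kernel (ℝ≥0 × ℝ) ℝ) (s : ℝ≥0) (y : ℝ) : ℝ≥0∞ :=
  1 + η (s, y) Set.univ + ∑ u, ‖𝓜.ratio s u y‖ₑ ^ 2

lemma measurable_ratio (u : 𝓜.S) : Measurable (fun p : ℝ≥0 × ℝ => 𝓜.ratio p.1 u p.2) :=
  (𝓜.measurable_b1 u).div 𝓜.measurable_sigma1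

lemma measurable_clock (η : Kernel (ℝ≥0 × ℝ) ℝ) :
    Measurable (fun p : ℝ≥0 × ℝ => 𝓜.clock η p.1 p.2) :=
  ((measurable_const.add (η.measurable_coe MeasurableSet.univ))).add
    (Finset.measurable_fun_sum _ fun u _ => (𝓜.measurable_ratio u).enorm.pow_const 2)

lemma enorm_ratio_sq_le_clock (η : Kernel (ℝ≥0 × ℝ) ℝ) (s : ℝ≥0) (u : 𝓜.S) (y : ℝ) :
    ‖𝓜.ratio s u y‖ₑ ^ 2 ≤ 𝓜.clock η s y :=
  (Finset.single_le_sum (f := fun u => ‖𝓜.ratio s u y‖ₑ ^ 2) (fun _ _ => zero_le)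
    (Finset.mem_univ u)).trans le_add_self

lemma one_le_clock (η : Kernel (ℝ≥0 × ℝ) ℝ) (s : ℝ≥0) (y : ℝ) : 1 ≤ 𝓜.clock η s y :=
  le_self_add.trans le_self_add

lemma enorm_ratio_le_clock (η : Kernel (ℝ≥0 × ℝ) ℝ) (s : ℝ≥0) (u : 𝓜.S) (y : ℝ) :
    ‖𝓜.ratio s u y‖ₑ ≤ 𝓜.clock η s y := by
  rcases le_total ‖𝓜.ratio s u y‖ₑ 1 with h | h
  · exact h.trans (𝓜.one_le_clock η s y)
  · exact (le_self_pow₀ h two_ne_zero).trans (𝓜.enorm_ratio_sq_le_clock η s u y)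

lemma enorm_ratio_mul_ratio_le_clock (η : Kernel (ℝ≥0 × ℝ) ℝ) (s : ℝ≥0) (u v : 𝓜.S) (y : ℝ) :
    ‖𝓜.ratio s u y‖ₑ * ‖𝓜.ratio s v y‖ₑ ≤ 𝓜.clock η s y := by
  rcases le_total ‖𝓜.ratio s u y‖ₑ ‖𝓜.ratio s v y‖ₑ with h | h
  · refine le_trans ?_ (𝓜.enorm_ratio_sq_le_clock η s v y)
    rw [sq]; gcongr
  · refine le_trans ?_ (𝓜.enorm_ratio_sq_le_clock η s u y)
    rw [sq]; gcongr

/-- The drift of the mass `w u` in the linear system satisfied by the masses `w` of a solution of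
the Zakai equation, written with respect to the original Brownian motion: `x` is the state of the
signal and `yl` the left limit of the observation. -/
def linearDrift (η : Kernel (ℝ≥0 × ℝ) ℝ) (φ : ℝ → ℝ) (u : 𝓜.S) (s : ℝ≥0) (x : 𝓜.S) (y yl : ℝ)
    (w : 𝓜.S → ℝ) : ℝ :=
  (∑ v, w v * (𝓜.driftCoeff φ s v y + (η (s, yl)).real Set.univ * φ v)) +
    𝓜.ratio s u y * w u * 𝓜.ratio s x y

lemma linearDrift_sub (η : Kernel (ℝ≥0 × ℝ) ℝ) (φ : ℝ → ℝ) (u : 𝓜.S) (s : ℝ≥0) (x : 𝓜.S)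
    (y yl : ℝ) (w w' : 𝓜.S → ℝ) : 𝓜.linearDrift η φ u s x y yl w - 𝓜.linearDrift η φ u s x y yl w' =
      𝓜.linearDrift η φ u s x y yl (fun v => w v - w' v) := by
  have : ∑ v, (w v - w' v) * (𝓜.driftCoeff φ s v y + (η (s, yl)).real Set.univ * φ v) =
      ∑ v, w v * (𝓜.driftCoeff φ s v y + (η (s, yl)).real Set.univ * φ v) -
      ∑ v, w' v * (𝓜.driftCoeff φ s v y + (η (s, yl)).real Set.univ * φ v) := by
    rw [← Finset.sum_sub_distrib]
    exact Finset.sum_congr rfl fun v _ => sub_mul _ _ _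
  rw [linearDrift, linearDrift, linearDrift, this]
  ring

lemma exists_enorm_linearDrift_le (η : Kernel (ℝ≥0 × ℝ) ℝ) {φ : ℝ → ℝ} {B : ℝ}
    (hφ : ∀ x, |φ x| ≤ B) : ∃ C : ℝ≥0, ∀ (u : 𝓜.S) s x y w,
      ‖𝓜.linearDrift η φ u s x y y w‖ₑ ≤ C * (𝓜.clock η s y * ∑ v, ‖w v‖ₑ) := by
  have hB : 0 ≤ B := (abs_nonneg _).trans (hφ 0)
  -- The first term bounds `driftCoeff` and is paid for by the summand 1 of the clock; the second
  -- pays for η. The further 1 below covers the product of two ratios.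
  set C₁ : ℝ≥0 := (3 * B * ∑ ζ, 𝓜.nu.real {ζ}).toNNReal + B.toNNReal with hC₁
  refine ⟨C₁ + 1, fun u s x y w => ?_⟩
  have h1 : ∀ v : 𝓜.S, ‖𝓜.driftCoeff φ s v y + (η (s, y)).real Set.univ * φ v‖ₑ ≤
      C₁ * 𝓜.clock η s y := by
    intro v
    refine (enorm_add_le _ _).trans ?_
    have h2 : ‖𝓜.driftCoeff φ s v y‖ₑ ≤ (3 * B * ∑ ζ, 𝓜.nu.real {ζ}).toNNReal := by
      rw [Real.enorm_eq_ofReal_abs]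
      exact ENNReal.ofReal_le_ofReal (𝓜.abs_driftCoeff_le hφ s v y)
    have h3 : ‖(η (s, y)).real Set.univ * φ v‖ₑ ≤ η (s, y) Set.univ * B.toNNReal := by
      rw [enorm_mul]
      gcongr
      · rw [Real.enorm_eq_ofReal measureReal_nonneg]
        exact ENNReal.ofReal_toReal_le
      · rw [Real.enorm_eq_ofReal_abs]
        exact ENNReal.ofReal_le_ofReal (hφ v)
    calc _ ≤ ((3 * B * ∑ ζ, 𝓜.nu.real {ζ}).toNNReal : ℝ≥0∞) * 1 +
          B.toNNReal * η (s, y) Set.univ := by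
          rw [mul_one, mul_comm (B.toNNReal : ℝ≥0∞)]; gcongr
      _ ≤ ((3 * B * ∑ ζ, 𝓜.nu.real {ζ}).toNNReal : ℝ≥0∞) * 𝓜.clock η s y +
          B.toNNReal * 𝓜.clock η s y := by
          gcongr
          · exact 𝓜.one_le_clock η s y
          · exact le_add_self.trans le_self_add
      _ = _ := by rw [hC₁]; push_cast; ring
  calc ‖𝓜.linearDrift η φ u s x y y w‖ₑ
      ≤ (∑ v, ‖w v‖ₑ * (C₁ * 𝓜.clock η s y)) + ‖w u‖ₑ * 𝓜.clock η s y := by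
        refine (enorm_add_le _ _).trans (add_le_add ?_ ?_)
        · refine (enorm_sum_le _ _).trans (Finset.sum_le_sum fun v _ => ?_)
          rw [enorm_mul]
          gcongr
          exact h1 v
        · rw [enorm_mul, enorm_mul]
          calc _ = ‖w u‖ₑ * (‖𝓜.ratio s u y‖ₑ * ‖𝓜.ratio s x y‖ₑ) := by ring
            _ ≤ _ := by gcongr; exact 𝓜.enorm_ratio_mul_ratio_le_clock η s u x y
    _ ≤ (∑ v, ‖w v‖ₑ * (C₁ * 𝓜.clock η s y)) + (∑ v, ‖w v‖ₑ) * 𝓜.clock η s y := by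
        gcongr
        exact Finset.single_le_sum (f := fun v => ‖w v‖ₑ) (fun _ _ => zero_le) (Finset.mem_univ u)
    _ = _ := by
        rw [← Finset.sum_mul]; push_cast; ring

end Model

/-- Used to replace an almost sure path property by one holding at every point of a measurable event
of full measure. -/
lemma exists_measurableSet_of_ae {P : Measure Ω} {p : Ω → Prop} (h : ∀ᵐ ω ∂P, p ω) :
    ∃ A, MeasurableSet A ∧ P Aᶜ = 0 ∧ ∀ ω ∈ A, p ω := by
  obtain ⟨B, hsub, hB, h0⟩ := exists_measurable_superset_of_null (ae_iff.1 h)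
  refine ⟨Bᶜ, hB.compl, by rwa [compl_compl], fun ω hω => ?_⟩
  by_contra hp
  exact hω (hsub hp)

lemma MeasurableUpTo.comp_time {E F : Type*} [MeasurableSpace E] [MeasurableSpace F]
    {m : MeasurableSpace Ω} {t : ℝ≥0} {y : ℝ≥0 → Ω → E} (hy : MeasurableUpTo m t y)
    {g : ℝ≥0 × E → F} (hg : Measurable g) : MeasurableUpTo m t (fun s ω => g (s, y s ω)) :=
  hg.comp (((@measurable_fst _ _ _ m).min measurable_const).prodMk hy)

lemma timeLIntegral_mono {f g : ℝ≥0 → ℝ≥0∞} {T : ℝ≥0} (h : ∀ s ≤ T, f s ≤ g s) :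
    timeLIntegral f T ≤ timeLIntegral g T :=
  setLIntegral_mono' measurableSet_Icc fun _ hs => h _ (Real.toNNReal_le_iff_le_coe.2 hs.2)

/-! ### Regular paths of the system. -/

namespace Model

variable (𝓜 : Model)

/-- Since `S` is finite, measurability in (t, y) for each state already gives joint measurability.
-/
lemma measurable_along {f : ℝ≥0 → 𝓜.S → ℝ → ℝ}
    (hf : ∀ u, Measurable (fun p : ℝ≥0 × ℝ => f p.1 u p.2)) {x : ℝ≥0 → 𝓜.S} {y : ℝ≥0 → ℝ}
    (hx : Measurable x) (hy : Measurable y) : Measurable (fun s => f s (x s) (y s)) := by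
  have h : Measurable (fun p : 𝓜.S × (ℝ≥0 × ℝ) => f p.2.1 p.1 p.2.2) :=
    measurable_from_prod_countable_right hf
  exact h.comp (hx.prodMk (measurable_id.prodMk hy))

/-- A path of the system along which the coefficients of the Zakai equation are integrable. -/
structure IsRegularPath (η : Kernel (ℝ≥0 × ℝ) ℝ) (T : ℝ≥0) (x : ℝ≥0 → 𝓜.S) (y : ℝ≥0 → ℝ) :
    Prop where
  measurable_x : Measurable x
  measurable_y : Measurable y
  leftLim_eq : ∀ᵐ s ∂(volume.restrict (Set.Icc (0 : ℝ) T)),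
    Function.leftLim y s.toNNReal = y s.toNNReal
  clock_lt_top : timeLIntegral (fun s => 𝓜.clock η s (y s)) T < ∞

variable {𝓜} {η : Kernel (ℝ≥0 × ℝ) ℝ} {T : ℝ≥0} {x : ℝ≥0 → 𝓜.S} {y : ℝ≥0 → ℝ}

lemma IsRegularPath.ratio_sq (h : 𝓜.IsRegularPath η T x y) :
    timeLIntegral (fun s => ‖𝓜.ratio s (x s) (y s)‖ₑ ^ 2) T < ∞ :=
  (timeLIntegral_mono fun s _ => 𝓜.enorm_ratio_sq_le_clock η s (x s) (y s)).trans_lt h.clock_lt_top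

lemma IsRegularPath.measurable_ratio (h : 𝓜.IsRegularPath η T x y) :
    Measurable (fun s => 𝓜.ratio s (x s) (y s)) :=
  𝓜.measurable_along 𝓜.measurable_ratio h.measurable_x h.measurable_y

lemma IsRegularPath.measurable_ratio_state (h : 𝓜.IsRegularPath η T x y) (u : 𝓜.S) :
    Measurable (fun s => 𝓜.ratio s u (y s)) :=
  𝓜.measurable_along 𝓜.measurable_ratio measurable_const h.measurable_y

lemma IsRegularPath.intervalIntegrable_of_enorm_le (h : 𝓜.IsRegularPath η T x y) {f : ℝ≥0 → ℝ}
    (hf : AEStronglyMeasurable (fun s : ℝ => f s.toNNReal) (volume.restrict (Set.Icc 0 T)))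
    {C : ℝ≥0} (hC : ∀ᵐ s ∂(volume.restrict (Set.Icc (0 : ℝ) T)),
      ‖f s.toNNReal‖ₑ ≤ C * 𝓜.clock η s.toNNReal (y s.toNNReal)) :
    IntervalIntegrable (fun s : ℝ => f s.toNNReal) volume 0 T := by
  refine intervalIntegrable_of_timeLIntegral hf ((lintegral_mono_ae hC).trans_lt ?_)
  rw [lintegral_const_mul' _ _ ENNReal.coe_ne_top]
  exact ENNReal.mul_lt_top ENNReal.coe_lt_top h.clock_lt_top

lemma IsRegularPath.intervalIntegrable_ratio (h : 𝓜.IsRegularPath η T x y) :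
    IntervalIntegrable (fun s : ℝ => 𝓜.ratio s.toNNReal (x s.toNNReal) (y s.toNNReal))
      volume 0 T := by
  refine h.intervalIntegrable_of_enorm_le (f := fun s => 𝓜.ratio s (x s) (y s)) (C := 1)
    (h.measurable_ratio.comp measurable_real_toNNReal).aestronglyMeasurable (ae_of_all _ fun s => ?_)
  rw [ENNReal.coe_one, one_mul]
  exact 𝓜.enorm_ratio_le_clock η _ _ _

lemma IsRegularPath.intervalIntegrable_filteredRatio (h : 𝓜.IsRegularPath η T x y)
    {Y : ℝ≥0 → Ω → ℝ} {π : ℝ≥0 → Ω → ProbabilityMeasure 𝓜.S} {ω : Ω} (hy : ∀ s, Y s ω = y s)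
    (hπ : IsCadlag (fun t => π t ω)) :
    IntervalIntegrable (fun s : ℝ => 𝓜.filteredRatio Y π s.toNNReal ω) volume 0 T := by
  have e : ∀ s, 𝓜.filteredRatio Y π s ω =
      ∑ v, (π s ω : Measure 𝓜.S).real {v} * 𝓜.ratio s v (y s) := by
    intro s
    unfold filteredRatio
    rw [integral_fintype Integrable.of_finite, hy]
    rfl
  have hm : ∀ v, Measurable (fun s => (π s ω : Measure 𝓜.S).real {v}) := fun v =>
    measurable_of_rightContinuous fun s => ((continuous_finiteMeasure_singleton v).comp
      ProbabilityMeasure.toFiniteMeasure_continuous).continuousAt.comp_continuousWithinAt (hπ s).1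
  refine h.intervalIntegrable_of_enorm_le (f := fun s => 𝓜.filteredRatio Y π s ω)
    (C := Fintype.card 𝓜.S) ?_ (ae_of_all _ fun s => ?_)
  · simp_rw [e]
    refine Measurable.aestronglyMeasurable (Finset.measurable_fun_sum _ fun v _ => ?_)
    exact ((hm v).mul (h.measurable_ratio_state v)).comp measurable_real_toNNReal
  · rw [e]
    refine (enorm_sum_le _ _).trans ?_
    calc _ ≤ ∑ v : 𝓜.S, 𝓜.clock η s.toNNReal (y s.toNNReal) := by
          refine Finset.sum_le_sum fun v _ => ?_
          rw [enorm_mul]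
          refine le_trans ?_ (𝓜.enorm_ratio_le_clock η _ v _)
          refine mul_le_of_le_one_left zero_le ?_
          rw [Real.enorm_eq_ofReal measureReal_nonneg]
          exact ENNReal.ofReal_le_one.2 measureReal_le_one
      _ = _ := by simp

/-- The filtered ratio subtracted in the innovation is added back in W̃. Splitting the integral
requires both ratios to be integrable along the path, and the clock provides this. -/
lemma IsRegularPath.Wtilde_eq {W Y : ℝ≥0 → Ω → ℝ} {X : ℝ≥0 → Ω → 𝓜.S}
    {π : ℝ≥0 → Ω → ProbabilityMeasure 𝓜.S} {ω : Ω}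
    (h : 𝓜.IsRegularPath η T (fun s => X s ω) (fun s => Y s ω))
    (hπ : IsCadlag (fun t => π t ω)) {t : ℝ≥0} (ht : t ≤ T) :
    𝓜.Wtilde W X Y π t ω =
      W t ω + timeIntegral (fun s => 𝓜.ratio s (X s ω) (Y s ω)) t := by
  have h1 := intervalIntegrable_of_le (h.intervalIntegrable_filteredRatio (fun _ => rfl) hπ) ht
  have h2 := intervalIntegrable_of_le h.intervalIntegrable_ratio ht
  unfold Wtilde innovation timeIntegral
  rw [intervalIntegral.integral_sub h2 h1]
  ring

lemma IsRegularPath.intervalIntegrable_linearDrift (h : 𝓜.IsRegularPath η T x y) {φ : ℝ → ℝ}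
    {B : ℝ} (hφ : ∀ x, |φ x| ≤ B) (u : 𝓜.S) {w : ℝ≥0 → 𝓜.S → ℝ}
    (hw : ∀ v, Measurable (fun s => w s v)) {D : ℝ≥0} (hD : ∀ v, ∀ s ≤ T, |w s v| ≤ D) :
    IntervalIntegrable (fun s : ℝ => 𝓜.linearDrift η φ u s.toNNReal (x s.toNNReal) (y s.toNNReal)
      (Function.leftLim y s.toNNReal) (w s.toNNReal)) volume 0 T := by
  obtain ⟨C, hC⟩ := 𝓜.exists_enorm_linearDrift_le η hφ
  have hm : Measurable (fun s : ℝ => 𝓜.linearDrift η φ u s.toNNReal (x s.toNNReal) (y s.toNNReal)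
      (y s.toNNReal) (w s.toNNReal)) := by
    have : Measurable (fun s : ℝ≥0 => 𝓜.linearDrift η φ u s (x s) (y s) (y s) (w s)) := by
      unfold linearDrift
      have h1 : ∀ v, Measurable (fun s => 𝓜.driftCoeff φ s v (y s)) := fun v =>
        𝓜.measurable_along (𝓜.measurable_driftCoeff φ) measurable_const h.measurable_y
      have h2 : Measurable (fun s => (η (s, y s)).real Set.univ) :=
        ((η.measurable_coe MeasurableSet.univ).comp
          (measurable_id.prodMk h.measurable_y)).ennreal_toReal
      exact (Finset.measurable_fun_sum _ fun v _ =>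
        (hw v).mul ((h1 v).add (h2.mul_const _))).add
          (((h.measurable_ratio_state u).mul (hw u)).mul h.measurable_ratio)
    exact this.comp measurable_real_toNNReal
  refine h.intervalIntegrable_of_enorm_le
    (f := fun s => 𝓜.linearDrift η φ u s (x s) (y s) (Function.leftLim y s) (w s))
    (C := C * (Fintype.card 𝓜.S * D)) ?_ ?_
  · refine hm.aestronglyMeasurable.congr ?_
    filter_upwards [h.leftLim_eq] with s hs
    rw [hs]
  · filter_upwards [h.leftLim_eq, ae_restrict_mem measurableSet_Icc] with s hs hsI
    rw [hs]
    refine (hC u _ _ _ _).trans ?_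
    have : ∑ v, ‖w s.toNNReal v‖ₑ ≤ Fintype.card 𝓜.S * D := by
      calc _ ≤ ∑ v : 𝓜.S, (D : ℝ≥0∞) := by
            refine Finset.sum_le_sum fun v _ => ?_
            rw [Real.enorm_eq_ofReal_abs]
            refine (ENNReal.ofReal_le_ofReal
              (hD v _ (Real.toNNReal_le_iff_le_coe.2 hsI.2))).trans ?_
            rw [ENNReal.ofReal_coe_nnreal]
        _ = _ := by simp
    calc _ ≤ C * (𝓜.clock η s.toNNReal (y s.toNNReal) * (Fintype.card 𝓜.S * D)) := by gcongr
      _ = _ := by push_cast; ring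

/-- The bound on the mean of η yields a pathwise bound once the time integral is measurable in ω.
For this `Y` is set to 0 off an event on which its paths are càdlàg. The left limits of `Y` in the
hypothesis on η are exchanged for values by `hleft`. -/
lemma ae_clock_lt_top {P : Measure Ω} {Y : ℝ≥0 → Ω → ℝ} (hY : ∀ t, Measurable (Y t))
    (hYc : ∀ᵐ ω ∂P, IsCadlag (fun t => Y t ω))
    (hleft : ∀ᵐ ω ∂P, ∀ᵐ s ∂(volume.restrict (Set.Icc (0 : ℝ) T)),
      Function.leftLim (fun r => Y r ω) s.toNNReal = Y s.toNNReal ω)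
    (hη : ∫⁻ ω, timeLIntegral
      (fun s => η (s, Function.leftLim (fun r => Y r ω) s) Set.univ) T ∂P < ∞)
    (hratio : ∀ u : 𝓜.S, ∀ᵐ ω ∂P, timeLIntegral (fun s => ‖𝓜.ratio s u (Y s ω)‖ₑ ^ 2) T < ∞) :
    ∀ᵐ ω ∂P, timeLIntegral (fun s => 𝓜.clock η s (Y s ω)) T < ∞ := by
  obtain ⟨A, hA, hA0, hAc⟩ := exists_measurableSet_of_ae hYc
  have hAe : ∀ᵐ ω ∂P, ω ∈ A := hA0
  have hηm : Measurable (fun p : ℝ≥0 × ℝ => η p Set.univ) := η.measurable_coe MeasurableSet.univ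
  have hYm : MeasurableUpTo mΩ T (fun s => A.indicator (Y s)) := by
    refine measurableUpTo_of_rightContinuous (fun s _ => (hY s).indicator hA) fun ω s => ?_
    by_cases hω : ω ∈ A
    · simpa [hω] using (hAc ω hω s).1
    · simpa [hω] using continuousWithinAt_const
  have hm : Measurable (fun ω => timeLIntegral (fun s => η (s, A.indicator (Y s) ω) Set.univ) T) :=
    (hYm.comp_time hηm).lintegral 0
  have hfin : ∀ᵐ ω ∂P, timeLIntegral (fun s => η (s, A.indicator (Y s) ω) Set.univ) T < ∞ := by
    refine ae_lt_top hm (lt_of_le_of_lt (le_of_eq (lintegral_congr_ae ?_)) hη).ne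
    filter_upwards [hAe, hleft] with ω h1 h2
    refine lintegral_congr_ae ?_
    filter_upwards [h2] with s hs
    simp [h1, hs]
  filter_upwards [hfin, hAe, ae_all_iff.2 hratio] with ω h1 h2 h3
  have hy : Measurable (fun s => Y s ω) := measurable_of_rightContinuous fun s => (hAc ω h2 s).1
  simp only [Set.indicator_of_mem h2] at h1
  have m1 : Measurable (fun s : ℝ => η (s.toNNReal, Y s.toNNReal ω) Set.univ) :=
    (hηm.comp (measurable_id.prodMk hy)).comp measurable_real_toNNReal
  have m2 : ∀ u : 𝓜.S, Measurable (fun s : ℝ => ‖𝓜.ratio s.toNNReal u (Y s.toNNReal ω)‖ₑ ^ 2) :=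
    fun u => (((𝓜.measurable_ratio u).comp (measurable_id.prodMk hy)).enorm.pow_const 2).comp
      measurable_real_toNNReal
  have m3 : Measurable (fun s : ℝ => 1 + η (s.toNNReal, Y s.toNNReal ω) Set.univ) :=
    measurable_const.add m1
  simp only [timeLIntegral, clock]
  rw [lintegral_add_left m3, lintegral_add_left measurable_const,
    lintegral_finsetSum _ fun u _ => m2 u]
  refine ENNReal.add_lt_top.2 ⟨ENNReal.add_lt_top.2 ⟨by simp, h1⟩, ?_⟩
  exact ENNReal.sum_lt_top.2 fun u _ => h3 u

end Model

/-! ### The linear system of the masses and pathwise uniqueness. -/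

namespace Model

variable {𝓜 : Model} {η : Kernel (ℝ≥0 × ℝ) ℝ} {T : ℝ≥0}

/-- The masses of a solution of the Zakai equation solve a linear system driven by the original
Brownian motion. -/
lemma IsZakaiSolution.exists_representation {P P₀ : Measure Ω} (hP : P ≪ P₀)
    {𝓨 : Filtration ℝ≥0 mΩ} {W Y : ℝ≥0 → Ω → ℝ} {X : ℝ≥0 → Ω → 𝓜.S}
    {π : ℝ≥0 → Ω → ProbabilityMeasure 𝓜.S} {ξ : ℝ≥0 → Ω → FiniteMeasure 𝓜.S}
    (hξ : 𝓜.IsZakaiSolution P₀ 𝓨 T (𝓜.Wtilde W X Y π) Y η ξ)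
    (hpath : ∀ᵐ ω ∂P, 𝓜.IsRegularPath η T (fun s => X s ω) (fun s => Y s ω))
    (hπ : ∀ᵐ ω ∂P, IsCadlag (fun t => π t ω)) (hWc : ∀ᵐ ω ∂P, Continuous (fun t => W t ω))
    {φ : ℝ → ℝ} {u : 𝓜.S} (hφ : IsTestFunction (fun _ => φ))
    (hφu : ∀ x : 𝓜.S, φ x = if x = u then 1 else 0) :
    ∃ (Hn : ℕ → SimpleIntegrand 𝓨) (M : ℝ≥0 → Ω → ℝ), ∀ᵐ ω ∂P,
      Tendsto (fun n => timeLIntegral (fun s => ‖(Hn n).value s ω -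
        𝓜.ratio s u (Y s ω) * (ξ s ω : Measure 𝓜.S).real {u}‖ₑ ^ 2) T) atTop (𝓝 0) ∧
      (∀ t ≤ T, Tendsto (fun n => (Hn n).integral W t ω) atTop (𝓝 (M t ω))) ∧
      ContinuousOn (fun t => M t ω) (Set.Iic T) ∧
      IntervalIntegrable (fun s : ℝ => 𝓜.linearDrift η φ u s.toNNReal (X s.toNNReal ω)
        (Y s.toNNReal ω) (Function.leftLim (fun r => Y r ω) s.toNNReal)
        (fun v => (ξ s.toNNReal ω : Measure 𝓜.S).real {v})) volume 0 T ∧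
      ∀ t ≤ T, (ξ t ω : Measure 𝓜.S).real {u} = φ 𝓜.x0 +
        timeIntegral (fun s => 𝓜.linearDrift η φ u s (X s ω) (Y s ω)
          (Function.leftLim (fun r => Y r ω) s) (fun v => (ξ s ω : Measure 𝓜.S).real {v})) t +
        M t ω + ∑ᶠ s ∈ {s | s ∈ Set.Ioc 0 t ∧ jump (fun r => Y r ω) s ≠ 0},
          𝓜.zakaiJump Y η (fun _ => φ) ξ s ω (jump (fun r => Y r ω) s) := by
  obtain ⟨M, hM, heq⟩ := hξ.equation _ hφ
  obtain ⟨Hn, hHn⟩ := hM.exists_ae_tendsto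
  obtain ⟨B, hB⟩ := hφ.bounded
  -- The limit of the same elementary integrals taken against `W`: the W̃-integral minus the drift
  -- it contains.
  refine ⟨Hn, fun t ω => M t ω - timeIntegral (fun s => 𝓜.ratio s u (Y s ω) *
    (ξ s ω : Measure 𝓜.S).real {u} * 𝓜.ratio s (X s ω) (Y s ω)) t, ?_⟩
  filter_upwards [hP.ae_le heq, hP.ae_le hHn, hP.ae_le hξ.cadlag, hpath, hπ, hWc]
    with ω heq hHn hξc hpath hπ hWc
  have hmass : ∀ v, IsCadlag (fun s => (ξ s ω : Measure 𝓜.S).real {v}) := fun v =>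
    hξc.comp (continuous_finiteMeasure_singleton v)
  have hmm : ∀ v, Measurable (fun s => (ξ s ω : Measure 𝓜.S).real {v}) := fun v =>
    measurable_of_rightContinuous fun s => (hmass v s).1
  choose D hD using fun v => (hmass v).exists_bound T
  have hD' : ∀ v, ∀ s ≤ T, |(ξ s ω : Measure 𝓜.S).real {v}| ≤ (∑ v, D v : ℝ≥0) := fun v s hs =>
    (hD v s hs).trans (NNReal.coe_le_coe.2
      (Finset.single_le_sum (f := D) (fun _ _ => zero_le) (Finset.mem_univ v)))
  have hWt : ∀ t ≤ T, 𝓜.Wtilde W X Y π t ω =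
      W t ω + timeIntegral (fun s => 𝓜.ratio s (X s ω) (Y s ω)) t := fun t ht =>
    hpath.Wtilde_eq hπ ht
  have hhm : AEStronglyMeasurable (fun s : ℝ => 𝓜.ratio s.toNNReal u (Y s.toNNReal ω) *
      (ξ s.toNNReal ω : Measure 𝓜.S).real {u}) (volume.restrict (Set.Icc 0 T)) :=
    (((hpath.measurable_ratio_state u).mul (hmm u)).comp
      measurable_real_toNNReal).aestronglyMeasurable
  have hhR : IntervalIntegrable (fun s : ℝ => 𝓜.ratio s.toNNReal u (Y s.toNNReal ω) *
      (ξ s.toNNReal ω : Measure 𝓜.S).real {u} *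
      𝓜.ratio s.toNNReal (X s.toNNReal ω) (Y s.toNNReal ω)) volume 0 T := by
    refine hpath.intervalIntegrable_of_enorm_le (f := fun s => 𝓜.ratio s u (Y s ω) *
      (ξ s ω : Measure 𝓜.S).real {u} * 𝓜.ratio s (X s ω) (Y s ω)) (C := D u)
      (hhm.mul (hpath.measurable_ratio.comp measurable_real_toNNReal).aestronglyMeasurable) ?_
    filter_upwards [ae_restrict_mem measurableSet_Icc] with s hs
    rw [enorm_mul, enorm_mul]
    have h1 : ‖(ξ s.toNNReal ω : Measure 𝓜.S).real {u}‖ₑ ≤ D u := by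
      rw [Real.enorm_eq_ofReal_abs]
      refine (ENNReal.ofReal_le_ofReal (hD u _ (Real.toNNReal_le_iff_le_coe.2 hs.2))).trans ?_
      rw [ENNReal.ofReal_coe_nnreal]
    calc _ = ‖(ξ s.toNNReal ω : Measure 𝓜.S).real {u}‖ₑ *
          (‖𝓜.ratio s.toNNReal u (Y s.toNNReal ω)‖ₑ *
            ‖𝓜.ratio s.toNNReal (X s.toNNReal ω) (Y s.toNNReal ω)‖ₑ) := by ring
      _ ≤ _ := by
          gcongr
          exact 𝓜.enorm_ratio_mul_ratio_le_clock η _ _ _ _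
  have hdr := hpath.intervalIntegrable_linearDrift (fun x => (hB 0 x).1) u
    (w := fun s v => (ξ s ω : Measure 𝓜.S).real {v}) hmm hD'
  have hconv := hHn.1
  simp only [𝓜.zakaiDiffusion_eq hφu] at hconv
  have hWtc : ContinuousOn (fun t => 𝓜.Wtilde W X Y π t ω) (Set.Iic T) :=
    ((hWc.continuousOn).add (continuous_timeIntegral hpath.intervalIntegrable_ratio)).congr hWt
  refine ⟨hconv, fun t ht => ?_, ?_, hdr, fun t ht => ?_⟩
  · exact tendsto_integral_sub_drift hWt hpath.intervalIntegrable_ratio hpath.ratio_sq hhm hhR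
      hconv ht (hHn.2.tendsto_at ht)
  · exact (hHn.2.continuousOn (Frequently.of_forall fun n => (Hn n).continuous_integral hWtc)).sub
      (continuous_timeIntegral hhR)
  · have h1 := heq t ht
    rw [𝓜.pairing_eq hφu] at h1
    -- The last term of `linearDrift` is exactly the drift moved out of the W̃-integral, so it
    -- cancels against the correction of `M`.
    have h2 : timeIntegral (fun s => 𝓜.zakaiDrift Y η (fun _ => φ) ξ s ω) t =
        timeIntegral (fun s => 𝓜.linearDrift η φ u s (X s ω) (Y s ω)
          (Function.leftLim (fun r => Y r ω) s) (fun v => (ξ s ω : Measure 𝓜.S).real {v})) t -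
        timeIntegral (fun s => 𝓜.ratio s u (Y s ω) *
          (ξ s ω : Measure 𝓜.S).real {u} * 𝓜.ratio s (X s ω) (Y s ω)) t := by
      unfold timeIntegral
      rw [← intervalIntegral.integral_sub (intervalIntegrable_of_le hdr ht)
        (intervalIntegrable_of_le hhR ht)]
      simp only [𝓜.zakaiDrift_eq, linearDrift, add_sub_cancel_right]
    rw [h1, h2]
    ring

end Model

lemma finiteMeasure_ext_singleton {α : Type*} [Countable α] [MeasurableSpace α]
    [MeasurableSingletonClass α] {ρ ρ' : FiniteMeasure α}
    (h : ∀ a, (ρ : Measure α).real {a} = (ρ' : Measure α).real {a}) : ρ = ρ' := by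
  refine Subtype.ext (Measure.ext_iff_singleton.2 fun a => ?_)
  exact (ENNReal.toReal_eq_toReal_iff' (measure_ne_top (ρ : Measure α) _)
    (measure_ne_top (ρ' : Measure α) _)).1 (h a)

lemma SimpleIntegrand.tendsto_value_sub {𝓖 𝓖' : Filtration ℝ≥0 mΩ} {H : ℕ → SimpleIntegrand 𝓖}
    {H' : ℕ → SimpleIntegrand 𝓖'} {h h' : ℝ≥0 → ℝ} {T : ℝ≥0} {ω : Ω} (hm : Measurable h)
    (hH : Tendsto (fun n => timeLIntegral (fun s => ‖(H n).value s ω - h s‖ₑ ^ 2) T) atTop (𝓝 0))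
    (hH' : Tendsto (fun n => timeLIntegral (fun s => ‖(H' n).value s ω - h' s‖ₑ ^ 2) T) atTop
      (𝓝 0)) :
    Tendsto (fun n => timeLIntegral (fun s =>
      ‖(H n).value s ω - (H' n).value s ω - (h s - h' s)‖ₑ ^ 2) T) atTop (𝓝 0) := by
  have hlim := ENNReal.Tendsto.const_mul (a := 2) (hH.add hH') (Or.inr (by simp))
  rw [add_zero, mul_zero] at hlim
  refine tendsto_of_tendsto_of_tendsto_of_le_of_le tendsto_const_nhds hlim (fun n => zero_le)
    fun n => ?_
  have hmeas : Measurable (fun s : ℝ => ‖(H n).value s.toNNReal ω - h s.toNNReal‖ₑ ^ 2) :=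
    (((H n).measurable_value_path ω).sub (hm.comp measurable_real_toNNReal)).enorm.pow_const 2
  unfold timeLIntegral
  rw [← lintegral_add_left hmeas, ← lintegral_const_mul' _ _ (by simp)]
  refine lintegral_mono fun s => ?_
  refine le_trans (pow_le_pow_left₀ zero_le ?_ 2) (ennreal_add_sq_le _ _)
  rw [show (H n).value s.toNNReal ω - (H' n).value s.toNNReal ω -
    (h s.toNNReal - h' s.toNNReal) = ((H n).value s.toNNReal ω - h s.toNNReal) -
      ((H' n).value s.toNNReal ω - h' s.toNNReal) by ring]
  exact enorm_sub_le

namespace Model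

variable {𝓜 : Model} {η : Kernel (ℝ≥0 × ℝ) ℝ} {T : ℝ≥0}

/-- Pathwise uniqueness for the Zakai equation under the original probability. -/
theorem IsZakaiSolution.ae_eq {P P₀ : Measure Ω} [IsProbabilityMeasure P] (hP : P ≪ P₀)
    {𝓕 𝓨 : Filtration ℝ≥0 mΩ} (h𝓨 : 𝓨 ≤ augmentation P 𝓕) {W Y : ℝ≥0 → Ω → ℝ}
    (hW : IsBrownianWrt P 𝓕 W) {N : 𝓜.S × 𝓜.S → ℝ≥0 → Ω → ℕ}
    (hN : IsPoissonFamily P 𝓕 N 𝓜.rate) {X : ℝ≥0 → Ω → 𝓜.S} {π : ℝ≥0 → Ω → ProbabilityMeasure 𝓜.S}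
    (hYa : ∀ t, Measurable[𝓕 t] (Y t)) (hYc : ∀ᵐ ω ∂P, IsCadlag (fun t => Y t ω))
    (hjump : ∀ᵐ ω ∂P, ∀ s ≤ T, (∃ q < s, ∀ ζ, N ζ q ω = N ζ s ω) → jump (fun r => Y r ω) s = 0)
    (hpath : ∀ᵐ ω ∂P, 𝓜.IsRegularPath η T (fun s => X s ω) (fun s => Y s ω))
    (hπ : ∀ᵐ ω ∂P, IsCadlag (fun t => π t ω))
    {ξ ξ' : ℝ≥0 → Ω → FiniteMeasure 𝓜.S}
    (hξ : 𝓜.IsZakaiSolution P₀ 𝓨 T (𝓜.Wtilde W X Y π) Y η ξ)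
    (hξ' : 𝓜.IsZakaiSolution P₀ 𝓨 T (𝓜.Wtilde W X Y π) Y η ξ') :
    ∀ᵐ ω ∂P, ∀ t ≤ T, ξ t ω = ξ' t ω := by
  classical
  choose φ hφ hφu using 𝓜.exists_testFunction
  choose H M hrep using fun u =>
    hξ.exists_representation hP hpath hπ hW.brownian.cont (hφ u) (hφu u)
  choose H' M' hrep' using fun u =>
    hξ'.exists_representation hP hpath hπ hW.brownian.cont (hφ u) (hφu u)
  choose B hB using fun u => (hφ u).bounded
  choose D hD using fun u => 𝓜.exists_enorm_linearDrift_le η (fun x => (hB u 0 x).1)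
  have hgood : ∀ᵐ ω ∂P, IsCadlag (fun t => Y t ω) ∧ IsCadlag (fun t => ξ t ω) ∧
      IsCadlag (fun t => ξ' t ω) ∧
      ∀ ζ, Monotone (fun t => N ζ t ω) ∧ IsCadlag (fun t => N ζ t ω) := by
    filter_upwards [hYc, hP.ae_le hξ.cadlag, hP.ae_le hξ'.cadlag, ae_all_iff.2 hN.paths]
      with ω h1 h2 h3 h4 using ⟨h1, h2, h3, fun ζ => (h4 ζ).2⟩
  -- Multiplying all processes by the indicator of `A` gives regular paths for every ω; adaptedness
  -- survives because the filtration is augmented.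
  obtain ⟨A, hA, hA0, hAg⟩ := exists_measurableSet_of_ae hgood
  have hAe : ∀ᵐ ω ∂P, ω ∈ A := hA0
  have hA𝓗 : ∀ t, MeasurableSet[augmentation P 𝓕 t] A := measurableSet_augmentation 𝓕 hA hA0
  set m : 𝓜.S → ℝ≥0 → Ω → ℝ := fun u t ω => (ξ t ω : Measure 𝓜.S).real {u} with hm
  set m' : 𝓜.S → ℝ≥0 → Ω → ℝ := fun u t ω => (ξ' t ω : Measure 𝓜.S).real {u} with hm'
  have hmass : ∀ u : 𝓜.S, Measurable (fun ρ : FiniteMeasure 𝓜.S => (ρ : Measure 𝓜.S).real {u}) :=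
    fun u => ((Measure.measurable_coe (measurableSet_singleton u)).comp
      measurable_subtype_coe).ennreal_toReal
  have hYm : ∀ t, MeasurableUpTo (augmentation P 𝓕 t) t (fun s => A.indicator (Y s)) := by
    refine fun t => measurableUpTo_of_rightContinuous (fun s hs => ?_) fun ω s => ?_
    · exact Measurable.indicator (((hYa s).mono (𝓕.mono hs) le_rfl).mono
        (le_augmentation P 𝓕 t) le_rfl) (hA𝓗 t)
    · by_cases hω : ω ∈ A
      · simpa [hω] using ((hAg ω hω).1 s).1
      · simpa [hω] using continuousWithinAt_const
  have hdiff : ∀ ω ∈ A, ∀ s, (∀ r < s, ∀ u, A.indicator (m u r - m' u r) ω = 0) →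
      ∀ r < s, ξ r ω = ξ' r ω := by
    intro ω hω s h r hr
    refine finiteMeasure_ext_singleton fun u => ?_
    have h1 : m u r ω = m' u r ω := by simpa [hω, sub_eq_zero] using h r hr u
    exact h1
  -- If the solutions agree before every jump time of `Y`, all their jump coefficients agree, the
  -- one at the final time included.
  have hsum : ∀ ω ∈ A, ∀ t ≤ T, ∀ u, (∀ s, 0 < s → s ≤ t → jump (fun r => Y r ω) s ≠ 0 →
        ∀ r < s, ∀ u, A.indicator (m u r - m' u r) ω = 0) →
      ∑ᶠ s ∈ {s | s ∈ Set.Ioc 0 t ∧ jump (fun r => Y r ω) s ≠ 0},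
        𝓜.zakaiJump Y η (fun _ => φ u) ξ s ω (jump (fun r => Y r ω) s) =
      ∑ᶠ s ∈ {s | s ∈ Set.Ioc 0 t ∧ jump (fun r => Y r ω) s ≠ 0},
        𝓜.zakaiJump Y η (fun _ => φ u) ξ' s ω (jump (fun r => Y r ω) s) := by
    intro ω hω t ht u h
    refine finsum_mem_congr rfl fun s hs => ?_
    exact 𝓜.zakaiJump_congr Y η _ hs.1.1 (hdiff ω hω s (h s hs.1.1 hs.1.2 hs.2)) (hAg ω hω).2.1 _
  -- With the jump sums cancelled, the difference of the two representations is a linear drift in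
  -- the differences of the masses, dominated by the clock.
  have hincr : ∀ᵐ ω ∂P, ∀ t ≤ T, (∀ s, 0 < s → s ≤ t → jump (fun r => Y r ω) s ≠ 0 →
        ∀ r < s, ∀ u, A.indicator (m u r - m' u r) ω = 0) →
      ∀ u, ‖A.indicator (m u t - m' u t) ω - (M u t ω - M' u t ω)‖ₑ ≤ (∑ u, D u : ℝ≥0) *
        timeLIntegral (fun s => 𝓜.clock η s (A.indicator (Y s) ω) *
          ∑ v, ‖A.indicator (m v s - m' v s) ω‖ₑ) t := by
    filter_upwards [hAe, ae_all_iff.2 hrep, ae_all_iff.2 hrep', hpath]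
      with ω hω hrep hrep' hpath t ht h u
    obtain ⟨-, -, -, hi, he⟩ := hrep u
    obtain ⟨-, -, -, hi', he'⟩ := hrep' u
    have h1 := he t ht
    have h2 := he' t ht
    have h0 := hsum ω hω t ht u h
    simp only [Set.mem_ofPred_eq] at h0
    rw [h0] at h1
    simp only [Set.indicator_of_mem hω, Pi.sub_apply]
    have h3 : m u t ω - m' u t ω - (M u t ω - M' u t ω) = timeIntegral (fun s =>
        𝓜.linearDrift η (φ u) u s (X s ω) (Y s ω) (Function.leftLim (fun r => Y r ω) s)
          (fun v => m v s ω - m' v s ω)) t := by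
      have e : timeIntegral (fun s =>
          𝓜.linearDrift η (φ u) u s (X s ω) (Y s ω) (Function.leftLim (fun r => Y r ω) s)
          (fun v => m v s ω - m' v s ω)) t = timeIntegral (fun s => 𝓜.linearDrift η (φ u) u s (X s ω) (Y s ω)
          (Function.leftLim (fun r => Y r ω) s) (fun v => (ξ s ω : Measure 𝓜.S).real {v})) t -
          timeIntegral (fun s => 𝓜.linearDrift η (φ u) u s (X s ω) (Y s ω)
          (Function.leftLim (fun r => Y r ω) s) (fun v => (ξ' s ω : Measure 𝓜.S).real {v})) t := by
        unfold timeIntegral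
        rw [← intervalIntegral.integral_sub (intervalIntegrable_of_le hi ht)
          (intervalIntegrable_of_le hi' ht)]
        simp only [𝓜.linearDrift_sub, hm, hm']
      rw [e]
      simp only [hm, hm']
      rw [h1, h2]
      ring
    rw [h3]
    refine (enorm_timeIntegral_le _ _).trans ?_
    unfold timeLIntegral
    rw [← lintegral_const_mul' _ _ ENNReal.coe_ne_top]
    refine lintegral_mono_ae ?_
    filter_upwards [ae_restrict_of_ae_restrict_of_subset
      (Set.Icc_subset_Icc_right (NNReal.coe_le_coe.2 ht)) hpath.leftLim_eq] with s hs
    rw [hs]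
    refine (hD u u _ _ _ _).trans ?_
    gcongr
    exact Finset.single_le_sum (f := D) (fun _ _ => zero_le) (Finset.mem_univ u)
  have key := ae_eq_zero_of_linear_ito hW.augmentation T
    (d := fun u t => A.indicator (m u t - m' u t))
    (N := fun ζ t => A.indicator (N ζ t))
    (k := fun s ω => 𝓜.clock η s (A.indicator (Y s) ω))
    (r := fun u s ω => 𝓜.ratio s u (A.indicator (Y s) ω))
    (H := fun u n => (H u n).ofLE h𝓨) (H' := fun u n => (H' u n).ofLE h𝓨)
    (M := fun u t ω => M u t ω - M' u t ω) (C := ∑ u, D u)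
    ?_ ?_ ?_ ?_ ?_ ?_ ?_ ?_ ?_ ?_ ?_ ?_ ?_
  · filter_upwards [key, hAe] with ω h hω t ht
    refine finiteMeasure_ext_singleton fun u => ?_
    have h1 : m u t ω = m' u t ω := by simpa [hω, sub_eq_zero] using h t ht u
    exact h1
  · intro u t ht
    exact Measurable.indicator (((hmass u).comp ((hξ.adapted t ht).mono (h𝓨 t) le_rfl)).sub
      ((hmass u).comp ((hξ'.adapted t ht).mono (h𝓨 t) le_rfl))) (hA𝓗 t)
  · intro ω u t
    by_cases hω : ω ∈ A
    · simp only [Set.indicator_of_mem hω, Pi.sub_apply]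
      exact ((hAg ω hω).2.1.comp (continuous_finiteMeasure_singleton u) t).1.sub
        ((hAg ω hω).2.2.1.comp (continuous_finiteMeasure_singleton u) t).1
    · simpa [hω] using continuousWithinAt_const
  · intro ζ t
    exact Measurable.indicator ((hN.adapted ζ t).mono (le_augmentation P 𝓕 t) le_rfl) (hA𝓗 t)
  · intro ω ζ
    by_cases hω : ω ∈ A
    · simpa [hω] using ((hAg ω hω).2.2.2 ζ).1
    · simpa [hω] using monotone_const
  · intro ω ζ t
    by_cases hω : ω ∈ A
    · simpa [hω] using (((hAg ω hω).2.2.2 ζ).2 t).1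
    · simpa [hω] using continuousWithinAt_const
  · exact fun t _ => (hYm t).comp_time (𝓜.measurable_clock η)
  · filter_upwards [hAe, hpath] with ω hω h
    simpa [hω] using h.clock_lt_top
  · exact fun u t _ => (hYm t).comp_time (𝓜.measurable_ratio u)
  · exact fun u s ω => 𝓜.enorm_ratio_sq_le_clock η s u _
  · intro u
    filter_upwards [hAe, hpath, hrep u, hrep' u] with ω hω hpath hrep hrep'
    have hmm : Measurable (fun s => m u s ω) := measurable_of_rightContinuous fun s =>
      ((hAg ω hω).2.1.comp (continuous_finiteMeasure_singleton u) s).1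
    have h1 := SimpleIntegrand.tendsto_value_sub ((hpath.measurable_ratio_state u).mul hmm)
      hrep.1 hrep'.1
    simp only [Set.indicator_of_mem hω, Pi.sub_apply, mul_sub]
    exact h1
  · intro u
    filter_upwards [hrep u, hrep' u] with ω hrep hrep' t ht
    exact (hrep.2.1 t ht).sub (hrep'.2.1 t ht)
  -- At a jump of `Y` the counting processes cannot be constant just before, so the alternative of
  -- vanishing past must hold there.
  · filter_upwards [hAe, hincr, hjump] with ω hω hincr hjump t ht h
    refine hincr t ht fun s hs hst hsj => (h s hs hst).resolve_right fun hq => hsj ?_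
    simp only [Set.indicator_of_mem hω] at hq
    exact hjump s (hst.trans ht) hq
  -- If the difference vanishes before `t`, the jump sums agree up to and including `t` and the
  -- drift integral is 0. The difference then equals M - M', which is continuous and zero before
  -- `t`.
  · filter_upwards [hincr, ae_all_iff.2 hrep, ae_all_iff.2 hrep'] with ω hincr hrep hrep' t ht h u
    have hzero : ∀ s ≤ t, A.indicator (m u s - m' u s) ω = M u s ω - M' u s ω := by
      intro s hs
      have h1 := hincr s (hs.trans ht) (fun r _ hr _ q hq => h q (hq.trans_le (hr.trans hs))) u
      have h2 : timeLIntegral (fun s => 𝓜.clock η s (A.indicator (Y s) ω) *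
          ∑ v, ‖A.indicator (m v s - m' v s) ω‖ₑ) s = 0 := by
        unfold timeLIntegral
        rw [setLIntegral_congr Ico_ae_eq_Icc.symm]
        refine (setLIntegral_congr_fun (g := fun _ => 0) measurableSet_Ico fun r hr => ?_).trans
          (by simp)
        have hrt : r.toNNReal < t :=
          (Real.toNNReal_lt_iff_lt_coe hr.1).2 (hr.2.trans_le (NNReal.coe_le_coe.2 hs))
        simp [h _ hrt]
      rw [h2, mul_zero, nonpos_iff_eq_zero, enorm_eq_zero, sub_eq_zero] at h1
      exact h1
    rw [hzero t le_rfl]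
    -- Time 0 has no left neighbourhood; there the elementary integrals vanish, and so do their
    -- limits.
    rcases eq_or_ne t 0 with rfl | ht0
    · have e : ∀ K : SimpleIntegrand 𝓨, K.integral W 0 ω = 0 := by
        intro K
        simp [SimpleIntegrand.integral]
      have h1 := (hrep u).2.1 0 ht
      have h2 := (hrep' u).2.1 0 ht
      simp only [e] at h1 h2
      rw [tendsto_nhds_unique h1 tendsto_const_nhds, tendsto_nhds_unique h2 tendsto_const_nhds,
        sub_zero]
    · have hne : (𝓝[<] t).NeBot := nhdsLT_neBot_of_exists_lt ⟨0, pos_iff_ne_zero.2 ht0⟩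
      have hc : Tendsto (fun s => M u s ω - M' u s ω) (𝓝[<] t) (𝓝 (M u t ω - M' u t ω)) :=
        ((((hrep u).2.2.1.sub (hrep' u).2.2.1) t ht).mono
          (fun r (hr : r < t) => hr.le.trans ht)).tendsto
      refine tendsto_nhds_unique hc (tendsto_const_nhds.congr' ?_)
      filter_upwards [self_mem_nhdsWithin] with s hs
      rw [← hzero s (le_of_lt hs), h s hs u]

end Model

end PureJumpFilter
end

theorem mainTheorem7 {Ω : Type*} [mΩ : MeasurableSpace Ω] (P : Measure Ω) [IsProbabilityMeasure P]
    (𝓕 : Filtration ℝ≥0 mΩ) (T : ℝ≥0) (hT : 0 < T) (𝓜 : PureJumpFilter.Model)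
    (W : ℝ≥0 → Ω → ℝ) (hW : PureJumpFilter.IsBrownianWrt P 𝓕 W)
    (N : 𝓜.S × 𝓜.S → ℝ≥0 → Ω → ℕ) (hN : PureJumpFilter.IsPoissonFamily P 𝓕 N 𝓜.rate)
    -- existence and uniqueness for the system
    (X : ℝ≥0 → Ω → 𝓜.S) (Y : ℝ≥0 → Ω → ℝ) (hXY : 𝓜.IsSolution P 𝓕 T W N X Y)
    (hunique : ∀ X' Y', 𝓜.IsSolution P 𝓕 T W N X' Y' →
      ∀ᵐ ω ∂P, ∀ t ≤ T, X' t ω = X t ω ∧ Y' t ω = Y t ω)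
    (hint : 𝓜.IsIntegrableSystem P T X Y)
    -- the coefficients of the linear system between jump times are square integrable
    (hratio : ∀ u : 𝓜.S, ∀ᵐ ω ∂P,
      PureJumpFilter.timeLIntegral (fun s => ‖𝓜.ratio s u (Y s ω)‖ₑ ^ 2) T < ∞)
    -- the filter
    (hY : ∀ t, StronglyMeasurable (Y t))
    (π : ℝ≥0 → Ω → ProbabilityMeasure 𝓜.S)
    (hπ : 𝓜.IsFilter P (PureJumpFilter.obsFiltration P Y hY) T X π)
    (hπratio : ∫⁻ ω, PureJumpFilter.timeLIntegral
      (fun s => (∫⁻ x, ‖𝓜.ratio s x (Y s ω)‖ₑ ∂(π s ω : Measure 𝓜.S)) ^ 2) T ∂P < ∞)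
    -- the reference probability
    (η : Kernel (ℝ≥0 × ℝ) ℝ) (Ψ : ℝ≥0 → Ω → ℝ → ℝ)
    (hη : 𝓜.IsReference P (PureJumpFilter.obsFiltration P Y hY) T Y π η Ψ)
    (J : ℝ≥0 → Ω → ℝ)
    (hJ : PureJumpFilter.IsItoIntegral P (PureJumpFilter.obsFiltration P Y hY) T
      (𝓜.innovation W X Y π) (𝓜.filteredRatio Y π) J)
    (hZ : Martingale (fun t => 𝓜.girsanovDensity Y π Ψ J (min t T))
      (PureJumpFilter.obsFiltration P Y hY) P)
    -- two strong solutions of the Zakai equation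
    (ξ ξ' : ℝ≥0 → Ω → FiniteMeasure 𝓜.S)
    (hξ : 𝓜.IsZakaiSolution (𝓜.referenceMeasure P T Y π Ψ J)
      (PureJumpFilter.obsFiltration P Y hY) T (𝓜.Wtilde W X Y π) Y η ξ)
    (hξ' : 𝓜.IsZakaiSolution (𝓜.referenceMeasure P T Y π Ψ J)
      (PureJumpFilter.obsFiltration P Y hY) T (𝓜.Wtilde W X Y π) Y η ξ') :
    ∀ᵐ ω ∂(𝓜.referenceMeasure P T Y π Ψ J), ∀ t ≤ T, ξ t ω = ξ' t ω := by
  have hdens : AEMeasurable (𝓜.girsanovDensity Y π Ψ J T) P := by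
    have h := (hZ.integrable T).aestronglyMeasurable.aemeasurable
    simpa only [min_self] using h
  -- The solutions are given up to P₀-null events; this direction carries their properties over to
  -- `P`, under which the Brownian motion lives.
  have hP := 𝓜.absolutelyContinuous_referenceMeasure hη hdens
  have hb : ∀ᵐ ω ∂P, IntervalIntegrable
      (fun s : ℝ => 𝓜.b1 s.toNNReal (X s.toNNReal ω) (Y s.toNNReal ω)) volume 0 T := by
    filter_upwards [hXY.integrable_b1, hXY.cadlag_X, hXY.cadlag_Y] with ω h hX hYc
    refine PureJumpFilter.intervalIntegrable_of_timeLIntegral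
      (f := fun s => 𝓜.b1 s (X s ω) (Y s ω)) (Measurable.aestronglyMeasurable ?_) h
    exact (𝓜.measurable_along 𝓜.measurable_b1
      (PureJumpFilter.measurable_of_rightContinuous fun s => (hX s).1)
      (PureJumpFilter.measurable_of_rightContinuous fun s => (hYc s).1)).comp
        measurable_real_toNNReal
  have hjump := 𝓜.ae_jump_eq_zero hW hN hXY hb
  have hleft := 𝓜.ae_countable_jump hN hjump
  have hclock := PureJumpFilter.Model.ae_clock_lt_top (𝓜 := 𝓜) (fun t => (hY t).measurable)
    hXY.cadlag_Y hleft hη.integrable hratio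
  have hpath : ∀ᵐ ω ∂P, 𝓜.IsRegularPath η T (fun s => X s ω) (fun s => Y s ω) := by
    filter_upwards [hXY.cadlag_X, hXY.cadlag_Y, hleft, hclock] with ω h1 h2 h3 h4
    exact ⟨PureJumpFilter.measurable_of_rightContinuous fun s => (h1 s).1,
      PureJumpFilter.measurable_of_rightContinuous fun s => (h2 s).1, h3, h4⟩
  -- The converse direction, P₀ ≪ P, returns the conclusion to the reference probability.
  exact (withDensity_absolutelyContinuous P _).ae_le
    (PureJumpFilter.Model.IsZakaiSolution.ae_eq hP
      (PureJumpFilter.obsFiltration_le_augmentation hY hXY.adapted_Y) hW hN hXY.adapted_Y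
      hXY.cadlag_Y hjump hpath hπ.cadlag hξ hξ')
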